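/- Let $S=\mathbb{Q}_2[h(-1),h(-2),\dots]\mathbf 1$ be the Heisenberg vertex operator algebra over $\mathbb{Q}_2$: $h(k)$ acts by multiplication for $k<0$, as $k\,\partial/\partial h(-k)$ for $k>0$, and $h(0)=0$. It is graded by $\mathrm{wt}\,h(-n_1)\cdots h(-n_r)\mathbf 1=\sum n_i$, with weight spaces $S_{(N)}$. For a state $v=\sum_I a_Ih^I$ put $\nu_2(v)=\inf_I\nu_2(a_I)$, let $|v|=\sup_I|a_I|_2$ be the sup-norm, and let $S_1$ be the completion of $S$ with respect to this norm. Let $$F_S(v,q)=q^{-1/24}\eta(q)\sum_{N\ge0}\mathrm{Tr}_{S_{(N)}}o(v)\,q^N$$ be the normalized character, where $o(v)$ is the weight-preserving mode of the vertex operator $Y(v,z)$, and let $\widehat F_S$ be its continuous linear extension to $S_1$ (with values in $q$-expansions with bounded coefficients in $\mathbb{Q}_2$, with the sup-norm). Let $$\lambda=\Delta(q^2)/\Delta(q)=q\prod_{k\ge1}\left(\frac{1-q^{2k}}{1-q^k}\right)^{24}.$$ Let $h[n]=\mathrm{Res}_z\,Y(h(-1)\mathbf 1,e^z-1)e^zz^n$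 be the square-bracket modes, and for $r,s\ge 0$ (with $(-1)!!=1$) let $$\alpha_r=\frac{(-1)^r}{2^r(2r-1)!!}h[-2]^{2r}\mathbf 1,\qquad \alpha_r\beta_s=\frac{(-1)^r}{2^r(2r-1)!!}\cdot\frac{2^s}{(2s-1)!!}\,h[-2]^{2r}h[-3]^{2s}\mathbf 1 .$$ For $n\ge1$, and for $m$ with $n<2^m$, let $$c_{n,m,i}=\sum_{j=0}^{2^m-n}\binom{n+j}{i}\binom{3\cdot2^m-3n-2j}{j}\frac{3\cdot2^m-3n}{3\cdot2^m-3n-2j}(-1)^{i+j}\,2^{12\cdot2^m-6n-6i+2j}\,3^{6\cdot2^m-3n+i-3j}\,5^{6\cdot2^m-3i}\,7^{2i}$$ and $v_{n,m}=\sum_{i=0}^{2^m+1}c_{n,m,i}\,\alpha_{3\cdot2^m-3i}\beta_{2i}$, where the summand $i=2^m+1$ is zero because $c_{n,m,2^m+1}=0$. Fix $n\ge1$. Then: 1. As $m\to\infty$, $\nu_2\left(c_{n,m+1,i}\,\alpha_{3\cdot2^m}-c_{n,m,i}\mathbf 1\right)-12\cdot2^m+6i\to\infty$ uniformly in $0\le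 i\le2^m+1$. That is, for every $B$ there is an $m_0$ such that for all $m\ge m_0$ and all $0\le i\le 2^m+1$ the left-hand side is at least $B$. 2. The sequence $(v_{n,m})_m$ is Cauchy in $S_1$. 3. The limit $v_n=\lim_{m\to\infty}v_{n,m}\in S_1$ exists and satisfies $\widehat F_S(v_n)=\lambda^n$. -/

import Mathlib

noncomputable section

namespace HeisenbergTwoAdic

open scoped Nat NNReal PowerSeries

/-! ### The Heisenberg vertex operator algebra over `ℚ_2` -/

/-- The Heisenberg VOA `S` over `ℚ_2`, as the symmetric (polynomial) algebra on the
creation operators `h(-1), h(-2), …`: the variable `X k` is `h(-(k+1))`, and the vacuum is `1`.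
A multi-index `I : ℕ →₀ ℕ` stands for the monomial state `h^I = ∏ₖ h(-(k+1))^(I k)`. -/
abbrev Heis : Type := MvPolynomial ℕ ℚ_[2]

/-- The round-bracket modes `h(n)` on `S`: multiplication by the variable `h(n)` for `n < 0`,
zero for `n = 0`, and `n ∂/∂h(-n)` for `n > 0`. -/
def hMode : ℤ → Heis →ₗ[ℚ_[2]] Heis
  | Int.ofNat 0 => 0
  | Int.ofNat (k + 1) => ((k + 1 : ℕ) : ℚ_[2]) • (MvPolynomial.pderiv k).toLinearMap
  | Int.negSucc k => LinearMap.mulLeft ℚ_[2] (MvPolynomial.X k)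

/-- The round-bracket weight of the monomial state `h^I`. -/
def wt (I : ℕ →₀ ℕ) : ℕ := I.sum fun k e => e * (k + 1)

/-- The monomial basis of the (finite-dimensional) weight space `S_(N)`. -/
def monomialsOfWeight (N : ℕ) : Finset (ℕ →₀ ℕ) :=
  ((Finset.range N).finsupp fun _ => Finset.range (N + 1)).filter fun I => wt I = N

theorem mem_monomialsOfWeight {N : ℕ} {I : ℕ →₀ ℕ} : I ∈ monomialsOfWeight N ↔ wt I = N := by
  have key : ∀ k ∈ I.support, I k * (k + 1) ≤ wt I := fun k hk =>
    Finset.single_le_sum (f := fun k => I k * (k + 1)) (fun _ _ => Nat.zero_le _) hk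
  rw [monomialsOfWeight, Finset.mem_filter, Finset.mem_finsupp_iff]
  refine ⟨fun h => h.2, fun h => ⟨⟨fun k hk => ?_, fun k _ => ?_⟩, h⟩⟩
  · have h1 := key k hk
    have h2 : 1 ≤ I k := Nat.one_le_iff_ne_zero.2 (Finsupp.mem_support_iff.1 hk)
    refine Finset.mem_coe.2 (Finset.mem_range.2 ?_)
    nlinarith
  · refine Finset.mem_range.2 ?_
    by_cases hk : k ∈ I.support
    · have h1 := key k hk
      nlinarith
    · rw [Finsupp.notMem_support_iff.1 hk]
      omega

/-- Modes of vertex operators.  For a monomial state `v = h(-k₁) ⋯ h(-kᵣ) 1`, encoded by the list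
`[k₁ - 1, …, kᵣ - 1]`, the vertex operator is the normally ordered product
`Y(v, z) = :∂^(k₁-1) h(z) ⋯ ∂^(kᵣ-1) h(z): = ∑_d (fieldMode [k₁-1, …, kᵣ-1] d) z^(-d - wt v)`
with divided derivatives `∂^(k-1) h(z) = ∑ₙ (-n-1 choose k-1) h(n) z^(-n-k)`; in the normally
ordered product `:a(z) B(z):` the modes `h(n)` of `a(z)` with `n < 0` stand to the left of `B(z)`
and those with `n ≥ 0` to the right.  On each state only finitely many terms of the sum are
non-zero.  The operator `fieldMode L d` lowers the weight by `d`. -/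
def fieldMode : List ℕ → ℤ → Heis → Heis
  | [], d, u => if d = 0 then u else 0
  | a :: L, d, u => ∑ᶠ n : ℤ, Ring.choose (-n - 1) a •
      (if n < 0 then hMode n (fieldMode L (d - n) u) else fieldMode L (d - n) (hMode n u))

/-- The endomorphism `o(v)` of `S` attached to a state `v` that preserves the round-bracket
grading: the weight-preserving mode of `Y(v, z)`, for `v` a combination of monomials. -/
def zeroMode (v u : Heis) : Heis :=
  ∑ I ∈ v.support, MvPolynomial.coeff I v • fieldMode (Finsupp.toMultiset I).toList 0 u

/-- The trace of `o(v)` on the weight space `S_(N)`, computed in its monomial basis. -/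
def trace (v : Heis) (N : ℕ) : ℚ_[2] :=
  ∑ w ∈ monomialsOfWeight N, MvPolynomial.coeff w (zeroMode v (MvPolynomial.monomial w 1))

/-- The power series `q^(-1/24) η(q) = ∏_{k ≥ 1} (1 - q^k)`: its coefficients up to `q^N` are those
of the product over `k ≤ N`. -/
def etaProd : ℚ_[2]⟦X⟧ :=
  PowerSeries.mk fun N =>
    PowerSeries.coeff N (∏ k ∈ Finset.range N, (1 - (PowerSeries.X : ℚ_[2]⟦X⟧) ^ (k + 1)))

/-- The normalized character `F_S(v, q) = η(q) q^(-1/24) ∑_N Tr_{S_(N)} o(v) q^N`. -/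
def character (v : Heis) : ℚ_[2]⟦X⟧ := etaProd * PowerSeries.mk (trace v)

/-! ### Valuation, sup-norm, and the `2`-adic Heisenberg VOA -/

/-- The `2`-adic valuation `ν₂(∑ a_I h^I) = inf_I ν₂(a_I)` of a state (`⊤` for the zero state). -/
def stateVal (v : Heis) : WithTop ℤ :=
  v.support.inf fun I => Padic.addValuation (MvPolynomial.coeff I v)

/-- The sup-norm `|∑ a_I h^I| = sup_I |a_I|`. -/
def supNorm (v : Heis) : ℝ≥0 := v.support.sup fun I => ‖MvPolynomial.coeff I v‖₊

theorem supNorm_le_iff {v : Heis} {C : ℝ≥0} :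
    supNorm v ≤ C ↔ ∀ I, ‖MvPolynomial.coeff I v‖₊ ≤ C := by
  refine Finset.sup_le_iff.trans ⟨fun h I => ?_, fun h I _ => h I⟩
  by_cases hI : I ∈ v.support
  · exact h I hI
  · rw [MvPolynomial.notMem_support_iff.1 hI]
    simp

theorem nnnorm_coeff_le (v : Heis) (I : ℕ →₀ ℕ) : ‖MvPolynomial.coeff I v‖₊ ≤ supNorm v :=
  supNorm_le_iff.1 le_rfl I

theorem supNorm_zero : supNorm 0 = 0 := by
  simp [supNorm]

theorem supNorm_add_le_max (v w : Heis) : supNorm (v + w) ≤ max (supNorm v) (supNorm w) := by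
  refine supNorm_le_iff.2 fun I => ?_
  rw [MvPolynomial.coeff_add]
  exact (Padic.nonarchimedean _ _).trans
    (max_le_max (nnnorm_coeff_le v I) (nnnorm_coeff_le w I))

theorem supNorm_smul (a : ℚ_[2]) (v : Heis) : supNorm (a • v) = ‖a‖₊ * supNorm v := by
  rcases eq_or_ne a 0 with rfl | ha
  · simp [supNorm]
  · have hs : (a • v).support = v.support := by
      ext I
      simp [MvPolynomial.mem_support_iff, ha]
    simp only [supNorm, hs, MvPolynomial.coeff_smul, smul_eq_mul, nnnorm_mul,
      NNReal.mul_finset_sup]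

theorem supNorm_neg (v : Heis) : supNorm (-v) = supNorm v := by
  have h := supNorm_smul (-1) v
  rwa [neg_one_smul, nnnorm_neg, nnnorm_one, one_mul] at h

/-- The space `S` equipped with the sup-norm. -/
def NormedHeis : Type := Heis

instance : AddCommGroup NormedHeis := inferInstanceAs (AddCommGroup Heis)

instance : Module ℚ_[2] NormedHeis := inferInstanceAs (Module ℚ_[2] Heis)

instance : NormedAddCommGroup NormedHeis :=
  AddGroupNorm.toNormedAddCommGroup
    { toFun := fun v => (supNorm v : ℝ)
      map_zero' := by
        exact_mod_cast supNorm_zero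
      add_le' := fun v w => by
        exact_mod_cast (supNorm_add_le_max v w).trans (max_le_add_of_nonneg zero_le zero_le)
      neg' := fun v => congrArg ((↑) : ℝ≥0 → ℝ) (supNorm_neg v)
      eq_zero_of_map_eq_zero' := fun v hv => by
        refine MvPolynomial.ext (v : Heis) 0 fun I => ?_
        have h := nnnorm_coeff_le v I
        rw [NNReal.coe_eq_zero.1 hv] at h
        simpa using h }

instance : NormedSpace ℚ_[2] NormedHeis where
  norm_smul_le a v := by
    refine le_of_eq ?_
    exact (congrArg ((↑) : ℝ≥0 → ℝ) (supNorm_smul a v)).trans (NNReal.coe_mul _ _)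

/-- The `2`-adic Heisenberg VOA `S₁`: the completion of `S` for the sup-norm. -/
abbrev HeisComplete : Type := UniformSpace.Completion NormedHeis

/-- The canonical embedding `S → S₁`. -/
def toComplete (v : Heis) : HeisComplete := UniformSpace.Completion.coe' (α := NormedHeis) v

/-! ### The `2`-adic character map -/

theorem norm_coeff_le (v : Heis) (I : ℕ →₀ ℕ) : ‖MvPolynomial.coeff I v‖ ≤ supNorm v :=
  nnnorm_coeff_le v I

theorem norm_le_of_coeff {v : Heis} {C : ℝ≥0}
    (h : ∀ I, ‖MvPolynomial.coeff I v‖ ≤ C) : supNorm v ≤ C :=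
  supNorm_le_iff.2 fun I => by exact_mod_cast h I

theorem norm_intCast_smul_le (z : ℤ) (v : Heis) : supNorm (z • v) ≤ supNorm v := by
  rw [← Int.cast_smul_eq_zsmul ℚ_[2], supNorm_smul]
  exact mul_le_of_le_one_left zero_le (by exact_mod_cast Padic.norm_int_le_one z)

theorem norm_monomial_one (w : ℕ →₀ ℕ) : supNorm (MvPolynomial.monomial w 1) ≤ 1 := by
  refine norm_le_of_coeff fun I => ?_
  rw [MvPolynomial.coeff_monomial]
  split_ifs <;> simp

theorem norm_hMode_le (n : ℤ) (u : Heis) : supNorm (hMode n u) ≤ supNorm u := by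
  refine norm_le_of_coeff fun I => ?_
  match n with
  | Int.ofNat 0 => simp [hMode]
  | Int.ofNat (k + 1) =>
    have h : MvPolynomial.coeff I (hMode (Int.ofNat (k + 1)) u) =
        ((k + 1 : ℕ) : ℚ_[2]) * (MvPolynomial.coeff (I + Finsupp.single k 1) u
          * ((I k + 1 : ℕ) : ℚ_[2])) := by
      simp [hMode, MvPolynomial.coeff_pderiv]
    rw [h, norm_mul, norm_mul]
    have h1 : ∀ j : ℕ, ‖(j : ℚ_[2])‖ ≤ 1 := fun j => by
      simpa using Padic.norm_int_le_one (p := 2) j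
    exact (mul_le_of_le_one_left (by positivity) (h1 _)).trans
      ((mul_le_of_le_one_right (by positivity) (h1 _)).trans (norm_coeff_le _ _))
  | Int.negSucc k =>
    have h : MvPolynomial.coeff I (hMode (Int.negSucc k) u) =
        if k ∈ I.support then MvPolynomial.coeff (I - Finsupp.single k 1) u else 0 := by
      simp [hMode, MvPolynomial.coeff_X_mul']
    rw [h]
    split_ifs
    · exact norm_coeff_le _ _
    · simp

theorem norm_fieldMode_le (L : List ℕ) : ∀ (d : ℤ) (u : Heis), supNorm (fieldMode L d u) ≤ supNorm u := by
  induction L with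
  | nil =>
    intro d u
    rw [fieldMode]
    split_ifs <;> simp [supNorm_zero]
  | cons a L ih =>
    intro d u
    rw [fieldMode]
    refine finsum_induction (fun v : Heis => supNorm v ≤ supNorm u)
      (by simp [supNorm_zero]) (fun v w hv hw => ?_) fun n => ?_
    · exact (supNorm_add_le_max v w).trans (max_le hv hw)
    · refine (norm_intCast_smul_le _ _).trans ?_
      split_ifs
      · exact (norm_hMode_le _ _).trans (ih _ _)
      · exact (ih _ _).trans (norm_hMode_le _ _)

theorem norm_trace_le (v : Heis) (N : ℕ) : ‖trace v N‖ ≤ supNorm v := by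
  refine IsUltrametricDist.norm_sum_le_of_forall_le_of_nonneg NNReal.zero_le_coe fun w _ => ?_
  rw [zeroMode, MvPolynomial.coeff_sum]
  refine IsUltrametricDist.norm_sum_le_of_forall_le_of_nonneg NNReal.zero_le_coe fun I _ => ?_
  rw [MvPolynomial.coeff_smul, smul_eq_mul, norm_mul]
  refine (mul_le_of_le_one_right (norm_nonneg _) ?_).trans (norm_coeff_le v I)
  refine (norm_coeff_le _ _).trans ?_
  exact_mod_cast (norm_fieldMode_le _ _ _).trans (norm_monomial_one w)

theorem norm_coeff_etaProd_le (N : ℕ) : ‖PowerSeries.coeff N etaProd‖ ≤ 1 := by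
  have h : (∏ k ∈ Finset.range N, (1 - (PowerSeries.X : ℚ_[2]⟦X⟧) ^ (k + 1))) =
      PowerSeries.map (Int.castRingHom ℚ_[2])
        (∏ k ∈ Finset.range N, (1 - (PowerSeries.X : ℤ⟦X⟧) ^ (k + 1))) := by
    simp
  rw [etaProd, PowerSeries.coeff_mk, h, PowerSeries.coeff_map]
  exact Padic.norm_int_le_one _

theorem norm_coeff_character_le (v : Heis) (N : ℕ) :
    ‖PowerSeries.coeff N (character v)‖ ≤ supNorm v := by
  rw [character, PowerSeries.coeff_mul]
  refine IsUltrametricDist.norm_sum_le_of_forall_le_of_nonneg NNReal.zero_le_coe fun p _ => ?_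
  rw [norm_mul, PowerSeries.coeff_mk]
  exact (mul_le_of_le_one_left (norm_nonneg _) (norm_coeff_etaProd_le _)).trans (norm_trace_le v _)

theorem zeroMode_eq_sum {v : Heis} {T : Finset (ℕ →₀ ℕ)} (hT : v.support ⊆ T) (u : Heis) :
    zeroMode v u =
      ∑ I ∈ T, MvPolynomial.coeff I v • fieldMode (Finsupp.toMultiset I).toList 0 u :=
  Finset.sum_subset hT fun I _ hI => by
    rw [MvPolynomial.notMem_support_iff.1 hI, zero_smul]

theorem zeroMode_add (v w u : Heis) : zeroMode (v + w) u = zeroMode v u + zeroMode w u := by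
  classical
  rw [zeroMode_eq_sum (MvPolynomial.support_add (p := v) (q := w)),
    zeroMode_eq_sum (Finset.subset_union_left (s₂ := w.support)),
    zeroMode_eq_sum (Finset.subset_union_right (s₁ := v.support)), ← Finset.sum_add_distrib]
  exact Finset.sum_congr rfl fun I _ => by rw [MvPolynomial.coeff_add, add_smul]

theorem zeroMode_smul (a : ℚ_[2]) (v u : Heis) : zeroMode (a • v) u = a • zeroMode v u := by
  rw [zeroMode_eq_sum (MvPolynomial.support_smul (a := a) (f := v)), zeroMode, Finset.smul_sum]
  exact Finset.sum_congr rfl fun I _ => by rw [MvPolynomial.coeff_smul, smul_assoc]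

theorem trace_add (v w : Heis) : trace (v + w) = trace v + trace w := by
  funext N
  simp [trace, zeroMode_add, Finset.sum_add_distrib]

theorem trace_smul (a : ℚ_[2]) (v : Heis) : trace (a • v) = a • trace v := by
  funext N
  simp [trace, zeroMode_smul, Finset.mul_sum]

theorem character_add (v w : Heis) : character (v + w) = character v + character w := by
  rw [character, trace_add, character, character, ← mul_add]
  rfl

theorem character_smul (a : ℚ_[2]) (v : Heis) : character (a • v) = a • character v := by
  rw [character, trace_smul, character, ← mul_smul_comm]
  rfl

/-- The character map `F_S` as a continuous linear map from `S`, with the sup-norm, to the Banach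
space of `q`-expansions with bounded coefficients in `ℚ_2`, with the sup-norm (the space in which
`2`-adic modular forms are limits of modular forms). A `q`-expansion is given by its sequence of
coefficients. -/
def characterCLM : NormedHeis →L[ℚ_[2]] BoundedContinuousFunction ℕ ℚ_[2] :=
  LinearMap.mkContinuous (σ := RingHom.id ℚ_[2])
    { toFun := fun v => BoundedContinuousFunction.ofNormedAddCommGroupDiscrete
        (fun N => PowerSeries.coeff N (character v)) (supNorm v) (norm_coeff_character_le v)
      map_add' := fun v w => by
        ext N
        exact congrArg (PowerSeries.coeff N) (character_add v w)
      map_smul' := fun a v => by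
        ext N
        exact congrArg (PowerSeries.coeff N) (character_smul a v) }
    1 fun v => by
      rw [one_mul]
      exact (BoundedContinuousFunction.norm_le (norm_nonneg v)).2 (norm_coeff_character_le v)

/-- The `2`-adic character map on `S₁`: the continuous linear extension of `F_S`. -/
def characterHat : HeisComplete →L[ℚ_[2]] BoundedContinuousFunction ℕ ℚ_[2] :=
  characterCLM.extend (UniformSpace.Completion.toComplL : NormedHeis →L[ℚ_[2]] HeisComplete)

theorem characterHat_toComplete (v : Heis) : characterHat (toComplete v) = characterCLM v :=
  ContinuousLinearMap.extend_eq
    (e := (UniformSpace.Completion.toComplL : NormedHeis →L[ℚ_[2]] HeisComplete))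
    characterCLM UniformSpace.Completion.denseRange_coe
    (UniformSpace.Completion.isUniformInducing_coe NormedHeis) v

/-! ### Square-bracket modes and the pre-images -/

/-- The number `Res_z (e^z - 1)^(-k-1) e^z z^n`. -/
def sqCoeff (n k : ℤ) : ℚ_[2] :=
  ((((PowerSeries.exp ℚ_[2] - 1 : ℚ_[2]⟦X⟧) : LaurentSeries ℚ_[2]) ^ (-k - 1)) *
    ((PowerSeries.exp ℚ_[2] : ℚ_[2]⟦X⟧) : LaurentSeries ℚ_[2]) *
    (HahnSeries.single n 1 : LaurentSeries ℚ_[2])).coeff (-1)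

/-- The square-bracket mode
`h[n] = Res_z Y(h(-1)1, e^z - 1) e^z z^n = ∑ₖ (Res_z (e^z - 1)^(-k-1) e^z z^n) h(k)`.
On each state only finitely many terms are non-zero. -/
def hSq (n : ℤ) (u : Heis) : Heis := ∑ᶠ k : ℤ, sqCoeff n k • hMode k u

/-- The scalar `(-1)^r / (2^r (2r-1)!!)`, with `(-1)!! = 1`. -/
def alphaScalar (r : ℕ) : ℚ_[2] := (-1) ^ r / (2 ^ r * ((2 * r - 1)‼ : ℕ))

/-- The scalar `2^s / (2s-1)!!`, with `(-1)!! = 1`. -/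
def betaScalar (s : ℕ) : ℚ_[2] := 2 ^ s / ((2 * s - 1)‼ : ℕ)

/-- The state `α_r = (-1)^r / (2^r (2r-1)!!) h[-2]^(2r) 1`. -/
def alpha (r : ℕ) : Heis := alphaScalar r • (hSq (-2))^[2 * r] 1

/-- The state `α_r β_s = (-1)^r / (2^r (2r-1)!!) * 2^s / (2s-1)!! h[-2]^(2r) h[-3]^(2s) 1`. -/
def alphaBeta (r s : ℕ) : Heis :=
  (alphaScalar r * betaScalar s) • (hSq (-2))^[2 * r] ((hSq (-3))^[2 * s] 1)

/-- The numbers `Ψ_{n,m,i,j}`. They are used for `j ≤ 2^m - n`, where for `n < 2^m` no natural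
number subtraction is truncated. -/
def Psi (n m i j : ℕ) : ℚ_[2] :=
  ((n + j).choose i : ℚ_[2]) * ((3 * 2 ^ m - 3 * n - 2 * j).choose j : ℚ_[2]) *
    ((3 * 2 ^ m - 3 * n) / (3 * 2 ^ m - 3 * n - 2 * j)) * (-1) ^ (i + j) *
    2 ^ (12 * 2 ^ m - 6 * n - 6 * i + 2 * j : ℤ) * 3 ^ (6 * 2 ^ m - 3 * n + i - 3 * j : ℤ) *
    5 ^ (6 * 2 ^ m - 3 * i : ℤ) * 7 ^ (2 * i)

/-- The coefficients `c_{n,m,i} = ∑_{0 ≤ j ≤ 2^m - n} Ψ_{n,m,i,j}` (an empty sum if `n > 2^m`). -/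
def cCoeff (n m i : ℕ) : ℚ_[2] := ∑ j ∈ Finset.range (2 ^ m + 1 - n), Psi n m i j

/-- The states `v_{n,m} = ∑_{0 ≤ i ≤ 2^m + 1} c_{n,m,i} α_{3·2^m - 3i} β_{2i}`. The summand
`i = 2^m + 1` is zero, since `c_{n,m,i} = 0` there. -/
def preimage (n m : ℕ) : Heis :=
  ∑ i ∈ Finset.range (2 ^ m + 2), cCoeff n m i • alphaBeta (3 * 2 ^ m - 3 * i) (2 * i)

/-- The `q`-expansion of the Hauptmodul
`λ = Δ(q²)/Δ(q) = (η(q²)/η(q))^24 = q ∏_{k ≥ 1} ((1 - q^(2k))/(1 - q^k))^24`. -/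
def hauptmodul : ℚ_[2]⟦X⟧ :=
  PowerSeries.X * (PowerSeries.expand 2 two_ne_zero etaProd * etaProd⁻¹) ^ 24

end HeisenbergTwoAdic

end

/-! Write E₄ = 1 + 240 Σ σ₃(n) qⁿ, E₆ = 1 - 504 Σ σ₅(n) qⁿ and L = 2^m - n.

Characters. The graded trace of a normally ordered product is computed by Wick's theorem
(`thermal_X_mul`, `thermal_pow_mul_pow`). The fields of h[-2] and h[-3] contract with themselves to
multiples of Σ σ₃(n) qⁿ and Σ σ₅(n) qⁿ, and do not contract with each other. The annihilation parts
of these modes supply the constant terms, so α_r β_s has character (E₄/240)^r (-E₆/504)^s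
(`character_alphaBeta`).

Collapse of the sum. Once 240^(3·2^m-3i) 504^(2i) is taken out of c_{n,m,i} (`cCoeff_eq`), the sum
over i is a binomial expansion of (E₄³ - E₆²)^(n+j) = (1728 Δ)^(n+j). What remains is 15^(3·2^m) Δⁿ
Σⱼ a_j E₄^(3(L-j)) (-256 Δ)^j with Waring's coefficients a_j (`character_preimage`). Put w = 1/(1 +
256 λ). The modular equation E₄³ λ = Δ (1 + 256 λ)³ gives Δ = E₄³ λ w³ and 256 Δ = E₄³ (w² - w³), so
the sum over j is E₄^(3L) times the sum of the 3L-th powers of the roots of Y³ - Y² + (w² - w³). One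
root is w. The other two have sum 1 - w and product -w(1 - w), both divisible by q, so they
contribute only O(q^⌊3L/2⌋). Up to this error the character is λⁿ (15 E₄ w)^(3·2^m)
(`character_preimage_eq`). Since (15 E₄ w)³ ≡ 1 mod 2, its 2^m-th powers tend to 1, and each
q-coefficient tends to that of λⁿ.

Convergence in S₁. The rescaled coefficients are at most 256ⁿ 4^(-i) in norm, uniformly in m, and
change by amounts tending to 0 because their terms depend continuously on 3·2^m in ℤ₂. The rescaled
states have norm at most 1, and raising r by 3·2^m changes them by at most 2^(-m-1). In an
ultrametric space this makes the sequence Cauchy. The same estimates give the first assertion, as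
240^(3·2^m-3i) 504^(2i) has valuation 12·2^m - 6i.

Modular equation. 4096 λ and its two conjugates are permuted by SL(2, ℤ). Their symmetric functions
are found from their behaviour at i∞: the first and third are constants, and the second is 768 - j.
-/

noncomputable section
namespace HeisenbergTwoAdic
open scoped Nat NNReal PowerSeries

/-! ### Evaluation of complex power series on the unit disc -/

/-- The power series `f` converges on the open unit disc to the function `F`. -/
def EvaluatesTo (f : ℂ⟦X⟧) (F : ℂ → ℂ) : Prop :=
  ∀ q : ℂ, ‖q‖ < 1 → HasSum (fun n => PowerSeries.coeff n f * q ^ n) (F q)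

namespace EvaluatesTo

variable {f g : ℂ⟦X⟧} {F G : ℂ → ℂ}

theorem hasFPowerSeriesOnBall (hf : EvaluatesTo f F) :
    HasFPowerSeriesOnBall F (.ofScalars ℂ fun n => PowerSeries.coeff n f) 0 1 := by
  refine ⟨?_, one_pos, fun {y} hy => ?_⟩
  · refine le_of_forall_lt_imp_le_of_dense fun r hr => ?_
    lift r to ℝ≥0 using hr.ne_top
    apply FormalMultilinearSeries.le_radius_of_summable
    simpa [mul_comm, mul_left_comm, mul_assoc] using
      (hf (r : ℂ) (by simpa using hr)).summable.norm
  · rw [← ENNReal.coe_one, Metric.eball_coe, NNReal.coe_one, mem_ball_zero_iff] at hy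
    simpa [mul_comm] using hf y hy

theorem coeff_eq (hf : EvaluatesTo f F) (n : ℕ) :
    PowerSeries.coeff n f = iteratedDeriv n F 0 / n ! := by
  have h1 := hf.hasFPowerSeriesOnBall.hasFPowerSeriesAt
  have h2 := h1.analyticAt.hasFPowerSeriesAt
  have h3 := congrArg (FormalMultilinearSeries.coeff · n) (h1.eq_formalMultilinearSeries h2)
  simpa [FormalMultilinearSeries.coeff_ofScalars] using h3

/-- Both series are the Taylor expansion at 0 of one function. This turns identities between modular
forms into identities of formal power series. -/
theorem eq_of_eqOn (hf : EvaluatesTo f F) (hg : EvaluatesTo g G)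
    (h : ∀ q : ℂ, ‖q‖ < 1 → F q = G q) : f = g := by
  have hg' : EvaluatesTo g F := fun q hq => h q hq ▸ hg q hq
  ext n
  rw [hf.coeff_eq, hg'.coeff_eq]

theorem of_differentiableOn (hF : DifferentiableOn ℂ F (Metric.ball 0 1))
    (h : ∀ n, PowerSeries.coeff n f = iteratedDeriv n F 0 / n !) : EvaluatesTo f F := fun q hq => by
  have := Complex.hasSum_taylorSeries_on_ball hF (z := q) (by simpa using hq)
  convert! this using 2 with n
  rw [h]
  simp only [sub_zero, smul_eq_mul]
  ring

theorem differentiableOn (hf : EvaluatesTo f F) : DifferentiableOn ℂ F (Metric.ball 0 1) := by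
  have := hf.hasFPowerSeriesOnBall.differentiableOn
  rwa [← ENNReal.coe_one, Metric.eball_coe, NNReal.coe_one] at this

theorem add (hf : EvaluatesTo f F) (hg : EvaluatesTo g G) :
    EvaluatesTo (f + g) (fun q => F q + G q) := fun q hq => by
  simpa [add_mul] using (hf q hq).add (hg q hq)

theorem const (a : ℂ) : EvaluatesTo (PowerSeries.C a) (fun _ => a) := fun q _ => by
  have := hasSum_single (f := fun n => PowerSeries.coeff n (PowerSeries.C a) * q ^ n) 0
    (fun n hn => by simp [PowerSeries.coeff_C, hn])
  simpa using this

theorem X : EvaluatesTo (PowerSeries.X : ℂ⟦X⟧) (fun q => q) := fun q _ => by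
  have := hasSum_single (f := fun n => PowerSeries.coeff n (PowerSeries.X : ℂ⟦X⟧) * q ^ n) 1
    (fun n hn => by simp [PowerSeries.coeff_X, hn])
  simpa using this

theorem mul (hf : EvaluatesTo f F) (hg : EvaluatesTo g G) :
    EvaluatesTo (f * g) (fun q => F q * G q) := fun q hq => by
  have h1 := (hf q hq).summable.norm
  have h2 := (hg q hq).summable.norm
  have h3 := (summable_norm_sum_mul_antidiagonal_of_summable_norm h1 h2).of_norm.hasSum
  rw [← tsum_mul_tsum_eq_tsum_sum_antidiagonal_of_summable_norm h1 h2, (hf q hq).tsum_eq,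
    (hg q hq).tsum_eq] at h3
  convert! h3 using 2 with n
  rw [PowerSeries.coeff_mul, Finset.sum_mul]
  refine Finset.sum_congr rfl fun p hp => ?_
  rw [← Finset.HasAntidiagonal.mem_antidiagonal.1 hp, pow_add]
  ring

theorem one : EvaluatesTo 1 (fun _ => 1) := by
  simpa using const 1

theorem pow (hf : EvaluatesTo f F) (n : ℕ) : EvaluatesTo (f ^ n) (fun q => F q ^ n) := by
  induction n with
  | zero => simpa using one
  | succ n ih => simpa only [pow_succ] using ih.mul hf

theorem sub (hf : EvaluatesTo f F) (hg : EvaluatesTo g G) :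
    EvaluatesTo (f - g) (fun q => F q - G q) := fun q hq => by
  simpa [sub_mul] using (hf q hq).sub (hg q hq)

theorem expand_two (hf : EvaluatesTo f F) :
    EvaluatesTo (PowerSeries.expand 2 two_ne_zero f) (fun q => F (q ^ 2)) := fun q hq => by
  have h := hf (q ^ 2) (by rw [norm_pow]; exact pow_lt_one₀ (norm_nonneg _) hq two_ne_zero)
  have hinj : Function.Injective (fun n : ℕ => 2 * n) := fun a b h => by simpa using h
  rw [← hinj.hasSum_iff (fun n hn => ?_)]
  · convert h using 2 with n
    simp [PowerSeries.coeff_expand, pow_mul]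
  · rw [PowerSeries.coeff_expand, if_neg, zero_mul]
    rintro ⟨m, rfl⟩
    exact hn ⟨m, rfl⟩

theorem prod_one_sub (s : Finset ℕ) :
    EvaluatesTo (∏ k ∈ s, (1 - (PowerSeries.X : ℂ⟦X⟧) ^ (k + 1)))
      (fun q => ∏ k ∈ s, (1 - q ^ (k + 1))) := by
  classical
  induction s using Finset.induction_on with
  | empty => simpa using one
  | insert a s ha ih =>
    simp only [Finset.prod_insert ha]
    exact (one.sub (X.pow _)).mul ih

end EvaluatesTo

/-! ### The Euler product as a power series -/

/-- The power series `∏ (1 - q^k)` over a commutative ring. -/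
def eulerSeries (R : Type*) [CommRing R] : R⟦X⟧ :=
  PowerSeries.mk fun N =>
    PowerSeries.coeff N (∏ k ∈ Finset.range N, (1 - (PowerSeries.X : R⟦X⟧) ^ (k + 1)))

theorem map_eulerSeries {R S : Type*} [CommRing R] [CommRing S] (ψ : R →+* S) :
    PowerSeries.map ψ (eulerSeries R) = eulerSeries S := by
  ext N
  rw [PowerSeries.coeff_map, eulerSeries, eulerSeries, PowerSeries.coeff_mk, PowerSeries.coeff_mk,
    ← PowerSeries.coeff_map]
  simp

/-- The factors with k ≥ N are 1 modulo X^(N+1), so including more of them leaves the coefficient of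
X^N alone. -/
theorem coeff_eulerSeries {R : Type*} [CommRing R] {N : ℕ} {s : Finset ℕ}
    (hs : Finset.range N ⊆ s) :
    PowerSeries.coeff N (∏ k ∈ s, (1 - (PowerSeries.X : R⟦X⟧) ^ (k + 1))) =
      PowerSeries.coeff N (eulerSeries R) := by
  have key : ∀ t : Finset ℕ, (∀ k ∈ t, N ≤ k) →
      ∃ r : R⟦X⟧, ∏ k ∈ t, (1 - (PowerSeries.X : R⟦X⟧) ^ (k + 1)) =
        1 + PowerSeries.X ^ (N + 1) * r := by
    intro t
    induction t using Finset.induction_on with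
    | empty => exact fun _ => ⟨0, by simp⟩
    | insert a t ha ih =>
      intro h
      obtain ⟨r, hr⟩ := ih fun k hk => h k (Finset.mem_insert_of_mem hk)
      obtain ⟨d, hd⟩ := Nat.exists_eq_add_of_le (h a (Finset.mem_insert_self _ _))
      refine ⟨r - PowerSeries.X ^ d * (1 + PowerSeries.X ^ (N + 1) * r), ?_⟩
      rw [Finset.prod_insert ha, hr, hd, show N + d + 1 = N + 1 + d by ring, pow_add]
      ring
  obtain ⟨r, hr⟩ := key (s \ Finset.range N) fun k hk => by
    simpa using (Finset.mem_sdiff.1 hk).2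
  rw [eulerSeries, PowerSeries.coeff_mk, ← Finset.prod_sdiff hs, hr, add_mul, one_mul, map_add,
    mul_assoc, PowerSeries.coeff_X_pow_mul', if_neg (by omega), add_zero]

theorem iteratedDeriv_tendstoLocallyUniformlyOn {ι : Type*} {l : Filter ι} {F : ι → ℂ → ℂ}
    {f : ℂ → ℂ} {U : Set ℂ} (hU : IsOpen U) (h : TendstoLocallyUniformlyOn F f l U)
    (hF : ∀ i, DifferentiableOn ℂ (F i) U) (n : ℕ) :
    TendstoLocallyUniformlyOn (fun i => iteratedDeriv n (F i)) (iteratedDeriv n f) l U := by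
  have hd : ∀ (n : ℕ) (i : ι), DifferentiableOn ℂ (iteratedDeriv n (F i)) U := by
    intro n i
    induction n with
    | zero => simpa using hF i
    | succ n ih =>
      rw [iteratedDeriv_succ]
      exact ih.deriv hU
  induction n with
  | zero => simpa using h
  | succ n ih =>
    simp only [iteratedDeriv_succ]
    exact ih.deriv (Filter.Eventually.of_forall fun i => hd n i) hU

/-- Locally uniform convergence of the partial products passes to the derivatives at 0, and each
Taylor coefficient of the partial products is eventually constant. -/
theorem evaluatesTo_eulerSeries :
    EvaluatesTo (eulerSeries ℂ) (fun q => ∏' n : ℕ, (1 - q ^ (n + 1))) := by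
  refine EvaluatesTo.of_differentiableOn ModularForm.differentiableOn_tprod_one_sub_pow
    fun n => ?_
  have h := iteratedDeriv_tendstoLocallyUniformlyOn Metric.isOpen_ball
    ModularForm.multipliableLocallyUniformlyOn_one_sub_pow.hasProdLocallyUniformlyOn
    (fun s => (EvaluatesTo.prod_one_sub s).differentiableOn) n
  have h0 := (h.tendsto_at (a := 0) (by simp)).div_const (n ! : ℂ)
  refine tendsto_nhds_unique (Filter.Tendsto.congr' ?_ tendsto_const_nhds) h0
  filter_upwards [Filter.eventually_ge_atTop (Finset.range n)] with s hs
  rw [← (EvaluatesTo.prod_one_sub s).coeff_eq, coeff_eulerSeries hs]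

end HeisenbergTwoAdic
end

noncomputable section
namespace HeisenbergTwoAdic
open scoped Nat NNReal PowerSeries

/-! ### The modular relation between `j` and `λ` -/

section Modular

open UpperHalfPlane hiding I
open ModularForm Complex MatrixGroups Filter Topology

/-- A holomorphic `SL(2, ℤ)`-invariant function with a limit at `i∞` is constant. -/
theorem eq_of_levelOne_weight_zero {F : ℂ → ℂ} {c : ℂ}
    (hF : DifferentiableOn ℂ F {z | 0 < z.im})
    (hS : ∀ z : ℂ, 0 < z.im → F (-z⁻¹) = F z) (hT : ∀ z : ℂ, 0 < z.im → F (1 + z) = F z)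
    (hlim : Tendsto F (comap Complex.im atTop) (𝓝 c)) {z : ℂ} (hz : 0 < z.im) : F z = c := by
  set f : ℍ → ℂ := fun z => F z with hf
  have hfS : f ∣[(0 : ℤ)] ModularGroup.S = f := by
    ext z
    rw [SL_slash_apply, UpperHalfPlane.modular_S_smul]
    simpa [hf] using hS z z.im_pos
  have hfT : f ∣[(0 : ℤ)] ModularGroup.T = f := by
    ext z
    rw [SL_slash_apply, modular_T_smul]
    simpa [hf] using hT z z.im_pos
  -- S and T generate the group, so invariance holds throughout, and the limit at i∞ then bounds f
  -- at every cusp.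
  have hγ := SlashInvariantForm.slash_action_generators_SL2Z hfS hfT
  have hlim' : Tendsto f atImInfty (𝓝 c) := hlim.comp tendsto_coe_atImInfty
  let M : ModularForm 𝒮ℒ 0 :=
    { toFun := f
      slash_action_eq' := fun A hA => by
        obtain ⟨A, rfl⟩ := hA
        exact hγ A
      holo' := by
        rw [UpperHalfPlane.mdifferentiable_iff]
        refine hF.congr fun z hz => ?_
        simp [hf, ofComplex_apply_of_im_pos hz]
      bdd_at_cusps' := fun hc => by
        rw [Subgroup.IsArithmetic.isCusp_iff_isCusp_SL2Z] at hc
        rw [OnePoint.isBoundedAt_iff_forall_SL2Z hc]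
        intro γ _
        rw [hγ]
        exact hlim'.isBigO_one ℝ }
  obtain ⟨d, hd⟩ := ModularFormClass.levelOne_weight_zero_const M
  have hd' : f = Function.const _ d := hd
  have : d = c := by
    rw [hd'] at hlim'
    exact tendsto_nhds_unique (tendsto_const_nhds (f := atImInfty)) hlim'
  rw [← this]
  exact congrFun hd' ⟨z, hz⟩

/-- The `24`-th power of the Euler product. -/
def eulerFun (q : ℂ) : ℂ := (∏' n : ℕ, (1 - q ^ (n + 1))) ^ 24

/-- The 24th power removes roots of unity and square roots from the transformation laws of η. -/
theorem eta_pow_eq {z : ℂ} (hz : 0 < z.im) :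
    η z ^ 24 = cexp (2 * Real.pi * I * z) * eulerFun (cexp (2 * Real.pi * I * z)) := by
  have h := discriminant_eq_q_prod ⟨z, hz⟩
  have hm := (multipliableLocallyUniformlyOn_eta.multipliable hz).tprod_pow 24
  simp only [discriminant, hm] at h
  simpa [eulerFun, Function.Periodic.qParam, eta_q] using h

theorem eta_pow_one_add {z : ℂ} (hz : 0 < z.im) : η (1 + z) ^ 24 = η z ^ 24 := by
  rw [eta_pow_eq hz, eta_pow_eq (by simpa using hz)]
  have : cexp (2 * Real.pi * I * (1 + z)) = cexp (2 * Real.pi * I * z) := by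
    rw [mul_add, mul_one, Complex.exp_add, Complex.exp_two_pi_mul_I, one_mul]
  rw [this]

theorem eta_pow_neg_inv {z : ℂ} (hz : 0 < z.im) : η (-z⁻¹) ^ 24 = z ^ 12 * η z ^ 24 := by
  have h := congrFun discriminant_S_invariant ⟨z, hz⟩
  rw [SL_slash_apply, UpperHalfPlane.modular_S_smul] at h
  have hz0 : z ≠ 0 := fun h => by simp [h] at hz
  rw [ModularGroup.denom_S] at h
  have h' : η (-z)⁻¹ ^ 24 * z ^ (-12 : ℤ) = η z ^ 24 := h
  rw [inv_neg] at h'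
  rw [← h']
  field_simp

theorem eta_pow_ne_zero {z : ℂ} (hz : 0 < z.im) : η z ^ 24 ≠ 0 := pow_ne_zero _ (eta_ne_zero hz)

theorem im_neg_inv_pos {z : ℂ} (hz : 0 < z.im) : 0 < (-z⁻¹).im := by
  have h0 : z ≠ 0 := fun h => by simp [h] at hz
  simp only [Complex.neg_im, Complex.inv_im, neg_div, neg_neg]
  exact div_pos hz (Complex.normSq_pos.2 h0)

theorem im_div_two {z : ℂ} (hz : 0 < z.im) : 0 < (z / 2).im := by
  rw [show z / 2 = ((1 / 2 : ℝ) : ℂ) * z by push_cast; ring, Complex.im_ofReal_mul]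
  positivity

theorem im_mul_two {z : ℂ} (hz : 0 < z.im) : 0 < (2 * z).im := by
  simpa using hz

theorem im_one_add_div_two {z : ℂ} (hz : 0 < z.im) : 0 < ((1 + z) / 2).im :=
  im_div_two (by simpa using hz)

/-- The three conjugates of `4096 λ` over the field of level one modular functions. -/
def lambdaConj (i : Fin 3) (z : ℂ) : ℂ :=
  match i with
  | 0 => 4096 * (η (2 * z) ^ 24 / η z ^ 24)
  | 1 => η (z / 2) ^ 24 / η z ^ 24
  | 2 => η ((1 + z) / 2) ^ 24 / η z ^ 24

/-- T and S (`lambdaConj_neg_inv`) permute the three functions, so their elementary symmetric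
functions are invariant under SL(2, ℤ). -/
theorem lambdaConj_one_add {z : ℂ} (hz : 0 < z.im) :
    lambdaConj 0 (1 + z) = lambdaConj 0 z ∧ lambdaConj 1 (1 + z) = lambdaConj 2 z ∧
      lambdaConj 2 (1 + z) = lambdaConj 1 z := by
  refine ⟨?_, ?_, ?_⟩
  · simp only [lambdaConj]
    rw [eta_pow_one_add hz, show 2 * (1 + z) = 1 + (1 + 2 * z) by ring,
      eta_pow_one_add (by simpa using hz), eta_pow_one_add (by simpa using hz)]
  · simp only [lambdaConj]
    rw [eta_pow_one_add hz]
  · simp only [lambdaConj]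
    rw [eta_pow_one_add hz, show (1 + (1 + z)) / 2 = 1 + z / 2 by ring,
      eta_pow_one_add (im_div_two hz)]

/-- With u = (1 - z⁻¹)/2 one has -((z-1)/2)⁻¹ = 2 - u⁻¹ and uz = (z-1)/2. The inversion formula at u
and at (z-1)/2 therefore concerns the same values, and u¹² cancels. -/
theorem eta_pow_half_sub {z : ℂ} (hz : 0 < z.im) :
    η ((1 + -z⁻¹) / 2) ^ 24 = z ^ 12 * η ((1 + z) / 2) ^ 24 := by
  have hz0 : z ≠ 0 := fun h => by simp [h] at hz
  set u := (1 + -z⁻¹) / 2 with hu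
  have hui : 0 < u.im := im_one_add_div_two (im_neg_inv_pos hz)
  have hu0 : u ≠ 0 := fun h => by simp [h] at hui
  have hw : 0 < ((z - 1) / 2).im := im_div_two (by simpa using hz)
  have hw0 : z - 1 ≠ 0 := fun h => by simp [h] at hw
  have h1 := eta_pow_neg_inv hui
  have h2 := eta_pow_neg_inv hw
  have h3 := eta_pow_one_add hw
  have e1 : -((z - 1) / 2)⁻¹ = 1 + (1 + -u⁻¹) := by
    have : u = (z - 1) / (2 * z) := by rw [hu]; field_simp; ring
    rw [this]
    field_simp
    ring
  have e2 : 1 + (z - 1) / 2 = (1 + z) / 2 := by ring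
  rw [e1, eta_pow_one_add (by simpa using im_neg_inv_pos hui),
    eta_pow_one_add (im_neg_inv_pos hui), h1, ← h3, e2] at h2
  have e3 : u * z = (z - 1) / 2 := by rw [hu]; field_simp; ring
  rw [← e3, mul_pow, mul_assoc] at h2
  exact mul_left_cancel₀ (pow_ne_zero 12 hu0) h2

theorem lambdaConj_neg_inv {z : ℂ} (hz : 0 < z.im) :
    lambdaConj 0 (-z⁻¹) = lambdaConj 1 z ∧ lambdaConj 1 (-z⁻¹) = lambdaConj 0 z ∧
      lambdaConj 2 (-z⁻¹) = lambdaConj 2 z := by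
  have hz0 : z ≠ 0 := fun h => by simp [h] at hz
  have hη := eta_pow_ne_zero hz
  refine ⟨?_, ?_, ?_⟩
  · simp only [lambdaConj]
    rw [eta_pow_neg_inv hz, show 2 * (-z⁻¹) = -(z / 2)⁻¹ by field_simp,
      eta_pow_neg_inv (im_div_two hz)]
    field_simp
    norm_num
  · simp only [lambdaConj]
    rw [eta_pow_neg_inv hz, show -z⁻¹ / 2 = -(2 * z)⁻¹ by field_simp,
      eta_pow_neg_inv (im_mul_two hz)]
    field_simp
    ring
  · simp only [lambdaConj]
    rw [eta_pow_neg_inv hz, eta_pow_half_sub hz]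
    field_simp

theorem differentiableOn_eta_pow : DifferentiableOn ℂ (fun z => η z ^ 24) {z | 0 < z.im} :=
  fun _ hz => ((differentiableAt_eta_of_mem_upperHalfPlaneSet hz).pow 24).differentiableWithinAt

theorem differentiableOn_lambdaConj (i : Fin 3) :
    DifferentiableOn ℂ (lambdaConj i) {z | 0 < z.im} := by
  have h := differentiableOn_eta_pow
  have h0 : ∀ z ∈ {z : ℂ | 0 < z.im}, η z ^ 24 ≠ 0 := fun z hz => eta_pow_ne_zero hz
  fin_cases i
  · exact ((h.comp (f := fun z : ℂ => 2 * z) (by fun_prop) fun z hz => im_mul_two hz).div h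
      h0).const_mul 4096
  · exact (h.comp (f := fun z : ℂ => z / 2) (by fun_prop) fun z hz => im_div_two hz).div h h0
  · exact (h.comp (f := fun z : ℂ => (1 + z) / 2) (by fun_prop)
      fun z hz => im_one_add_div_two hz).div h h0

/-- `p = exp (π i z)`, the square root of `q`. -/
def halfNome (z : ℂ) : ℂ := cexp (Real.pi * I * z)

theorem exp_eq_halfNome_sq (z : ℂ) : cexp (2 * Real.pi * I * z) = halfNome z ^ 2 := by
  rw [halfNome, ← Complex.exp_nat_mul]
  congr 1
  push_cast
  ring

theorem halfNome_ne_zero (z : ℂ) : halfNome z ≠ 0 := Complex.exp_ne_zero _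

theorem tendsto_halfNome : Tendsto halfNome (comap Complex.im atTop) (𝓝[≠] 0) := by
  refine tendsto_nhdsWithin_of_tendsto_nhds_of_eventually_within _ ?_
    (Eventually.of_forall halfNome_ne_zero)
  rw [tendsto_zero_iff_norm_tendsto_zero]
  have : ∀ z, ‖halfNome z‖ = Real.exp (-(Real.pi * z.im)) := fun z => by
    simp [halfNome, Complex.norm_exp]
  simp only [this]
  exact Real.tendsto_exp_neg_atTop_nhds_zero.comp
    ((tendsto_id.const_mul_atTop Real.pi_pos).comp tendsto_comap)

theorem lambdaConj_zero_eq {z : ℂ} (hz : 0 < z.im) :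
    lambdaConj 0 z =
      4096 * halfNome z ^ 2 * (eulerFun (halfNome z ^ 4) / eulerFun (halfNome z ^ 2)) := by
  have h1 : cexp (2 * Real.pi * I * (2 * z)) = halfNome z ^ 4 := by
    rw [halfNome, ← Complex.exp_nat_mul]
    congr 1
    push_cast
    ring
  simp only [lambdaConj]
  rw [eta_pow_eq hz, eta_pow_eq (im_mul_two hz), h1, exp_eq_halfNome_sq]
  have := halfNome_ne_zero z
  field_simp

theorem lambdaConj_one_eq {z : ℂ} (hz : 0 < z.im) :
    lambdaConj 1 z = eulerFun (halfNome z) / (halfNome z * eulerFun (halfNome z ^ 2)) := by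
  have h1 : cexp (2 * Real.pi * I * (z / 2)) = halfNome z := by
    rw [halfNome]
    congr 1
    ring
  simp only [lambdaConj]
  rw [eta_pow_eq hz, eta_pow_eq (im_div_two hz), h1, exp_eq_halfNome_sq]
  have := halfNome_ne_zero z
  field_simp

theorem lambdaConj_two_eq {z : ℂ} (hz : 0 < z.im) :
    lambdaConj 2 z = -(eulerFun (-halfNome z) / (halfNome z * eulerFun (halfNome z ^ 2))) := by
  have h1 : cexp (2 * Real.pi * I * ((1 + z) / 2)) = -halfNome z := by
    rw [halfNome, show 2 * Real.pi * I * ((1 + z) / 2) = Real.pi * I + Real.pi * I * z by ring,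
      Complex.exp_add, Complex.exp_pi_mul_I, neg_one_mul]
  simp only [lambdaConj]
  rw [eta_pow_eq hz, eta_pow_eq (im_one_add_div_two hz), h1, exp_eq_halfNome_sq]
  have := halfNome_ne_zero z
  field_simp

theorem eventually_im_pos : ∀ᶠ z : ℂ in comap Complex.im atTop, 0 < z.im :=
  tendsto_comap.eventually (eventually_gt_atTop 0)

theorem evaluatesTo_eulerFun : EvaluatesTo (eulerSeries ℂ ^ 24) eulerFun :=
  evaluatesTo_eulerSeries.pow 24

theorem eulerFun_zero : eulerFun 0 = 1 := by
  simp [eulerFun]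

theorem hasDerivAt_of_evaluatesTo {f : ℂ⟦X⟧} {F : ℂ → ℂ} (h : EvaluatesTo f F) :
    HasDerivAt F (PowerSeries.coeff 1 f) 0 := by
  have hd := h.differentiableOn.differentiableAt (Metric.ball_mem_nhds 0 one_pos)
  have := h.coeff_eq 1
  simp only [iteratedDeriv_one, Nat.factorial_one, Nat.cast_one, div_one] at this
  rw [this]
  exact hd.hasDerivAt

theorem coeff_one_eulerSeries_pow {R : Type*} [CommRing R] (k : ℕ) :
    PowerSeries.coeff 1 (eulerSeries R ^ k) = -k := by
  have h0 : PowerSeries.constantCoeff (eulerSeries R) = 1 := by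
    rw [← PowerSeries.coeff_zero_eq_constantCoeff_apply]
    simp [eulerSeries]
  have h1 : PowerSeries.coeff 1 (eulerSeries R) = -1 := by
    simp [eulerSeries, PowerSeries.coeff_one]
  induction k with
  | zero => simp [PowerSeries.coeff_one]
  | succ k ih =>
    rw [pow_succ, PowerSeries.coeff_mul]
    simp [Finset.Nat.antidiagonal_succ, h0, h1, ih]

theorem hasDerivAt_eulerFun : HasDerivAt eulerFun (-24) 0 := by
  have := hasDerivAt_of_evaluatesTo evaluatesTo_eulerFun
  rwa [coeff_one_eulerSeries_pow, Nat.cast_ofNat] at this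

end Modular

end HeisenbergTwoAdic
end

/-! ### Eisenstein series and the modular equation of level two. -/

noncomputable section
namespace HeisenbergTwoAdic
open scoped Nat NNReal PowerSeries

/-- The power series `1 + c ∑ σₖ(n) qⁿ`. -/
def eisenstein (R : Type*) [CommRing R] (c : ℤ) (k : ℕ) : R⟦X⟧ :=
  PowerSeries.mk fun n => if n = 0 then 1 else (c : R) * (ArithmeticFunction.sigma k n : ℕ)

theorem map_eisenstein {R S : Type*} [CommRing R] [CommRing S] (ψ : R →+* S) (c : ℤ) (k : ℕ) :
    PowerSeries.map ψ (eisenstein R c k) = eisenstein S c k := by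
  ext n
  rw [PowerSeries.coeff_map, eisenstein, eisenstein, PowerSeries.coeff_mk, PowerSeries.coeff_mk]
  split_ifs <;> simp

section Modular

open UpperHalfPlane hiding I
open ModularForm Complex MatrixGroups Filter Topology

theorem exists_halfPlane {q : ℂ} (hq : ‖q‖ < 1) (hq0 : q ≠ 0) :
    ∃ z : ℍ, cexp (2 * Real.pi * I * z) = q := by
  have him := Function.Periodic.im_invQParam_pos_of_norm_lt_one one_pos hq hq0
  refine ⟨⟨_, him⟩, ?_⟩
  have := Function.Periodic.qParam_right_inv (h := 1) one_ne_zero hq0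
  simpa [Function.Periodic.qParam] using this

theorem evaluatesTo_qExpansion {k : ℤ} (f : ModularForm 𝒮ℒ k) :
    ∃ F : ℂ → ℂ, EvaluatesTo (qExpansion 1 f) F ∧
      ∀ z : ℍ, F (cexp (2 * Real.pi * I * z)) = f z := by
  have key : ∀ z : ℍ, HasSum (fun n => PowerSeries.coeff n (qExpansion 1 f) *
      cexp (2 * Real.pi * I * z) ^ n) (f z) := fun z => by
    simpa [Function.Periodic.qParam] using
      ModularForm.hasSum_qExpansion f one_pos one_mem_strictPeriods_SL z
  refine ⟨fun q => ∑' n, PowerSeries.coeff n (qExpansion 1 f) * q ^ n, fun q hq => ?_,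
    fun z => (key z).tsum_eq⟩
  refine Summable.hasSum ?_
  rcases eq_or_ne q 0 with rfl | hq0
  -- The point q = 0 does not come from the upper half-plane; there only the constant term survives.
  · refine summable_of_ne_finset_zero (s := {0}) fun n hn => ?_
    rw [zero_pow (by simpa using hn), mul_zero]
  · obtain ⟨z, rfl⟩ := exists_halfPlane hq hq0
    exact (key z).summable

theorem qExpansion_E₄ : qExpansion 1 E₄ = eisenstein ℂ 240 3 := by
  ext n
  rw [EisensteinSeries.E_qExpansion_coeff _ ⟨2, rfl⟩, eisenstein, PowerSeries.coeff_mk]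
  split_ifs
  · rfl
  · rw [bernoulli_eq_bernoulli'_of_ne_one (by norm_num), bernoulli'_four]
    norm_num

theorem bernoulli'_six : bernoulli' 6 = 1 / 42 := by
  have h5 : bernoulli' 5 = 0 := bernoulli'_eq_zero_of_odd (by decide) (by norm_num)
  rw [bernoulli'_def]
  norm_num [Finset.sum_range_succ, bernoulli'_two, bernoulli'_three, bernoulli'_four, h5,
    Nat.choose]

theorem qExpansion_E₆ : qExpansion 1 E₆ = eisenstein ℂ (-504) 5 := by
  ext n
  rw [EisensteinSeries.E_qExpansion_coeff _ ⟨3, rfl⟩, eisenstein, PowerSeries.coeff_mk]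
  split_ifs
  · rfl
  · rw [bernoulli_eq_bernoulli'_of_ne_one (by norm_num), bernoulli'_six]
    norm_num

theorem exists_eisenstein_four : ∃ F : ℂ → ℂ, EvaluatesTo (eisenstein ℂ 240 3) F ∧
    ∀ z : ℍ, F (cexp (2 * Real.pi * I * z)) = E₄ z :=
  qExpansion_E₄ ▸ evaluatesTo_qExpansion E₄

theorem exists_eisenstein_six : ∃ F : ℂ → ℂ, EvaluatesTo (eisenstein ℂ (-504) 5) F ∧
    ∀ z : ℍ, F (cexp (2 * Real.pi * I * z)) = E₆ z :=
  qExpansion_E₆ ▸ evaluatesTo_qExpansion E₆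

theorem eisenstein_cube_sub_sq_complex :
    eisenstein ℂ 240 3 ^ 3 - eisenstein ℂ (-504) 5 ^ 2 =
      PowerSeries.C 1728 * (PowerSeries.X * eulerSeries ℂ ^ 24) := by
  obtain ⟨F4, h4, h4'⟩ := exists_eisenstein_four
  obtain ⟨F6, h6, h6'⟩ := exists_eisenstein_six
  refine ((h4.pow 3).sub (h6.pow 2)).eq_of_eqOn
    ((EvaluatesTo.const 1728).mul (EvaluatesTo.X.mul evaluatesTo_eulerFun)) fun q hq => ?_
  rcases eq_or_ne q 0 with rfl | hq0
  · have e4 := h4.coeff_eq 0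
    have e6 := h6.coeff_eq 0
    simp [eisenstein] at e4 e6
    simp [← e4, ← e6]
  · obtain ⟨z, rfl⟩ := exists_halfPlane hq hq0
    have h := discriminant_eq_E₄_cube_sub_E₆_sq z
    rw [discriminant, eta_pow_eq z.im_pos] at h
    rw [h4', h6', h]
    ring

theorem tendsto_eulerFun : Tendsto eulerFun (𝓝 0) (𝓝 1) := by
  have := hasDerivAt_eulerFun.continuousAt.tendsto
  rwa [eulerFun_zero] at this

theorem tendsto_pow_punctured {k : ℕ} (hk : k ≠ 0) :
    Tendsto (fun p : ℂ => p ^ k) (𝓝[≠] 0) (𝓝 0) :=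
  ((continuous_pow k).tendsto' 0 0 (zero_pow hk)).mono_left nhdsWithin_le_nhds

theorem tendsto_slope_zero {f : ℂ → ℂ} {a : ℂ} (h : HasDerivAt f a 0) (h0 : f 0 = 0) :
    Tendsto (fun p => f p / p) (𝓝[≠] 0) (𝓝 a) := by
  have := hasDerivAt_iff_tendsto_slope.1 h
  refine this.congr fun p => ?_
  simp [slope, h0, div_eq_inv_mul]

/-- With Φ = `eulerFun`, the first conjugate vanishes at i∞ and the other two add up to (Φ(p) -
Φ(-p)) / (p Φ(p²)), which tends to 2 Φ'(0) = -48. -/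
theorem sum_lambdaConj {z : ℂ} (hz : 0 < z.im) :
    lambdaConj 0 z + lambdaConj 1 z + lambdaConj 2 z = -48 := by
  refine eq_of_levelOne_weight_zero
    (F := fun z => lambdaConj 0 z + lambdaConj 1 z + lambdaConj 2 z)
    (((differentiableOn_lambdaConj 0).add (differentiableOn_lambdaConj 1)).add
      (differentiableOn_lambdaConj 2)) (fun z hz => ?_) (fun z hz => ?_) ?_ hz
  · obtain ⟨h0, h1, h2⟩ := lambdaConj_neg_inv hz
    simp only [h0, h1, h2]
    ring
  · obtain ⟨h0, h1, h2⟩ := lambdaConj_one_add hz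
    simp only [h0, h1, h2]
    ring
  · have hs : Tendsto (fun p : ℂ => (eulerFun p - eulerFun (-p)) / p) (𝓝[≠] 0) (𝓝 (-48)) := by
      refine tendsto_slope_zero ?_ (by simp)
      have hneg : HasDerivAt (fun p : ℂ => eulerFun (-p)) (-24 * -1) 0 :=
        HasDerivAt.comp (0 : ℂ) (h₂ := eulerFun) (by simpa using hasDerivAt_eulerFun)
          (hasDerivAt_neg (0 : ℂ))
      exact (hasDerivAt_eulerFun.sub hneg).congr_deriv (by norm_num)
    have h2 := tendsto_eulerFun.comp (tendsto_pow_punctured two_ne_zero)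
    have h4 := tendsto_eulerFun.comp (tendsto_pow_punctured four_ne_zero)
    have hlim := (((tendsto_pow_punctured two_ne_zero).const_mul 4096).mul
      (h4.div h2 one_ne_zero)).add (hs.div h2 one_ne_zero)
    have := hlim.comp tendsto_halfNome
    simp only [mul_zero, zero_mul, zero_add, div_one] at this
    refine this.congr' ?_
    filter_upwards [eventually_im_pos] with z hz
    rw [lambdaConj_zero_eq hz, lambdaConj_one_eq hz, lambdaConj_two_eq hz]
    have := halfNome_ne_zero z
    simp only [Function.comp, Pi.div_apply]
    field_simp
    ring

/-- The powers of p cancel in the product, so the limit only needs Φ(0) = 1. -/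
theorem prod_lambdaConj {z : ℂ} (hz : 0 < z.im) :
    lambdaConj 0 z * lambdaConj 1 z * lambdaConj 2 z = -4096 := by
  refine eq_of_levelOne_weight_zero
    (F := fun z => lambdaConj 0 z * lambdaConj 1 z * lambdaConj 2 z)
    (((differentiableOn_lambdaConj 0).mul (differentiableOn_lambdaConj 1)).mul
      (differentiableOn_lambdaConj 2)) (fun z hz => ?_) (fun z hz => ?_) ?_ hz
  · obtain ⟨h0, h1, h2⟩ := lambdaConj_neg_inv hz
    simp only [h0, h1, h2]
    ring
  · obtain ⟨h0, h1, h2⟩ := lambdaConj_one_add hz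
    simp only [h0, h1, h2]
    ring
  · have h1 : Tendsto eulerFun (𝓝[≠] 0) (𝓝 1) := tendsto_eulerFun.mono_left nhdsWithin_le_nhds
    have h1' : Tendsto (fun p => eulerFun (-p)) (𝓝[≠] 0) (𝓝 1) := by
      have : Tendsto (fun p : ℂ => -p) (𝓝[≠] 0) (𝓝 0) :=
        ((continuous_neg (G := ℂ)).tendsto' 0 0 neg_zero).mono_left nhdsWithin_le_nhds
      exact tendsto_eulerFun.comp this
    have h2 := tendsto_eulerFun.comp (tendsto_pow_punctured two_ne_zero)
    have h4 := tendsto_eulerFun.comp (tendsto_pow_punctured four_ne_zero)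
    have hlim := (((h4.mul h1).mul h1').div (h2.pow 3) (by norm_num)).const_mul (-4096)
    have := hlim.comp tendsto_halfNome
    simp only [mul_one, one_pow, div_one] at this
    refine this.congr' ?_
    filter_upwards [eventually_im_pos] with z hz
    rw [lambdaConj_zero_eq hz, lambdaConj_one_eq hz, lambdaConj_two_eq hz]
    have := halfNome_ne_zero z
    simp only [Function.comp, Pi.div_apply]
    field_simp

/-- The relation between `λ` and the modular invariant `j = E₄³ / Δ`. -/
theorem lambdaConj_zero_relation {F : ℂ → ℂ} (hF : EvaluatesTo (eisenstein ℂ 240 3) F)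
    (hF' : ∀ z : ℍ, F (cexp (2 * Real.pi * I * z)) = E₄ z) {z : ℂ} (hz : 0 < z.im) :
    (lambdaConj 0 z + 16) ^ 3 = F (cexp (2 * Real.pi * I * z)) ^ 3 / η z ^ 24 *
      lambdaConj 0 z := by
  -- The second symmetric function has a pole at i∞ which j = E₄³/Δ cancels. The conjugates are thus
  -- the roots of Y³ + 48 Y² + (768 - j) Y + 4096 = (Y + 16)³ - j Y.
  have key : lambdaConj 0 z * lambdaConj 1 z + lambdaConj 0 z * lambdaConj 2 z +
      lambdaConj 1 z * lambdaConj 2 z + F (cexp (2 * Real.pi * I * z)) ^ 3 / η z ^ 24 = 768 := by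
    refine eq_of_levelOne_weight_zero
      (F := fun z => lambdaConj 0 z * lambdaConj 1 z + lambdaConj 0 z * lambdaConj 2 z +
        lambdaConj 1 z * lambdaConj 2 z + F (cexp (2 * Real.pi * I * z)) ^ 3 / η z ^ 24)
      ?_ (fun z hz => ?_) (fun z hz => ?_) ?_ hz
    · have hd := differentiableOn_lambdaConj
      refine ((((hd 0).mul (hd 1)).add ((hd 0).mul (hd 2))).add ((hd 1).mul (hd 2))).add
        (((hF.differentiableOn.comp (f := fun z : ℂ => cexp (2 * Real.pi * I * z)) (by fun_prop)
          fun z hz => ?_).pow 3).div differentiableOn_eta_pow fun z hz => eta_pow_ne_zero hz)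
      rw [mem_ball_zero_iff]
      exact norm_exp_two_pi_I_lt_one ⟨z, hz⟩
    · obtain ⟨h0, h1, h2⟩ := lambdaConj_neg_inv hz
      have hE : F (cexp (2 * Real.pi * I * (-z⁻¹))) =
          z ^ 4 * F (cexp (2 * Real.pi * I * z)) := by
        have e1 : F (cexp (2 * Real.pi * I * z)) = E₄ ⟨z, hz⟩ := hF' ⟨z, hz⟩
        have e2 : F (cexp (2 * Real.pi * I * (-z⁻¹))) = E₄ ⟨-z⁻¹, im_neg_inv_pos hz⟩ :=
          hF' ⟨-z⁻¹, im_neg_inv_pos hz⟩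
        have e3 := congrFun (E₄.slash_action_eq' (ModularGroup.S : SL(2, ℤ)) ⟨_, rfl⟩) ⟨z, hz⟩
        change ((E₄ : ℍ → ℂ) ∣[(4 : ℤ)] ModularGroup.S) ⟨z, hz⟩ = E₄ ⟨z, hz⟩ at e3
        rw [SL_slash_apply, UpperHalfPlane.modular_S_smul, ModularGroup.denom_S] at e3
        have hz0 : z ≠ 0 := fun h => by simp [h] at hz
        have e4 : (⟨-z⁻¹, im_neg_inv_pos hz⟩ : ℍ) = ⟨(-z)⁻¹, by
            rw [inv_neg]; exact im_neg_inv_pos hz⟩ := by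
          ext
          simp [inv_neg]
        rw [e4] at e2
        change E₄ ⟨(-z)⁻¹, _⟩ * z ^ (-4 : ℤ) = E₄ ⟨z, hz⟩ at e3
        rw [e1, e2, ← e3]
        field_simp
      simp only [h0, h1, h2, hE, eta_pow_neg_inv hz]
      have hz0 : z ≠ 0 := fun h => by simp [h] at hz
      have := eta_pow_ne_zero hz
      field_simp
      ring
    · obtain ⟨h0, h1, h2⟩ := lambdaConj_one_add hz
      have : cexp (2 * Real.pi * I * (1 + z)) = cexp (2 * Real.pi * I * z) := by
        rw [mul_add, mul_one, Complex.exp_add, Complex.exp_two_pi_mul_I, one_mul]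
      simp only [h0, h1, h2, this, eta_pow_one_add hz]
      ring
    · have hF0 : F 0 = 1 := by
        have := hF.coeff_eq 0
        simp [eisenstein] at this
        exact this.symm
      have hFd : HasDerivAt F 240 0 := by
        have := hasDerivAt_of_evaluatesTo hF
        simpa [eisenstein] using this
      have hΦ := hasDerivAt_eulerFun
      have hΦ2 : HasDerivAt (fun q : ℂ => eulerFun (q ^ 2)) 0 0 := by
        have h2 : HasDerivAt (fun q : ℂ => q ^ 2) 0 0 := by
          simpa using hasDerivAt_pow 2 (0 : ℂ)
        have := HasDerivAt.comp (0 : ℂ) (h₂ := eulerFun) (h₂' := -24) (by simpa using hΦ) h2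
        simpa [Function.comp_def] using this
      -- With q = p², the product of the last two conjugates is -Φ(q) / (q Φ(q²)) and j = F³ / (q
      -- Φ(q)), so the singular terms form a difference quotient at 0. The derivative is 3·240 + 24
      -- + 24 = 768.
      have hg : HasDerivAt (fun q => F q ^ 3 / eulerFun q - eulerFun q / eulerFun (q ^ 2))
          768 0 := by
        refine (((hFd.pow 3).div hΦ (by simp [eulerFun_zero])).sub
          (hΦ.div hΦ2 (by simp [eulerFun_zero]))).congr_deriv ?_
        simp [hF0, eulerFun_zero]
        norm_num
      have hs := tendsto_slope_zero hg (by simp [hF0, eulerFun_zero])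
      have hq : Tendsto (fun p : ℂ => p ^ 2) (𝓝[≠] 0) (𝓝[≠] 0) :=
        tendsto_nhdsWithin_of_tendsto_nhds_of_eventually_within _
          (tendsto_pow_punctured two_ne_zero)
          (by filter_upwards [self_mem_nhdsWithin] with p hp using pow_ne_zero 2 hp)
      have h1 : Tendsto eulerFun (𝓝[≠] 0) (𝓝 1) := tendsto_eulerFun.mono_left nhdsWithin_le_nhds
      have h2 := tendsto_eulerFun.comp (tendsto_pow_punctured two_ne_zero)
      have hid : Tendsto (fun q : ℂ => q) (𝓝[≠] 0) (𝓝 0) := nhdsWithin_le_nhds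
      have hl := (hid.const_mul 4096).mul (h2.div h1 one_ne_zero)
      have hlim := (((hl.mul (hl.const_sub (-48))).add hs).comp hq).comp tendsto_halfNome
      simp only [mul_zero, zero_mul, zero_add] at hlim
      refine hlim.congr' ?_
      filter_upwards [eventually_im_pos] with z hz
      have hsum := sum_lambdaConj hz
      have hprod := prod_lambdaConj hz
      have hη : η z ^ 24 ≠ 0 := eta_pow_ne_zero hz
      have hη2 : η (2 * z) ^ 24 ≠ 0 := eta_pow_ne_zero (im_mul_two hz)
      have hl0 : lambdaConj 0 z ≠ 0 := by
        intro h
        rw [h] at hprod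
        norm_num at hprod
      have h12 : lambdaConj 1 z * lambdaConj 2 z = -4096 / lambdaConj 0 z := by
        rw [eq_div_iff hl0, ← hprod]
        ring
      have hs12 : lambdaConj 0 z * lambdaConj 1 z + lambdaConj 0 z * lambdaConj 2 z =
          lambdaConj 0 z * (-48 - lambdaConj 0 z) := by
        rw [← hsum]
        ring
      rw [h12, hs12, lambdaConj_zero_eq hz, eta_pow_eq hz, exp_eq_halfNome_sq]
      rw [eta_pow_eq hz, exp_eq_halfNome_sq] at hη
      rw [lambdaConj_zero_eq hz] at hl0
      have hp := halfNome_ne_zero z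
      have hΦ0 : eulerFun (halfNome z ^ 2) ≠ 0 := right_ne_zero_of_mul hη
      have hΦ20 : eulerFun (halfNome z ^ 4) ≠ 0 := fun h => hl0 (by simp [h])
      have e4 : (halfNome z ^ 2) ^ 2 = halfNome z ^ 4 := by ring
      simp only [Function.comp, Pi.div_apply, e4]
      field_simp
      ring
  have hsum := sum_lambdaConj hz
  have hprod := prod_lambdaConj hz
  linear_combination (-lambdaConj 0 z ^ 2) * (-hsum) + (-lambdaConj 0 z) * key + hprod

/-- This is (1 + 256 λ)³ = j λ with λ = Δ(q²)/Δ(q), cleared of denominators by Δ³. -/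
theorem level_two_relation_complex :
    eisenstein ℂ 240 3 ^ 3 * (PowerSeries.X * eulerSeries ℂ ^ 24) *
        PowerSeries.expand 2 two_ne_zero (PowerSeries.X * eulerSeries ℂ ^ 24) =
      (PowerSeries.X * eulerSeries ℂ ^ 24 +
        PowerSeries.C 256 *
          PowerSeries.expand 2 two_ne_zero (PowerSeries.X * eulerSeries ℂ ^ 24)) ^ 3 := by
  obtain ⟨F, hF, hF'⟩ := exists_eisenstein_four
  have hΔ := EvaluatesTo.X.mul evaluatesTo_eulerFun
  refine (((hF.pow 3).mul hΔ).mul hΔ.expand_two).eq_of_eqOn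
    ((hΔ.add ((EvaluatesTo.const 256).mul hΔ.expand_two)).pow 3) fun q hq => ?_
  rcases eq_or_ne q 0 with rfl | hq0
  · simp
  · obtain ⟨z, rfl⟩ := exists_halfPlane hq hq0
    have h := lambdaConj_zero_relation hF hF' z.im_pos
    have hη := eta_pow_ne_zero z.im_pos
    have h2 : cexp (2 * Real.pi * I * z) ^ 2 = cexp (2 * Real.pi * I * (2 * z)) := by
      rw [← Complex.exp_nat_mul]
      congr 1
      push_cast
      ring
    rw [h2, ← eta_pow_eq z.im_pos, ← eta_pow_eq (im_mul_two z.im_pos)]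
    simp only [lambdaConj] at h
    generalize η z ^ 24 = a at *
    generalize η (2 * z) ^ 24 = b at *
    generalize F (cexp (2 * Real.pi * I * z)) = e at *
    field_simp at h
    linear_combination (-1 / 4096) * h

end Modular

/-- The power series of `Δ = q ∏ (1 - q^k)^24`. -/
def deltaSeries (R : Type*) [CommRing R] : R⟦X⟧ := PowerSeries.X * eulerSeries R ^ 24

theorem map_deltaSeries {R S : Type*} [CommRing R] [CommRing S] (ψ : R →+* S) :
    PowerSeries.map ψ (deltaSeries R) = deltaSeries S := by
  simp [deltaSeries, map_eulerSeries]

/-- All coefficients are integers and ℤ embeds in ℂ, so the analytic identity descends to ℤ and from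
there maps to every commutative ring, in particular to ℚ₂. -/
theorem eisenstein_cube_sub_sq_int :
    eisenstein ℤ 240 3 ^ 3 - eisenstein ℤ (-504) 5 ^ 2 = 1728 * deltaSeries ℤ := by
  apply PowerSeries.map_injective (Int.castRingHom ℂ) Int.cast_injective
  have := eisenstein_cube_sub_sq_complex
  simp only [map_mul, map_sub, map_pow, map_eisenstein, map_deltaSeries, map_ofNat]
  simpa only [deltaSeries, map_ofNat] using this

theorem map_expand_two {R S : Type*} [CommRing R] [CommRing S] (ψ : R →+* S) (f : R⟦X⟧) :
    PowerSeries.map ψ (PowerSeries.expand 2 two_ne_zero f) =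
      PowerSeries.expand 2 two_ne_zero (PowerSeries.map ψ f) := by
  ext n
  simp only [PowerSeries.coeff_map, PowerSeries.coeff_expand]
  split_ifs <;> simp

theorem level_two_relation_int :
    eisenstein ℤ 240 3 ^ 3 * deltaSeries ℤ * PowerSeries.expand 2 two_ne_zero (deltaSeries ℤ) =
      (deltaSeries ℤ + 256 * PowerSeries.expand 2 two_ne_zero (deltaSeries ℤ)) ^ 3 := by
  apply PowerSeries.map_injective (Int.castRingHom ℂ) Int.cast_injective
  have := level_two_relation_complex
  simp only [map_mul, map_add, map_pow, map_expand_two, map_eisenstein, map_deltaSeries,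
    map_ofNat]
  simpa only [deltaSeries, map_ofNat] using this

theorem eisenstein_cube_sub_sq (R : Type*) [CommRing R] :
    eisenstein R 240 3 ^ 3 - eisenstein R (-504) 5 ^ 2 = 1728 * deltaSeries R := by
  have := congrArg (PowerSeries.map (Int.castRingHom R)) eisenstein_cube_sub_sq_int
  simpa only [map_mul, map_sub, map_pow, map_eisenstein, map_deltaSeries, map_ofNat] using this

theorem level_two_relation (R : Type*) [CommRing R] :
    eisenstein R 240 3 ^ 3 * deltaSeries R * PowerSeries.expand 2 two_ne_zero (deltaSeries R) =
      (deltaSeries R + 256 * PowerSeries.expand 2 two_ne_zero (deltaSeries R)) ^ 3 := by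
  have := congrArg (PowerSeries.map (Int.castRingHom R)) level_two_relation_int
  simpa only [map_mul, map_add, map_pow, map_expand_two, map_eisenstein, map_deltaSeries,
    map_ofNat] using this

end HeisenbergTwoAdic
end

noncomputable section
namespace HeisenbergTwoAdic
open scoped Nat NNReal PowerSeries

/-! ### Commutation relations of the modes -/

theorem hMode_zero : hMode 0 = 0 := rfl

theorem hMode_natCast_succ (k : ℕ) (u : Heis) :
    hMode ((k : ℤ) + 1) u = ((k : ℚ_[2]) + 1) • MvPolynomial.pderiv k u := by
  have : hMode ((k : ℤ) + 1) = hMode (Int.ofNat (k + 1)) := rfl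
  rw [this, hMode]
  simp

theorem hMode_neg_natCast_succ (k : ℕ) (u : Heis) :
    hMode (-((k : ℤ) + 1)) u = MvPolynomial.X k * u := by
  have : hMode (-((k : ℤ) + 1)) = hMode (Int.negSucc k) := by
    congr 1
  rw [this, hMode]
  simp

theorem int_trichotomy_succ (n : ℤ) :
    n = 0 ∨ (∃ k : ℕ, n = (k : ℤ) + 1) ∨ ∃ k : ℕ, n = -((k : ℤ) + 1) := by
  rcases lt_trichotomy n 0 with h | h | h
  · exact Or.inr (Or.inr ⟨(-n - 1).toNat, by omega⟩)
  · exact Or.inl h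
  · exact Or.inr (Or.inl ⟨(n - 1).toNat, by omega⟩)

theorem pderiv_comm (i j : ℕ) (u : Heis) :
    MvPolynomial.pderiv i (MvPolynomial.pderiv j u) =
      MvPolynomial.pderiv j (MvPolynomial.pderiv i u) := by
  ext I
  rcases eq_or_ne i j with rfl | h
  · rfl
  · simp only [MvPolynomial.coeff_pderiv, Finsupp.add_apply, Finsupp.single_apply, if_neg h,
      if_neg h.symm, add_right_comm I (Finsupp.single i 1)]
    push_cast
    ring

theorem hMode_commutator (m n : ℤ) (u : Heis) :
    hMode m (hMode n u) = hMode n (hMode m u) + (if m + n = 0 then (m : ℚ_[2]) else 0) • u := by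
  rcases int_trichotomy_succ m with rfl | ⟨k, rfl⟩ | ⟨k, rfl⟩ <;>
  rcases int_trichotomy_succ n with rfl | ⟨l, rfl⟩ | ⟨l, rfl⟩
  · simp [hMode_zero]
  · simp [hMode_zero]
  · simp [hMode_zero]
  · rw [if_neg (by omega)]
    simp [hMode_zero]
  · rw [if_neg (by omega)]
    simp only [hMode_natCast_succ, map_smul, pderiv_comm k l, zero_smul, add_zero,
      smul_comm ((k : ℚ_[2]) + 1)]
  · simp only [hMode_natCast_succ, hMode_neg_natCast_succ, MvPolynomial.pderiv_mul,
      mul_smul_comm, smul_add]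
    rcases eq_or_ne k l with rfl | h
    · rw [if_pos (by omega), MvPolynomial.pderiv_X_self]
      push_cast
      rw [one_mul, add_comm]
    · rw [if_neg (by omega), MvPolynomial.pderiv_X_of_ne h.symm]
      simp
  · rw [if_neg (by omega)]
    simp [hMode_zero]
  · simp only [hMode_natCast_succ, hMode_neg_natCast_succ, MvPolynomial.pderiv_mul,
      mul_smul_comm, smul_add]
    rcases eq_or_ne k l with rfl | h
    · rw [if_pos (by omega), MvPolynomial.pderiv_X_self]
      push_cast
      rw [one_mul, neg_smul]
      abel
    · rw [if_neg (by omega), MvPolynomial.pderiv_X_of_ne h]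
      simp
  · rw [if_neg (by omega)]
    simp only [hMode_neg_natCast_succ, zero_smul, add_zero]
    ring

/-! ### Homogeneous states -/

/-- The state `u` is homogeneous of weight `N`. -/
def HasWt (u : Heis) (N : ℤ) : Prop := ∀ I, MvPolynomial.coeff I u ≠ 0 → (wt I : ℤ) = N

theorem HasWt.zero (N : ℤ) : HasWt 0 N := fun I h => absurd (MvPolynomial.coeff_zero I) h

theorem HasWt.add {u v : Heis} {N : ℤ} (hu : HasWt u N) (hv : HasWt v N) : HasWt (u + v) N :=
  fun I h => by
    by_cases h1 : MvPolynomial.coeff I u = 0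
    · refine hv I fun h2 => h ?_
      rw [MvPolynomial.coeff_add, h1, h2, add_zero]
    · exact hu I h1

theorem HasWt.smul {u : Heis} {N : ℤ} (hu : HasWt u N) (a : ℚ_[2]) : HasWt (a • u) N :=
  fun I h => hu I fun h1 => h (by rw [MvPolynomial.coeff_smul, h1, smul_zero])

theorem HasWt.zsmul {u : Heis} {N : ℤ} (hu : HasWt u N) (a : ℤ) : HasWt (a • u) N := by
  rw [← Int.cast_smul_eq_zsmul ℚ_[2]]
  exact hu.smul _

theorem HasWt.sum {ι : Type*} {s : Finset ι} {f : ι → Heis} {N : ℤ}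
    (h : ∀ i ∈ s, HasWt (f i) N) : HasWt (∑ i ∈ s, f i) N :=
  Finset.sum_induction f (HasWt · N) (fun _ _ => HasWt.add) (HasWt.zero N) h

theorem HasWt.eq_zero {u : Heis} {N : ℤ} (hu : HasWt u N) (hN : N < 0) : u = 0 := by
  ext I
  by_contra h
  have := hu I h
  omega

theorem wt_add (I J : ℕ →₀ ℕ) : wt (I + J) = wt I + wt J :=
  Finsupp.sum_add_index' (by simp) (fun k a b => by ring)

theorem wt_single (k e : ℕ) : wt (Finsupp.single k e) = e * (k + 1) :=
  Finsupp.sum_single_index (by simp)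

theorem HasWt.hMode {u : Heis} {N : ℤ} (hu : HasWt u N) (n : ℤ) : HasWt (hMode n u) (N - n) := by
  rcases int_trichotomy_succ n with rfl | ⟨k, rfl⟩ | ⟨k, rfl⟩
  · exact HasWt.zero _
  · rw [hMode_natCast_succ]
    refine HasWt.smul (fun I h => ?_) _
    rw [MvPolynomial.coeff_pderiv] at h
    have := hu _ (left_ne_zero_of_mul h)
    rw [wt_add, wt_single] at this
    push_cast at this
    omega
  · rw [hMode_neg_natCast_succ]
    intro I h
    rw [MvPolynomial.coeff_X_mul'] at h
    split_ifs at h with hk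
    · have := hu _ h
      have hI : I = I - Finsupp.single k 1 + Finsupp.single k 1 := by
        ext j
        rcases eq_or_ne k j with rfl | hj
        · have := Finsupp.mem_support_iff.1 hk
          simp
          omega
        · simp [hj]
      rw [hI, wt_add, wt_single]
      push_cast
      omega
    · exact absurd rfl h

theorem hasWt_monomial (I : ℕ →₀ ℕ) (a : ℚ_[2]) : HasWt (MvPolynomial.monomial I a) (wt I) :=
  fun J h => by
    rw [MvPolynomial.coeff_monomial] at h
    split_ifs at h with hI
    · rw [hI]
    · exact absurd rfl h

/-! ### Truncated fields -/

/-- The normally ordered product of `h(n)` and an operator. -/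
def normalOrder (n : ℤ) (A : Module.End ℚ_[2] Heis) : Module.End ℚ_[2] Heis :=
  if n < 0 then hMode n * A else A * hMode n

theorem normalOrder_smul (n : ℤ) (a : ℚ_[2]) (A : Module.End ℚ_[2] Heis) :
    normalOrder n (a • A) = a • normalOrder n A := by
  unfold normalOrder
  split_ifs <;> simp

theorem normalOrder_sum {ι : Type*} (n : ℤ) (s : Finset ι) (f : ι → Module.End ℚ_[2] Heis) :
    normalOrder n (∑ i ∈ s, f i) = ∑ i ∈ s, normalOrder n (f i) := by
  unfold normalOrder
  split_ifs
  · rw [Finset.mul_sum]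
  · rw [Finset.sum_mul]

/-- Two modes of the same sign commute. Among non-negative modes a central term could occur only for
m = n = 0, where it vanishes. Hence the order of the factors in a field is immaterial
(`truncField_perm`). -/
theorem normalOrder_comm (m n : ℤ) (A : Module.End ℚ_[2] Heis) :
    normalOrder m (normalOrder n A) = normalOrder n (normalOrder m A) := by
  refine LinearMap.ext fun u => ?_
  unfold normalOrder
  split_ifs
  · simp only [Module.End.mul_apply]
    rw [hMode_commutator, if_neg (by omega), zero_smul, add_zero]
  · rfl
  · rfl
  · simp only [Module.End.mul_apply]
    rw [hMode_commutator n m]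
    split_ifs with h
    · have : n = 0 := by omega
      rw [this]
      simp
    · rw [zero_smul, add_zero]

/-- The modes of the normally ordered product of fields whose modes are cut off at `±K`. -/
def truncField (K : ℕ) : List ℕ → ℤ → Module.End ℚ_[2] Heis
  | [], d => if d = 0 then 1 else 0
  | a :: L, d => ∑ n ∈ Finset.Icc (-(K : ℤ)) K,
      ((Ring.choose (-n - 1) a : ℤ) : ℚ_[2]) • normalOrder n (truncField K L (d - n))

theorem truncField_hasWt (K : ℕ) (L : List ℕ) : ∀ (d : ℤ) {u : Heis} {N : ℤ}, HasWt u N →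
    HasWt (truncField K L d u) (N - d) := by
  induction L with
  | nil =>
    intro d u N hu
    rw [truncField]
    split_ifs with h
    · simpa [h] using hu
    · exact HasWt.zero _
  | cons a L ih =>
    intro d u N hu
    rw [truncField, LinearMap.sum_apply]
    refine HasWt.sum fun n _ => HasWt.smul ?_ _
    unfold normalOrder
    split_ifs
    · have := (ih (d - n) hu).hMode n
      rwa [show N - (d - n) - n = N - d by ring] at this
    · have := ih (d - n) (hu.hMode n)
      rwa [show N - n - (d - n) = N - d by ring] at this

theorem fieldMode_hasWt (L : List ℕ) : ∀ (d : ℤ) {u : Heis} {N : ℤ}, HasWt u N →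
    HasWt (fieldMode L d u) (N - d) := by
  induction L with
  | nil =>
    intro d u N hu
    rw [fieldMode]
    split_ifs with h
    · simpa [h] using hu
    · exact HasWt.zero _
  | cons a L ih =>
    intro d u N hu
    rw [fieldMode]
    refine finsum_induction (HasWt · (N - d)) (HasWt.zero _) (fun _ _ => HasWt.add) fun n => ?_
    refine HasWt.zsmul ?_ _
    split_ifs
    · have := (ih (d - n) hu).hMode n
      rwa [show N - (d - n) - n = N - d by ring] at this
    · have := ih (d - n) (hu.hMode n)
      rwa [show N - n - (d - n) = N - d by ring] at this

theorem fieldMode_zero (L : List ℕ) (d : ℤ) : fieldMode L d 0 = 0 :=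
  (fieldMode_hasWt L d (HasWt.zero (d - 1))).eq_zero (by omega)

/-- A mode beyond ±K would have to pass through a state of negative weight, so it contributes
nothing. The infinite sums become finite ones, which are linear operators. -/
theorem fieldMode_eq_truncField (K : ℕ) (L : List ℕ) : ∀ (d : ℤ) {u : Heis} {N : ℤ},
    HasWt u N → N ≤ K → N - d ≤ K → fieldMode L d u = truncField K L d u := by
  induction L with
  | nil =>
    intro d u N _ _ _
    rw [fieldMode, truncField]
    split_ifs <;> rfl
  | cons a L ih =>
    intro d u N hu hN hd
    rw [fieldMode, truncField, LinearMap.sum_apply,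
      finsum_eq_sum_of_support_subset (s := Finset.Icc (-(K : ℤ)) K)]
    · refine Finset.sum_congr rfl fun n _ => ?_
      rw [LinearMap.smul_apply, Int.cast_smul_eq_zsmul]
      unfold normalOrder
      congr 1
      split_ifs with hn
      · rw [Module.End.mul_apply, ih _ hu hN (by omega)]
      · rw [Module.End.mul_apply, ih _ (hu.hMode n) (by omega) (by omega)]
    · intro n hn
      by_contra hK
      refine hn ?_
      simp only [Finset.coe_Icc, Set.mem_Icc, not_and_or, not_le] at hK
      dsimp only
      rcases hK with hK | hK
      · rw [if_pos (by omega), (fieldMode_hasWt L (d - n) hu).eq_zero (by omega), map_zero,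
          smul_zero]
      · rw [if_neg (by omega), (hu.hMode n).eq_zero (by omega), fieldMode_zero, smul_zero]

theorem truncField_perm (K : ℕ) {L L' : List ℕ} (h : L.Perm L') :
    truncField K L = truncField K L' := by
  induction h with
  | nil => rfl
  | cons a _ ih =>
    funext d
    simp only [truncField, ih]
  | swap a b L =>
    funext d
    simp only [truncField, normalOrder_sum, normalOrder_smul, Finset.smul_sum]
    rw [Finset.sum_comm]
    refine Finset.sum_congr rfl fun m _ => Finset.sum_congr rfl fun n _ => ?_
    rw [normalOrder_comm, smul_comm, sub_right_comm]
  | trans _ _ ih1 ih2 => exact ih1.trans ih2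

theorem normalOrder_mul_hMode (n m : ℤ) (A B : Module.End ℚ_[2] Heis)
    (h : A * hMode m = hMode m * A + B) :
    normalOrder n A * hMode m = hMode m * normalOrder n A +
      ((if n + m = 0 then (n : ℚ_[2]) else 0) • A + normalOrder n B) := by
  have hc : hMode n * hMode m = hMode m * hMode n +
      (if n + m = 0 then (n : ℚ_[2]) else 0) • (1 : Module.End ℚ_[2] Heis) :=
    LinearMap.ext fun u => hMode_commutator n m u
  unfold normalOrder
  split_ifs with h1 h2 h2
  all_goals
    simp only [h2, if_true, if_false] at hc
  · rw [mul_assoc, h, mul_add, ← mul_assoc, hc, add_mul, mul_assoc]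
    simp [add_assoc]
  · rw [mul_assoc, h, mul_add, ← mul_assoc, hc, add_mul, mul_assoc]
    simp
  · rw [mul_assoc, hc, mul_add, ← mul_assoc, h, add_mul, mul_assoc]
    simp only [mul_smul_comm, mul_one]
    abel
  · rw [mul_assoc, hc, mul_add, ← mul_assoc, h, add_mul, mul_assoc]
    simp

/-- In each factor h(m) fails to commute only with h(-m), whose coefficient is `Ring.choose (m - 1)
a`, and [h(-m), h(m)] = -m. The bound on m keeps h(-m) inside the cut-off. -/
theorem truncField_mul_hMode {K : ℕ} {m : ℤ} (hm : m ∈ Finset.Icc (-(K : ℤ)) K) (L : List ℕ) :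
    ∀ d : ℤ, truncField K L d * hMode m = hMode m * truncField K L d +
      ∑ i : Fin L.length, (((Ring.choose (m - 1) (L.get i) : ℤ) : ℚ_[2]) * -m) •
        truncField K (L.eraseIdx i) (d + m) := by
  induction L with
  | nil =>
    intro d
    rw [truncField]
    split_ifs <;> simp
  | cons a L ih =>
    intro d
    have hm' : -m ∈ Finset.Icc (-(K : ℤ)) K := by
      simp only [Finset.mem_Icc] at hm ⊢
      omega
    have hterm : ∀ n : ℤ, normalOrder n (truncField K L (d - n)) * hMode m =
        hMode m * normalOrder n (truncField K L (d - n)) +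
          ((if n = -m then -(m : ℚ_[2]) else 0) • truncField K L (d - n) +
          ∑ i : Fin L.length, (((Ring.choose (m - 1) (L.get i) : ℤ) : ℚ_[2]) * -m) •
            normalOrder n (truncField K (L.eraseIdx i) (d + m - n))) := fun n => by
      rw [normalOrder_mul_hMode n m _ _ (ih (d - n)), normalOrder_sum]
      have : (if n + m = 0 then (n : ℚ_[2]) else 0) = if n = -m then -(m : ℚ_[2]) else 0 := by
        by_cases h : n = -m
        · simp [h]
        · rw [if_neg h, if_neg (by omega)]
      rw [this]
      congr 2
      refine Finset.sum_congr rfl fun i _ => ?_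
      rw [normalOrder_smul, show d - n + m = d + m - n by ring]
    rw [truncField, Finset.sum_mul, Finset.mul_sum]
    simp only [smul_mul_assoc, mul_smul_comm, hterm, smul_add, Finset.sum_add_distrib]
    congr 1
    refine Eq.trans ?_ (Fin.sum_univ_succ (n := L.length) _).symm
    congr 1
    · rw [Finset.sum_eq_single (-m)]
      · rw [if_pos rfl, smul_smul, neg_neg, sub_neg_eq_add]
        rfl
      · intro n _ hn
        rw [if_neg hn, zero_smul, smul_zero]
      · intro h
        exact absurd hm' h
    · simp only [Finset.smul_sum]
      rw [Finset.sum_comm]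
      refine Finset.sum_congr rfl fun i _ => ?_
      simp only [Fin.val_succ, List.eraseIdx_cons_succ, truncField,
        Finset.smul_sum]
      exact Finset.sum_congr rfl fun n _ => smul_comm _ _ _

/-! ### Graded traces -/

/-- The trace of an operator over the weight space `S_(N)`. -/
def opTrace (N : ℕ) : Module.End ℚ_[2] Heis →ₗ[ℚ_[2]] ℚ_[2] :=
  ∑ w ∈ monomialsOfWeight N, MvPolynomial.lcoeff ℚ_[2] w ∘ₗ
    LinearMap.applyₗ (MvPolynomial.monomial w (1 : ℚ_[2]))

theorem opTrace_apply (N : ℕ) (A : Module.End ℚ_[2] Heis) :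
    opTrace N A = ∑ w ∈ monomialsOfWeight N,
      MvPolynomial.coeff w (A (MvPolynomial.monomial w 1)) := by
  simp [opTrace]

theorem HasWt.eq_sum {u : Heis} {N : ℕ} (hu : HasWt u N) :
    u = ∑ w ∈ monomialsOfWeight N, MvPolynomial.coeff w u • MvPolynomial.monomial w 1 := by
  conv_lhs => rw [MvPolynomial.as_sum u]
  refine (Finset.sum_subset (fun I hI => ?_) fun I _ hI => ?_).trans
    (Finset.sum_congr rfl fun I _ => ?_)
  · exact mem_monomialsOfWeight.2 (by exact_mod_cast hu I (MvPolynomial.mem_support_iff.1 hI))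
  · rw [MvPolynomial.notMem_support_iff.1 hI, map_zero]
  · rw [MvPolynomial.smul_monomial, smul_eq_mul, mul_one]

theorem opTrace_mul_comm {N M : ℕ} {A B : Module.End ℚ_[2] Heis}
    (hA : ∀ u, HasWt u M → HasWt (A u) N) (hB : ∀ u, HasWt u N → HasWt (B u) M) :
    opTrace N (A * B) = opTrace M (B * A) := by
  have hw : ∀ {N : ℕ} {w}, w ∈ monomialsOfWeight N →
      HasWt (MvPolynomial.monomial w (1 : ℚ_[2])) N := fun {N w} h => by
    rw [← mem_monomialsOfWeight.1 h]
    exact hasWt_monomial w 1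
  rw [opTrace_apply, opTrace_apply]
  have h1 : ∀ w ∈ monomialsOfWeight N,
      MvPolynomial.coeff w ((A * B) (MvPolynomial.monomial w 1)) =
      ∑ w' ∈ monomialsOfWeight M, MvPolynomial.coeff w' (B (MvPolynomial.monomial w 1)) *
        MvPolynomial.coeff w (A (MvPolynomial.monomial w' 1)) := fun w h => by
    rw [Module.End.mul_apply, (hB _ (hw h)).eq_sum, map_sum, MvPolynomial.coeff_sum]
    refine Finset.sum_congr rfl fun w' _ => ?_
    rw [← (hB _ (hw h)).eq_sum, map_smul, MvPolynomial.coeff_smul, smul_eq_mul]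
  have h2 : ∀ w ∈ monomialsOfWeight M,
      MvPolynomial.coeff w ((B * A) (MvPolynomial.monomial w 1)) =
      ∑ w' ∈ monomialsOfWeight N, MvPolynomial.coeff w' (A (MvPolynomial.monomial w 1)) *
        MvPolynomial.coeff w (B (MvPolynomial.monomial w' 1)) := fun w h => by
    rw [Module.End.mul_apply, (hA _ (hw h)).eq_sum, map_sum, MvPolynomial.coeff_sum]
    refine Finset.sum_congr rfl fun w' _ => ?_
    rw [← (hA _ (hw h)).eq_sum, map_smul, MvPolynomial.coeff_smul, smul_eq_mul]
  rw [Finset.sum_congr rfl h1, Finset.sum_congr rfl h2, Finset.sum_comm]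
  exact Finset.sum_congr rfl fun w _ => Finset.sum_congr rfl fun w' _ => mul_comm _ _

theorem opTrace_eq_zero {N : ℕ} {M : ℤ} (hM : M < 0) {A B : Module.End ℚ_[2] Heis}
    (hB : ∀ u, HasWt u N → HasWt (B u) M) : opTrace N (A * B) = 0 := by
  rw [opTrace_apply]
  refine Finset.sum_eq_zero fun w hw => ?_
  have h : HasWt (MvPolynomial.monomial w (1 : ℚ_[2])) N := by
    rw [← mem_monomialsOfWeight.1 hw]
    exact hasWt_monomial w 1
  rw [Module.End.mul_apply, (hB _ h).eq_zero hM, map_zero, MvPolynomial.coeff_zero]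

/-- The graded trace of an operator. -/
def gradedTrace : Module.End ℚ_[2] Heis →ₗ[ℚ_[2]] ℚ_[2]⟦X⟧ where
  toFun A := PowerSeries.mk fun N => opTrace N A
  map_add' A B := by ext; simp
  map_smul' a A := by ext; simp

theorem coeff_gradedTrace (A : Module.End ℚ_[2] Heis) (N : ℕ) :
    PowerSeries.coeff N (gradedTrace A) = opTrace N A := by
  simp [gradedTrace]

theorem gradedTrace_eq_X_pow_mul {A B C : Module.End ℚ_[2] Heis} (n : ℕ)
    (h1 : ∀ N < n, opTrace N A = 0) (h2 : ∀ N, opTrace (N + n) A = opTrace N B + opTrace N C) :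
    gradedTrace A = PowerSeries.X ^ n * (gradedTrace B + gradedTrace C) := by
  ext N
  rw [coeff_gradedTrace, PowerSeries.coeff_X_pow_mul']
  split_ifs with h
  · obtain ⟨M, rfl⟩ := Nat.exists_eq_add_of_le' h
    rw [h2, Nat.add_sub_cancel, map_add, coeff_gradedTrace, coeff_gradedTrace]
  · exact h1 N (by omega)

/-- The power series `qⁿ / (1 - qⁿ)`. -/
def geomSeries (n : ℕ) : ℚ_[2]⟦X⟧ := PowerSeries.X ^ n * (1 - PowerSeries.X ^ n)⁻¹

theorem eq_geomSeries_mul {n : ℕ} (hn : n ≠ 0) {f g : ℚ_[2]⟦X⟧}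
    (h : f = PowerSeries.X ^ n * (f + g)) : f = geomSeries n * g := by
  have hu : (1 - PowerSeries.X ^ n : ℚ_[2]⟦X⟧) * (1 - PowerSeries.X ^ n)⁻¹ = 1 :=
    PowerSeries.mul_inv_cancel _ (by simp [hn])
  rw [geomSeries]
  linear_combination (1 - PowerSeries.X ^ n : ℚ_[2]⟦X⟧)⁻¹ * h - f * hu

/-- Cyclicity moves h(-n) to the other side and lowers the weight space by n; commuting it back
gives T = qⁿ (T + contractions). Solving for T produces the factor qⁿ/(1 - qⁿ). -/
theorem gradedTrace_hMode_neg_mul {K n : ℕ} (hn : n ≠ 0) (hK : n ≤ K) (L : List ℕ) :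
    gradedTrace (hMode (-n) * truncField K L n) = geomSeries n *
      ∑ i : Fin L.length, (((Ring.choose (-n - 1 : ℤ) (L.get i) : ℤ) : ℚ_[2]) * n) •
        gradedTrace (truncField K (L.eraseIdx i) 0) := by
  have hw : ∀ N M : ℤ, M = N - n → ∀ u, HasWt u N → HasWt (truncField K L n u) M :=
    fun N M h u hu => h ▸ truncField_hasWt K L n hu
  have hc := truncField_mul_hMode (K := K) (m := -n) (by rw [Finset.mem_Icc]; omega) L n
  refine eq_geomSeries_mul hn ?_
  have := gradedTrace_eq_X_pow_mul (A := hMode (-n) * truncField K L n)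
    (B := hMode (-n) * truncField K L n)
    (C := ∑ i : Fin L.length, (((Ring.choose (-n - 1 : ℤ) (L.get i) : ℤ) : ℚ_[2]) * n) •
      truncField K (L.eraseIdx i) 0) n
    (fun N hN => opTrace_eq_zero (M := N - n) (by omega) (hw _ _ rfl)) fun N => ?_
  · rwa [map_sum, Finset.sum_congr rfl fun i _ => map_smul gradedTrace _ _] at this
  · rw [opTrace_mul_comm (M := N) (fun u hu => ?_) (fun u hu => ?_), hc, map_add]
    · congr 2
      refine Finset.sum_congr rfl fun i _ => ?_
      rw [add_neg_cancel]
      simp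
    · have := hu.hMode (-n)
      push_cast
      rwa [show (N : ℤ) + n = N - -n by ring]
    · exact hw _ _ (by push_cast; ring) u hu

theorem gradedTrace_mul_hMode {K n : ℕ} (hn : n ≠ 0) (hK : n ≤ K) (L : List ℕ) :
    gradedTrace (truncField K L (-n) * hMode n) = geomSeries n *
      ∑ i : Fin L.length, (((Ring.choose (n - 1 : ℤ) (L.get i) : ℤ) : ℚ_[2]) * n) •
        gradedTrace (truncField K (L.eraseIdx i) 0) := by
  have hc := truncField_mul_hMode (K := K) (m := n) (by rw [Finset.mem_Icc]; omega) L (-n)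
  refine eq_geomSeries_mul hn ?_
  have := gradedTrace_eq_X_pow_mul (A := truncField K L (-n) * hMode n)
    (B := truncField K L (-n) * hMode n)
    (C := ∑ i : Fin L.length, (((Ring.choose (n - 1 : ℤ) (L.get i) : ℤ) : ℚ_[2]) * n) •
      truncField K (L.eraseIdx i) 0) n
    (fun N hN => opTrace_eq_zero (M := N - n) (by omega) fun u hu => hu.hMode n) fun N => ?_
  · rwa [map_sum, Finset.sum_congr rfl fun i _ => map_smul gradedTrace _ _] at this
  · rw [opTrace_mul_comm (M := N) (fun u hu => ?_) (fun u hu => ?_), hc, map_add, add_assoc,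
      ← map_add, ← Finset.sum_add_distrib, Finset.sum_eq_zero, map_zero, add_zero]
    · intro i _
      rw [neg_add_cancel, ← add_smul]
      simp
    · have := truncField_hasWt K L (-n) hu
      push_cast
      rwa [show (N : ℤ) + n = N - -n by ring]
    · have := hu.hMode n
      push_cast at this
      rwa [add_sub_cancel_right] at this

/-- The thermal contraction of the fields `∂^a h(z)` and `∂^c h(z)`, with modes cut off at `±K`. -/
def contraction (K a c : ℕ) : ℚ_[2]⟦X⟧ :=
  ∑ n ∈ Finset.Icc 1 K, ((n : ℚ_[2]) *
    ((Ring.choose (n - 1 : ℤ) a : ℤ) * (Ring.choose (-n - 1 : ℤ) c : ℤ) +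
      (Ring.choose (-n - 1 : ℤ) a : ℤ) * (Ring.choose (n - 1 : ℤ) c : ℤ))) • geomSeries n

theorem sum_Icc_neg {M : Type*} [AddCommMonoid M] (K : ℕ) (f : ℤ → M) (h0 : f 0 = 0) :
    ∑ n ∈ Finset.Icc (-(K : ℤ)) K, f n = ∑ n ∈ Finset.Icc 1 K, (f (-n) + f n) := by
  induction K with
  | zero => simp [h0]
  | succ K ih =>
    have : Finset.Icc (-((K + 1 : ℕ) : ℤ)) (K + 1 : ℕ) =
        insert (-((K + 1 : ℕ) : ℤ)) (insert ((K + 1 : ℕ) : ℤ) (Finset.Icc (-(K : ℤ)) K)) := by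
      ext x
      simp only [Finset.mem_Icc, Finset.mem_insert]
      omega
    rw [this, Finset.sum_insert (by simp; omega), Finset.sum_insert (by simp), ih,
      Finset.sum_Icc_succ_top (by omega)]
    abel

/-- The recursion behind Wick's theorem: the first field is contracted with each of the others in
turn. The modes n and -n are paired, and n = 0 drops out because h(0) = 0. -/
theorem gradedTrace_truncField_cons (K a : ℕ) (L : List ℕ) :
    gradedTrace (truncField K (a :: L) 0) =
      ∑ i : Fin L.length, contraction K a (L.get i) *
        gradedTrace (truncField K (L.eraseIdx i) 0) := by
  rw [truncField, map_sum, sum_Icc_neg _ _ (by simp [normalOrder, hMode_zero])]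
  simp only [contraction, Finset.sum_mul]
  rw [Finset.sum_comm]
  refine Finset.sum_congr rfl fun n hn => ?_
  obtain ⟨h1, hK⟩ := Finset.mem_Icc.1 hn
  have h0 : n ≠ 0 := by omega
  rw [map_smul, map_smul, normalOrder, if_pos (by omega), normalOrder, if_neg (by omega),
    zero_sub, zero_sub, neg_neg, gradedTrace_hMode_neg_mul h0 hK, gradedTrace_mul_hMode h0 hK,
    Finset.mul_sum, Finset.mul_sum, Finset.smul_sum, Finset.smul_sum, ← Finset.sum_add_distrib]
  refine Finset.sum_congr rfl fun i _ => ?_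
  rw [mul_smul_comm, mul_smul_comm, smul_smul, smul_smul, ← add_smul, smul_mul_assoc]
  congr 1
  ring

end HeisenbergTwoAdic
end

noncomputable section
namespace HeisenbergTwoAdic
open scoped Nat NNReal PowerSeries

/-! ### The thermal functional and Wick's theorem -/

/-- Polynomials in the creation operators with coefficients in `q`-series. -/
abbrev QHeis : Type := MvPolynomial ℕ ℚ_[2]⟦X⟧

/-- The graded trace as a functional on states, extended to `q`-series coefficients; modes are cut
off at `±K`. -/
def thermal (K : ℕ) : QHeis →ₗ[ℚ_[2]⟦X⟧] ℚ_[2]⟦X⟧ :=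
  (MvPolynomial.basisMonomials ℕ ℚ_[2]⟦X⟧).constr ℚ_[2]⟦X⟧ fun I =>
    gradedTrace (truncField K (Finsupp.toMultiset I).toList 0)

theorem thermal_monomial (K : ℕ) (I : ℕ →₀ ℕ) :
    thermal K (MvPolynomial.monomial I 1) =
      gradedTrace (truncField K (Finsupp.toMultiset I).toList 0) := by
  have := (MvPolynomial.basisMonomials ℕ ℚ_[2]⟦X⟧).constr_basis ℚ_[2]⟦X⟧
    (fun I => gradedTrace (truncField K (Finsupp.toMultiset I).toList 0)) I
  rwa [MvPolynomial.coe_basisMonomials] at this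

theorem prod_map_X {R : Type*} [CommSemiring R] (L : List ℕ) :
    (L.map (MvPolynomial.X (R := R))).prod =
      MvPolynomial.monomial (Multiset.toFinsupp (L : Multiset ℕ)) 1 := by
  induction L with
  | nil => simp
  | cons a L ih =>
    rw [List.map_cons, List.prod_cons, ih, MvPolynomial.X, MvPolynomial.monomial_mul,
      ← Multiset.cons_coe, ← Multiset.singleton_add, map_add, Multiset.toFinsupp_singleton,
      one_mul]

theorem thermal_prod (K : ℕ) (L : List ℕ) :
    thermal K (L.map MvPolynomial.X).prod = gradedTrace (truncField K L 0) := by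
  rw [prod_map_X, thermal_monomial, Multiset.toFinsupp_toMultiset]
  rw [truncField_perm K (Multiset.coe_eq_coe.1 (Multiset.coe_toList (L : Multiset ℕ)))]

/-- The derivation contracting the field `∂^a h(z)` with another field. -/
def contractionDer (K a : ℕ) : Derivation ℚ_[2]⟦X⟧ QHeis QHeis :=
  MvPolynomial.mkDerivation _ fun c => MvPolynomial.C (contraction K a c)

theorem contractionDer_prod (K a : ℕ) (L : List ℕ) :
    contractionDer K a (L.map MvPolynomial.X).prod =
      ∑ i : Fin L.length, contraction K a (L.get i) •
        ((L.eraseIdx i).map MvPolynomial.X).prod := by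
  induction L with
  | nil => simp
  | cons b L ih =>
    refine Eq.trans ?_ (Fin.sum_univ_succ (n := L.length) _).symm
    rw [List.map_cons, List.prod_cons, Derivation.leibniz, ih, Finset.smul_sum, add_comm]
    congr 1
    · rw [contractionDer, MvPolynomial.mkDerivation_X]
      simp [MvPolynomial.smul_eq_C_mul, mul_comm]
    · refine Finset.sum_congr rfl fun i _ => ?_
      simp [MvPolynomial.smul_eq_C_mul, mul_left_comm]

/-- Gaussian integration by parts: summing over the contractions with one field is a derivation in
the remaining factors, so the recursion for lists of fields becomes an identity for all polynomials.
-/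
theorem thermal_X_mul (K a : ℕ) (M : QHeis) :
    thermal K (MvPolynomial.X a * M) = thermal K (contractionDer K a M) := by
  have : (thermal K).comp (LinearMap.mulLeft _ (MvPolynomial.X a)) =
      (thermal K).comp (contractionDer K a).toLinearMap := by
    refine (MvPolynomial.basisMonomials ℕ ℚ_[2]⟦X⟧).ext fun I => ?_
    rw [MvPolynomial.coe_basisMonomials]
    have hI : MvPolynomial.monomial I (1 : ℚ_[2]⟦X⟧) =
        ((Finsupp.toMultiset I).toList.map MvPolynomial.X).prod := by
      rw [prod_map_X, Multiset.coe_toList, Finsupp.toMultiset_toFinsupp]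
    simp only [LinearMap.comp_apply, LinearMap.mulLeft_apply, Derivation.coeFn_coe, hI]
    generalize (Finsupp.toMultiset I).toList = L
    have h1 : MvPolynomial.X a * (L.map MvPolynomial.X).prod =
        ((a :: L).map (MvPolynomial.X (R := ℚ_[2]⟦X⟧))).prod := by simp
    rw [h1, thermal_prod, gradedTrace_truncField_cons, contractionDer_prod, map_sum]
    refine Finset.sum_congr rfl fun i _ => ?_
    rw [map_smul, thermal_prod, smul_eq_mul]
  exact LinearMap.congr_fun this M

/-- The state `∑ xₐ h(-(a+1))` with `a < 3`. -/
def linState {R : Type*} [CommSemiring R] (x : ℕ → R) : MvPolynomial ℕ R :=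
  ∑ a ∈ Finset.range 3, x a • MvPolynomial.X a

/-- The thermal contraction of two linear states. -/
def linContraction (K : ℕ) (x y : ℕ → ℚ_[2]⟦X⟧) : ℚ_[2]⟦X⟧ :=
  ∑ a ∈ Finset.range 3, ∑ b ∈ Finset.range 3, x a * y b * contraction K a b

/-- The derivation contracting with a linear state. -/
def linDer (K : ℕ) (x : ℕ → ℚ_[2]⟦X⟧) : Derivation ℚ_[2]⟦X⟧ QHeis QHeis :=
  MvPolynomial.mkDerivation _ fun b =>
    MvPolynomial.C (∑ a ∈ Finset.range 3, x a * contraction K a b)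

theorem linDer_apply (K : ℕ) (x : ℕ → ℚ_[2]⟦X⟧) (M : QHeis) :
    linDer K x M = ∑ a ∈ Finset.range 3, x a • contractionDer K a M := by
  have : linDer K x = x 0 • contractionDer K 0 + x 1 • contractionDer K 1 +
      x 2 • contractionDer K 2 := by
    refine MvPolynomial.derivation_ext fun b => ?_
    simp [linDer, contractionDer, MvPolynomial.mkDerivation_X, Finset.sum_range_succ,
      MvPolynomial.smul_eq_C_mul]
  rw [this]
  simp [Finset.sum_range_succ]

theorem thermal_linState_mul (K : ℕ) (x : ℕ → ℚ_[2]⟦X⟧) (M : QHeis) :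
    thermal K (linState x * M) = thermal K (linDer K x M) := by
  rw [linDer_apply]
  simp only [linState, Finset.sum_mul, map_sum, map_smul, ← thermal_X_mul, smul_mul_assoc]

theorem linDer_linState (K : ℕ) (x y : ℕ → ℚ_[2]⟦X⟧) :
    linDer K x (linState y) = MvPolynomial.C (linContraction K x y) := by
  rw [linState, map_sum, linContraction, Finset.sum_comm, map_sum]
  refine Finset.sum_congr rfl fun b _ => ?_
  rw [Derivation.map_smul, linDer, MvPolynomial.mkDerivation_X, MvPolynomial.smul_eq_C_mul,
    ← map_mul, Finset.mul_sum]
  congr 1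
  exact Finset.sum_congr rfl fun a _ => by ring

/-- Wick's theorem for powers of two linear states with vanishing mixed contraction. -/
theorem thermal_pow_mul_pow (K : ℕ) (x y : ℕ → ℚ_[2]⟦X⟧) (hxy : linContraction K x y = 0)
    (k l : ℕ) : thermal K (linState x ^ (2 * k) * linState y ^ (2 * l)) =
      ((2 * k - 1)‼ * (2 * l - 1)‼ : ℕ) * linContraction K x x ^ k * linContraction K y y ^ l *
        gradedTrace 1 := by
  have hdf : ∀ k : ℕ, (2 * (k + 1) - 1)‼ = (2 * k + 1) * (2 * k - 1)‼ := fun k => by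
    rcases k with _ | k
    · rfl
    · rw [show 2 * (k + 1 + 1) - 1 = 2 * k + 1 + 2 by omega, Nat.doubleFactorial_add_two]
      rfl
  induction k with
  | zero =>
    induction l with
    | zero =>
      have := thermal_prod K []
      simpa [truncField] using this
    | succ l ih =>
      have h : linDer K y (linState y ^ (2 * l + 1)) =
          ((2 * l + 1 : ℕ) * linContraction K y y) • linState y ^ (2 * l) := by
        rw [Derivation.leibniz_pow, linDer_linState, MvPolynomial.smul_eq_C_mul, smul_eq_mul,
          nsmul_eq_mul, map_mul, map_natCast]
        simp
        ring
      rw [mul_zero, pow_zero, one_mul, show 2 * (l + 1) = 2 * l + 1 + 1 by ring, pow_succ',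
        thermal_linState_mul, h, map_smul]
      rw [mul_zero, pow_zero, one_mul] at ih
      rw [ih, show 2 * l + 1 + 1 = 2 * (l + 1) by ring, hdf]
      push_cast
      simp only [smul_eq_mul]
      ring
  | succ k ih =>
    have h : linDer K x (linState x ^ (2 * k + 1) * linState y ^ (2 * l)) =
        ((2 * k + 1 : ℕ) * linContraction K x x) •
          (linState x ^ (2 * k) * linState y ^ (2 * l)) := by
      rw [Derivation.leibniz, Derivation.leibniz_pow, Derivation.leibniz_pow, linDer_linState,
        linDer_linState, hxy, MvPolynomial.smul_eq_C_mul, map_mul, map_natCast]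
      simp
      ring
    rw [show 2 * (k + 1) = 2 * k + 1 + 1 by ring, pow_succ', mul_assoc, thermal_linState_mul, h,
      map_smul, ih, show 2 * k + 1 + 1 = 2 * (k + 1) by ring, hdf]
    push_cast
    simp only [smul_eq_mul]
    ring

/-- The cut-off must reach N to compute the coefficient of q^N, so K is chosen afresh for each
coefficient. -/
theorem coeff_thermal_map (v : Heis) {N K : ℕ} (h : N ≤ K) :
    PowerSeries.coeff N (thermal K (MvPolynomial.map PowerSeries.C v)) = trace v N := by
  have h1 : MvPolynomial.map (PowerSeries.C (R := ℚ_[2])) v =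
      ∑ I ∈ v.support, PowerSeries.C (MvPolynomial.coeff I v) •
        MvPolynomial.monomial I (1 : ℚ_[2]⟦X⟧) := by
    conv_lhs => rw [MvPolynomial.as_sum v, map_sum]
    refine Finset.sum_congr rfl fun I _ => ?_
    rw [MvPolynomial.map_monomial, MvPolynomial.smul_monomial, smul_eq_mul, mul_one]
  rw [h1, map_sum, map_sum, trace]
  simp only [map_smul, thermal_monomial, smul_eq_mul, PowerSeries.coeff_C_mul,
    coeff_gradedTrace, opTrace_apply, zeroMode, MvPolynomial.coeff_sum, MvPolynomial.coeff_smul,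
    Finset.mul_sum]
  rw [Finset.sum_comm]
  refine Finset.sum_congr rfl fun w hw => Finset.sum_congr rfl fun I _ => ?_
  have hwt : HasWt (MvPolynomial.monomial w (1 : ℚ_[2])) N := by
    rw [← mem_monomialsOfWeight.1 hw]
    exact hasWt_monomial w 1
  rw [fieldMode_eq_truncField K _ 0 hwt (by exact_mod_cast h) (by simpa using h)]

end HeisenbergTwoAdic
end

noncomputable section
namespace HeisenbergTwoAdic
open scoped Nat NNReal PowerSeries

/-! ### The character of the states built from `h[-2]` and `h[-3]` -/

/-- The power series `∑ σₖ(n) qⁿ`. -/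
def sigmaSeries (k : ℕ) : ℚ_[2]⟦X⟧ := PowerSeries.mk fun n => (ArithmeticFunction.sigma k n : ℕ)

theorem coeff_geomSeries {n : ℕ} (hn : n ≠ 0) (N : ℕ) :
    PowerSeries.coeff N (geomSeries n) = if N ≠ 0 ∧ n ∣ N then 1 else 0 := by
  have h := eq_geomSeries_mul (n := n) hn (g := 1)
    (f := PowerSeries.mk fun N => if N ≠ 0 ∧ n ∣ N then 1 else 0) ?_
  · rw [mul_one] at h
    rw [← h, PowerSeries.coeff_mk]
  · ext N
    rw [PowerSeries.coeff_mk, PowerSeries.coeff_X_pow_mul']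
    by_cases hN : n ≤ N
    · obtain ⟨M, rfl⟩ := Nat.exists_eq_add_of_le' hN
      rw [if_pos hN, Nat.add_sub_cancel, map_add, PowerSeries.coeff_mk, PowerSeries.coeff_one]
      rcases eq_or_ne M 0 with rfl | hM
      · simp [hn]
      · simp [hM]
    · rw [if_neg hN, if_neg]
      rintro ⟨h0, hd⟩
      exact hN (Nat.le_of_dvd (Nat.pos_of_ne_zero h0) hd)

/-- Lambert expansion of the divisor sums; the divisors of N are at most K, so the cut-off is
invisible here. -/
theorem coeff_sum_geomSeries (k : ℕ) {N K : ℕ} (h : N ≤ K) :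
    PowerSeries.coeff N (∑ n ∈ Finset.Icc 1 K, ((n : ℚ_[2]) ^ k) • geomSeries n) =
      PowerSeries.coeff N (sigmaSeries k) := by
  rw [map_sum, sigmaSeries, PowerSeries.coeff_mk, ArithmeticFunction.sigma_apply]
  rcases eq_or_ne N 0 with rfl | hN
  · simp only [Nat.divisors_zero, Finset.sum_empty, Nat.cast_zero]
    refine Finset.sum_eq_zero fun n hn => ?_
    have := (Finset.mem_Icc.1 hn).1
    rw [PowerSeries.coeff_smul, coeff_geomSeries (by omega)]
    simp
  · push_cast
    rw [← Finset.sum_subset (s₁ := N.divisors)]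
    · refine Finset.sum_congr rfl fun n hn => ?_
      obtain ⟨h1, h2⟩ := Nat.mem_divisors.1 hn
      rw [PowerSeries.coeff_smul, coeff_geomSeries (ne_zero_of_dvd_ne_zero h2 h1),
        if_pos ⟨hN, h1⟩, smul_eq_mul, mul_one]
    · intro n hn
      have h1 := Nat.divisor_le hn
      have h2 := Nat.pos_of_mem_divisors hn
      exact Finset.mem_Icc.2 ⟨h2, h1.trans h⟩
    · intro n hn hn'
      have := (Finset.mem_Icc.1 hn).1
      rw [PowerSeries.coeff_smul, coeff_geomSeries (by omega), if_neg, smul_zero]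
      rintro ⟨h0, hd⟩
      exact hn' (Nat.mem_divisors.2 ⟨hd, h0⟩)

/-- The coefficient of `h(n)` in the field of a linear state. -/
def fieldCoeff (x : ℕ → ℚ_[2]) (n : ℤ) : ℚ_[2] :=
  ∑ a ∈ Finset.range 3, x a * (Ring.choose (-n - 1) a : ℤ)

theorem linContraction_eq (K : ℕ) (x y : ℕ → ℚ_[2]) :
    linContraction K (fun a => PowerSeries.C (x a)) (fun a => PowerSeries.C (y a)) =
      ∑ n ∈ Finset.Icc 1 K, (n * (fieldCoeff x (-n) * fieldCoeff y n +
        fieldCoeff x n * fieldCoeff y (-n))) • geomSeries n := by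
  simp only [linContraction, contraction, Finset.mul_sum, ← map_mul, ← PowerSeries.smul_eq_C_mul]
  simp only [fieldCoeff, neg_neg]
  simp_rw [Finset.sum_comm (t := Finset.Icc 1 K)]
  refine Finset.sum_congr rfl fun n _ => ?_
  simp only [smul_smul, ← Finset.sum_smul, Finset.sum_range_succ, Finset.range_zero,
    Finset.sum_empty]
  congr 1
  ring

/-- The coefficients of the creation part `h(-2) + h(-1)` of `h[-2]`. -/
def coeffA (a : ℕ) : ℚ_[2] := if a = 0 then 1 else if a = 1 then 1 else 0

/-- The coefficients of the creation part `h(-3) + 3/2 h(-2) + 1/2 h(-1)` of `h[-3]`. -/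
def coeffB (a : ℕ) : ℚ_[2] := if a = 0 then 1 / 2 else if a = 1 then 3 / 2 else 1

theorem choose_int_two (n : ℤ) : ((Ring.choose n 2 : ℤ) : ℚ_[2]) = n * (n - 1) / 2 := by
  induction n using Int.induction_on with
  | zero => simp
  | succ n ih =>
    rw [Ring.choose_succ_succ, Ring.choose_one_right]
    push_cast at ih ⊢
    rw [ih]
    ring
  | pred n ih =>
    have h := Ring.choose_succ_succ (-(n : ℤ) - 1) 1
    rw [Ring.choose_one_right, sub_add_cancel] at h
    rw [h] at ih
    push_cast at ih ⊢
    linear_combination ih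

/-- The mode coefficients are monomials in n, odd here and even for `coeffB`. Hence each
self-contraction is a single divisor sum and the mixed contraction vanishes. -/
theorem fieldCoeff_A (n : ℤ) : fieldCoeff coeffA n = -n := by
  simp [fieldCoeff, coeffA, Finset.sum_range_succ]

theorem fieldCoeff_B (n : ℤ) : fieldCoeff coeffB n = n ^ 2 / 2 := by
  simp [fieldCoeff, coeffB, Finset.sum_range_succ, choose_int_two]
  ring

theorem linContraction_A_A (K : ℕ) :
    linContraction K (fun a => PowerSeries.C (coeffA a)) (fun a => PowerSeries.C (coeffA a)) =
      (-2 : ℚ_[2]) • ∑ n ∈ Finset.Icc 1 K, ((n : ℚ_[2]) ^ 3) • geomSeries n := by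
  rw [linContraction_eq, Finset.smul_sum]
  refine Finset.sum_congr rfl fun n _ => ?_
  rw [fieldCoeff_A, fieldCoeff_A, smul_smul]
  congr 1
  push_cast
  ring

theorem linContraction_A_B (K : ℕ) :
    linContraction K (fun a => PowerSeries.C (coeffA a)) (fun a => PowerSeries.C (coeffB a)) =
      0 := by
  rw [linContraction_eq]
  refine Finset.sum_eq_zero fun n _ => ?_
  rw [fieldCoeff_A, fieldCoeff_A, fieldCoeff_B, fieldCoeff_B]
  push_cast
  ring_nf
  exact zero_smul _ _

theorem linContraction_B_B (K : ℕ) :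
    linContraction K (fun a => PowerSeries.C (coeffB a)) (fun a => PowerSeries.C (coeffB a)) =
      (1 / 2 : ℚ_[2]) • ∑ n ∈ Finset.Icc 1 K, ((n : ℚ_[2]) ^ 5) • geomSeries n := by
  rw [linContraction_eq, Finset.smul_sum]
  refine Finset.sum_congr rfl fun n _ => ?_
  rw [fieldCoeff_B, fieldCoeff_B, smul_smul]
  congr 1
  push_cast
  ring

/-! ### The graded dimension of the Heisenberg algebra -/

/-- The generating function of the monomials in the first `k` variables. -/
def dimSeries (k : ℕ) : ℚ_[2]⟦X⟧ :=
  PowerSeries.mk fun N =>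
    (((monomialsOfWeight N).filter fun I => I.support ⊆ Finset.range k).card : ℚ_[2])

theorem dimSeries_zero : dimSeries 0 = 1 := by
  ext N
  rw [dimSeries, PowerSeries.coeff_mk, PowerSeries.coeff_one]
  rcases eq_or_ne N 0 with rfl | hN
  · rw [if_pos rfl, Finset.card_eq_one.2 ⟨0, ?_⟩, Nat.cast_one]
    ext I
    simp only [Finset.range_zero, Finset.subset_empty, Finsupp.support_eq_empty,
      Finset.mem_filter, mem_monomialsOfWeight, Finset.mem_singleton]
    exact ⟨fun h => h.2, fun h => ⟨by simp [h, wt], h⟩⟩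
  · rw [if_neg hN, Finset.card_eq_zero.2, Nat.cast_zero]
    refine Finset.filter_eq_empty_iff.2 fun I hI h => hN ?_
    rw [Finset.range_zero, Finset.subset_empty, Finsupp.support_eq_empty] at h
    rw [← mem_monomialsOfWeight.1 hI, h]
    simp [wt]

/-- Monomials are split according to whether the variable of index k occurs; if it does, removing
one copy lowers the weight by k + 1. -/
theorem one_sub_mul_dimSeries (k : ℕ) :
    (1 - PowerSeries.X ^ (k + 1)) * dimSeries (k + 1) = dimSeries k := by
  rw [sub_mul, one_mul, sub_eq_iff_eq_add]
  ext N
  rw [map_add, PowerSeries.coeff_X_pow_mul']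
  simp only [dimSeries, PowerSeries.coeff_mk]
  rw [← Finset.card_filter_add_card_filter_not (s := (monomialsOfWeight N).filter _)
    (fun I => I k = 0)]
  push_cast
  congr 2
  · congr 1
    ext I
    simp only [Finset.mem_filter, and_assoc, and_congr_right_iff]
    intro _
    constructor
    · rintro ⟨h1, h2⟩ j hj
      have := h1 hj
      have hjk : j ≠ k := fun h => Finsupp.mem_support_iff.1 hj (h ▸ h2)
      simp only [Finset.mem_range] at this ⊢
      omega
    · intro h
      refine ⟨h.trans (Finset.range_subset_range.2 k.le_succ), ?_⟩
      by_contra hk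
      simpa using h (Finsupp.mem_support_iff.2 hk)
  · split_ifs with hN
    · congr 1
      refine Finset.card_bij' (fun I _ => I - Finsupp.single k 1)
        (fun I _ => I + Finsupp.single k 1) ?_ ?_ ?_ ?_
      · intro I hI
        simp only [Finset.mem_filter, mem_monomialsOfWeight] at hI ⊢
        obtain ⟨⟨h1, h2⟩, h3⟩ := hI
        have h4 : I - Finsupp.single k 1 + Finsupp.single k 1 = I :=
          tsub_add_cancel_of_le (Finsupp.single_le_iff.2 (Nat.one_le_iff_ne_zero.2 h3))
        have h5 := congrArg wt h4
        rw [wt_add, wt_single] at h5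
        refine ⟨by omega, fun j hj => h2 ?_⟩
        rw [Finsupp.mem_support_iff] at hj ⊢
        rw [Finsupp.tsub_apply] at hj
        omega
      · intro I hI
        simp only [Finset.mem_filter, mem_monomialsOfWeight] at hI ⊢
        obtain ⟨h1, h2⟩ := hI
        refine ⟨⟨?_, ?_⟩, by simp⟩
        · rw [wt_add, wt_single]
          omega
        · refine Finsupp.support_add.trans (Finset.union_subset h2 ?_)
          exact Finsupp.support_single_subset.trans (by simp)
      · intro I hI
        have h3 := (Finset.mem_filter.1 hI).2
        exact tsub_add_cancel_of_le (Finsupp.single_le_iff.2 (Nat.one_le_iff_ne_zero.2 h3))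
      · intro I hI
        simp
    · rw [Finset.card_eq_zero.2, Nat.cast_zero]
      refine Finset.filter_eq_empty_iff.2 fun I hI h3 => hN ?_
      have h4 : I - Finsupp.single k 1 + Finsupp.single k 1 = I :=
        tsub_add_cancel_of_le (Finsupp.single_le_iff.2 (Nat.one_le_iff_ne_zero.2 h3))
      have h5 := congrArg wt h4
      rw [wt_add, wt_single, mem_monomialsOfWeight.1 (Finset.mem_filter.1 hI).1] at h5
      omega

theorem prod_one_sub_mul_dimSeries (k : ℕ) :
    (∏ j ∈ Finset.range k, (1 - (PowerSeries.X : ℚ_[2]⟦X⟧) ^ (j + 1))) * dimSeries k = 1 := by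
  induction k with
  | zero => simp [dimSeries_zero]
  | succ k ih => rw [Finset.prod_range_succ, mul_assoc, one_sub_mul_dimSeries, ih]

theorem coeff_gradedTrace_one {N k : ℕ} (h : N ≤ k) :
    PowerSeries.coeff N (gradedTrace 1) = PowerSeries.coeff N (dimSeries k) := by
  rw [coeff_gradedTrace, opTrace_apply, dimSeries, PowerSeries.coeff_mk,
    Finset.filter_true_of_mem]
  · simp
  · intro I hI j hj
    rw [← mem_monomialsOfWeight.1 hI] at h
    have h1 : I j * (j + 1) ≤ wt I :=
      Finset.single_le_sum (f := fun j => I j * (j + 1)) (fun _ _ => Nat.zero_le _) hj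
    have h2 : 1 ≤ I j := Nat.one_le_iff_ne_zero.2 (Finsupp.mem_support_iff.1 hj)
    rw [Finset.mem_range]
    nlinarith

theorem etaProd_eq : etaProd = eulerSeries ℚ_[2] := rfl

theorem etaProd_mul_gradedTrace_one : etaProd * gradedTrace 1 = 1 := by
  ext N
  rw [← prod_one_sub_mul_dimSeries N, PowerSeries.coeff_mul, PowerSeries.coeff_mul]
  refine Finset.sum_congr rfl fun p hp => ?_
  have := Finset.HasAntidiagonal.mem_antidiagonal.1 hp
  rw [coeff_gradedTrace_one (k := N) (by omega), etaProd_eq,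
    coeff_eulerSeries (Finset.range_subset_range.2 (by omega : p.1 ≤ N))]

/-! ### The character of the Gaussian states -/

theorem X_pow_dvd_sum_geomSeries_sub (k K : ℕ) :
    PowerSeries.X ^ (K + 1) ∣
      (∑ n ∈ Finset.Icc 1 K, ((n : ℚ_[2]) ^ k) • geomSeries n) - sigmaSeries k := by
  refine PowerSeries.X_pow_dvd_iff.2 fun N hN => ?_
  rw [map_sub, coeff_sum_geomSeries k (by omega), sub_self]

/-- The creation part of `h[-2]`. -/
def stateA : Heis := linState coeffA

/-- The creation part of `h[-3]`. -/
def stateB : Heis := linState coeffB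

theorem map_linState (x : ℕ → ℚ_[2]) :
    MvPolynomial.map PowerSeries.C (linState x) =
      linState fun a => (PowerSeries.C (x a) : ℚ_[2]⟦X⟧) := by
  simp [linState, MvPolynomial.smul_eq_C_mul]

/-- The coefficient of q^N is computed with cut-off K = N, where the truncated divisor sums agree
with the full ones modulo q^(N+1). -/
theorem mk_trace_stateA_pow_mul_stateB_pow (k l : ℕ) :
    PowerSeries.mk (trace (stateA ^ (2 * k) * stateB ^ (2 * l))) =
      ((2 * k - 1)‼ * (2 * l - 1)‼ : ℕ) * ((-2 : ℚ_[2]) • sigmaSeries 3) ^ k *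
        ((1 / 2 : ℚ_[2]) • sigmaSeries 5) ^ l * gradedTrace 1 := by
  ext N
  rw [PowerSeries.coeff_mk, ← coeff_thermal_map _ le_rfl, map_mul, map_pow, map_pow, stateA,
    stateB, map_linState, map_linState, thermal_pow_mul_pow N _ _ (linContraction_A_B N),
    linContraction_A_A, linContraction_B_B]
  set s3 := ∑ n ∈ Finset.Icc 1 N, ((n : ℚ_[2]) ^ 3) • geomSeries n with hs3
  set s5 := ∑ n ∈ Finset.Icc 1 N, ((n : ℚ_[2]) ^ 5) • geomSeries n with hs5
  have h3 : PowerSeries.X ^ (N + 1) ∣ ((-2 : ℚ_[2]) • s3) ^ k -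
      ((-2 : ℚ_[2]) • sigmaSeries 3) ^ k := by
    refine Dvd.dvd.trans ?_ (sub_dvd_pow_sub_pow _ _ k)
    rw [← smul_sub, PowerSeries.smul_eq_C_mul]
    exact (X_pow_dvd_sum_geomSeries_sub 3 N).mul_left _
  have h5 : PowerSeries.X ^ (N + 1) ∣ ((1 / 2 : ℚ_[2]) • s5) ^ l -
      ((1 / 2 : ℚ_[2]) • sigmaSeries 5) ^ l := by
    refine Dvd.dvd.trans ?_ (sub_dvd_pow_sub_pow _ _ l)
    rw [← smul_sub, PowerSeries.smul_eq_C_mul]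
    exact (X_pow_dvd_sum_geomSeries_sub 5 N).mul_left _
  rw [← sub_eq_zero, ← map_sub]
  refine PowerSeries.X_pow_dvd_iff.1 ?_ N (Nat.lt_add_one N)
  obtain ⟨u, hu⟩ := h3
  obtain ⟨v, hv⟩ := h5
  rw [sub_eq_iff_eq_add] at hu hv
  rw [hu, hv]
  exact ⟨(((2 * k - 1)‼ * (2 * l - 1)‼ : ℕ) : ℚ_[2]⟦X⟧) * gradedTrace 1 *
    (u * (((1 / 2 : ℚ_[2]) • sigmaSeries 5) ^ l + PowerSeries.X ^ (N + 1) * v) +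
      ((-2 : ℚ_[2]) • sigmaSeries 3) ^ k * v), by ring⟩

theorem character_stateA_pow_mul_stateB_pow (k l : ℕ) :
    character (stateA ^ (2 * k) * stateB ^ (2 * l)) =
      ((2 * k - 1)‼ * (2 * l - 1)‼ : ℕ) * ((-2 : ℚ_[2]) • sigmaSeries 3) ^ k *
        ((1 / 2 : ℚ_[2]) • sigmaSeries 5) ^ l := by
  rw [character, mk_trace_stateA_pow_mul_stateB_pow, mul_left_comm, etaProd_mul_gradedTrace_one,
    mul_one]

end HeisenbergTwoAdic
end

noncomputable section
namespace HeisenbergTwoAdic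
open scoped Nat NNReal PowerSeries

/-! ### The coefficients of the square-bracket modes -/

/-- The power series `(e^z - 1) / z`. -/
def expQuot : ℚ_[2]⟦X⟧ := PowerSeries.mk fun n => ((n + 1)! : ℚ_[2])⁻¹

/-- The Bernoulli series `z / (e^z - 1)`. -/
def bernSeries : ℚ_[2]⟦X⟧ := expQuot⁻¹

theorem X_mul_expQuot : PowerSeries.X * expQuot = PowerSeries.exp ℚ_[2] - 1 := by
  ext n
  rcases n with _ | n
  · simp
  · simp [PowerSeries.coeff_succ_X_mul, expQuot, PowerSeries.coeff_exp, PowerSeries.coeff_one]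

theorem expQuot_mul_bernSeries : expQuot * bernSeries = 1 :=
  PowerSeries.mul_inv_cancel _ (by
    rw [← PowerSeries.coeff_zero_eq_constantCoeff_apply]
    simp [expQuot])

/-- Substitute e^z = 1 + z · `expQuot` and cancel one Bernoulli factor. The residues then involve
only powers of the Bernoulli series. -/
theorem exp_mul_bernSeries_pow (k : ℕ) :
    bernSeries ^ (k + 1) * PowerSeries.exp ℚ_[2] =
      bernSeries ^ (k + 1) + PowerSeries.X * bernSeries ^ k := by
  have h1 := X_mul_expQuot
  have h2 := expQuot_mul_bernSeries
  rw [sub_eq_iff_eq_add.1 h1.symm, pow_succ]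
  linear_combination (PowerSeries.X * bernSeries ^ k) * h2

theorem coeff_coe_mul_single (f : ℚ_[2]⟦X⟧) (n : ℤ) (m : ℕ) :
    ((f : LaurentSeries ℚ_[2]) * (HahnSeries.single n 1 : LaurentSeries ℚ_[2])).coeff (m + n) =
      PowerSeries.coeff m f := by
  rw [HahnSeries.coeff_mul_single_add, mul_one, HahnSeries.ofPowerSeries_apply_coeff]

theorem sqCoeff_neg_neg (m k : ℕ) : sqCoeff (-(m + 1)) (-(k + 1)) =
    PowerSeries.coeff m ((PowerSeries.X * expQuot) ^ k * PowerSeries.exp ℚ_[2]) := by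
  rw [sqCoeff, show (-(-((k : ℤ) + 1)) - 1) = (k : ℕ) by ring, zpow_natCast, ← X_mul_expQuot,
    ← map_pow, ← map_mul, show (-1 : ℤ) = m + -(m + 1) by ring, coeff_coe_mul_single]

/-- Here (e^z - 1)^(-k-1) = z^(-k-1) B^(k+1) with B the Bernoulli series, and together with z^(-m-1)
the residue is the coefficient of index m + k + 1. -/
theorem sqCoeff_neg_natCast (m k : ℕ) : sqCoeff (-(m + 1)) k =
    PowerSeries.coeff (m + k + 1) (bernSeries ^ (k + 1) * PowerSeries.exp ℚ_[2]) := by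
  have hX : (HahnSeries.ofPowerSeries ℤ ℚ_[2]) PowerSeries.X * HahnSeries.single (-1) 1 = 1 := by
    rw [HahnSeries.ofPowerSeries_X, HahnSeries.single_mul_single]
    simp
  have hB : (HahnSeries.ofPowerSeries ℤ ℚ_[2]) expQuot *
      (HahnSeries.ofPowerSeries ℤ ℚ_[2]) bernSeries = 1 := by
    rw [← map_mul (HahnSeries.ofPowerSeries ℤ ℚ_[2]), expQuot_mul_bernSeries, map_one]
  have h2 : (HahnSeries.ofPowerSeries ℤ ℚ_[2]) (PowerSeries.exp ℚ_[2] - 1) *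
      ((HahnSeries.ofPowerSeries ℤ ℚ_[2]) bernSeries * HahnSeries.single (-1) 1) = 1 := by
    rw [← X_mul_expQuot, map_mul (HahnSeries.ofPowerSeries ℤ ℚ_[2])]
    linear_combination (HahnSeries.ofPowerSeries ℤ ℚ_[2] expQuot *
      HahnSeries.ofPowerSeries ℤ ℚ_[2] bernSeries) * hX + hB
  have h1 : ((PowerSeries.exp ℚ_[2] - 1 : ℚ_[2]⟦X⟧) : LaurentSeries ℚ_[2]) ^ (-(k : ℤ) - 1) =
      ((bernSeries ^ (k + 1) : ℚ_[2]⟦X⟧) : LaurentSeries ℚ_[2]) *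
        (HahnSeries.single (-(k : ℤ) - 1) 1 : LaurentSeries ℚ_[2]) := by
    rw [show -(k : ℤ) - 1 = -((k + 1 : ℕ) : ℤ) by push_cast; ring, zpow_neg, zpow_natCast,
      ← inv_pow, inv_eq_of_mul_eq_one_right h2, mul_pow,
      map_pow (HahnSeries.ofPowerSeries ℤ ℚ_[2]), HahnSeries.single_pow]
    simp
  rw [sqCoeff, h1, mul_right_comm _ _ ((PowerSeries.exp ℚ_[2] : ℚ_[2]⟦X⟧) : LaurentSeries ℚ_[2]),
    mul_assoc, HahnSeries.single_mul_single, ← map_mul, mul_one,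
    show (-1 : ℤ) = ((m + k + 1 : ℕ) : ℤ) + (-(k : ℤ) - 1 + -(m + 1)) by push_cast; ring,
    coeff_coe_mul_single]

theorem coeff_bernSeries_pow_mul_exp (j k : ℕ) :
    PowerSeries.coeff (j + 1) (bernSeries ^ (k + 1) * PowerSeries.exp ℚ_[2]) =
      PowerSeries.coeff (j + 1) (bernSeries ^ (k + 1)) +
        PowerSeries.coeff j (bernSeries ^ k) := by
  rw [exp_mul_bernSeries_pow, map_add, PowerSeries.coeff_succ_X_mul]

theorem coeff_bernSeries_zero : PowerSeries.coeff 0 bernSeries = 1 := by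
  have h := congrArg (PowerSeries.coeff 0) expQuot_mul_bernSeries
  simpa [PowerSeries.coeff_mul, expQuot] using h

theorem coeff_bernSeries_succ (n : ℕ) : PowerSeries.coeff (n + 1) bernSeries =
    -∑ k ∈ Finset.range (n + 1), ((k + 2)! : ℚ_[2])⁻¹ * PowerSeries.coeff (n - k) bernSeries := by
  have h := congrArg (PowerSeries.coeff (n + 1)) expQuot_mul_bernSeries
  rw [PowerSeries.coeff_mul, Finset.Nat.sum_antidiagonal_eq_sum_range_succ_mk,
    Finset.sum_range_succ', PowerSeries.coeff_one, if_neg n.succ_ne_zero] at h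
  simp only [expQuot, PowerSeries.coeff_mk] at h
  simp only [Nat.add_sub_add_right, zero_add, Nat.factorial_one, Nat.cast_one, inv_one, one_mul,
    Nat.sub_zero] at h
  exact eq_neg_of_add_eq_zero_right h

theorem coeff_bernSeries : PowerSeries.coeff 1 bernSeries = -1 / 2 ∧
    PowerSeries.coeff 2 bernSeries = 1 / 12 ∧ PowerSeries.coeff 3 bernSeries = 0 ∧
    PowerSeries.coeff 4 bernSeries = -1 / 720 ∧ PowerSeries.coeff 5 bernSeries = 0 ∧
    PowerSeries.coeff 6 bernSeries = 1 / 30240 := by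
  have h0 := coeff_bernSeries_zero
  have h1 : PowerSeries.coeff 1 bernSeries = -1 / 2 := by
    rw [coeff_bernSeries_succ]
    norm_num [Finset.sum_range_succ, h0, Nat.factorial]
  have h2 : PowerSeries.coeff 2 bernSeries = 1 / 12 := by
    rw [coeff_bernSeries_succ]
    norm_num [Finset.sum_range_succ, h0, h1, Nat.factorial]
  have h3 : PowerSeries.coeff 3 bernSeries = 0 := by
    rw [coeff_bernSeries_succ]
    norm_num [Finset.sum_range_succ, h0, h1, h2, Nat.factorial]
  have h4 : PowerSeries.coeff 4 bernSeries = -1 / 720 := by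
    rw [coeff_bernSeries_succ]
    norm_num [Finset.sum_range_succ, h0, h1, h2, h3, Nat.factorial]
  have h5 : PowerSeries.coeff 5 bernSeries = 0 := by
    rw [coeff_bernSeries_succ]
    norm_num [Finset.sum_range_succ, h0, h1, h2, h3, h4, Nat.factorial]
  have h6 : PowerSeries.coeff 6 bernSeries = 1 / 30240 := by
    rw [coeff_bernSeries_succ]
    norm_num [Finset.sum_range_succ, h0, h1, h2, h3, h4, h5, Nat.factorial]
  exact ⟨h1, h2, h3, h4, h5, h6⟩

theorem coeff_mul_explicit (f g : ℚ_[2]⟦X⟧) (n : ℕ) : PowerSeries.coeff n (f * g) =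
    ∑ k ∈ Finset.range (n + 1), PowerSeries.coeff k f * PowerSeries.coeff (n - k) g := by
  rw [PowerSeries.coeff_mul, Finset.Nat.sum_antidiagonal_eq_sum_range_succ_mk]

/-- Only the annihilators h(1), h(2), h(3) are needed, since the states below involve only h(-1),
h(-2), h(-3). -/
theorem sqCoeff_values :
    sqCoeff (-2) 1 = 0 ∧ sqCoeff (-2) 2 = -1 / 240 ∧ sqCoeff (-2) 3 = 1 / 240 ∧
    sqCoeff (-3) 1 = 1 / 240 ∧ sqCoeff (-3) 2 = -1 / 480 ∧ sqCoeff (-3) 3 = 1 / 945 := by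
  obtain ⟨h1, h2, h3, h4, h5, h6⟩ := coeff_bernSeries
  have h0 := coeff_bernSeries_zero
  have e2 : ∀ k : ℕ, sqCoeff (-2) k = PowerSeries.coeff (k + 1 + 1) (bernSeries ^ (k + 1)) +
      PowerSeries.coeff (k + 1) (bernSeries ^ k) := fun k => by
    have := sqCoeff_neg_natCast 1 k
    norm_num at this
    rw [this, ← coeff_bernSeries_pow_mul_exp]
    congr 2
    ring
  have e3 : ∀ k : ℕ, sqCoeff (-3) k = PowerSeries.coeff (k + 2 + 1) (bernSeries ^ (k + 1)) +
      PowerSeries.coeff (k + 2) (bernSeries ^ k) := fun k => by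
    have := sqCoeff_neg_natCast 2 k
    norm_num at this
    rw [this, ← coeff_bernSeries_pow_mul_exp]
    congr 2
    ring
  have s : ∀ n, PowerSeries.coeff n (bernSeries ^ 2) = ∑ k ∈ Finset.range (n + 1),
      PowerSeries.coeff k bernSeries * PowerSeries.coeff (n - k) bernSeries := fun n => by
    rw [sq, coeff_mul_explicit]
  have c : ∀ n, PowerSeries.coeff n (bernSeries ^ 3) = ∑ k ∈ Finset.range (n + 1),
      PowerSeries.coeff k (bernSeries ^ 2) * PowerSeries.coeff (n - k) bernSeries := fun n => by
    rw [pow_succ, coeff_mul_explicit]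
  have q : ∀ n, PowerSeries.coeff n (bernSeries ^ 4) = ∑ k ∈ Finset.range (n + 1),
      PowerSeries.coeff k (bernSeries ^ 2) * PowerSeries.coeff (n - k) (bernSeries ^ 2) :=
    fun n => by rw [← coeff_mul_explicit, ← pow_add]
  have s0 : PowerSeries.coeff 0 (bernSeries ^ 2) = 1 := by simp [s, h0]
  have s1 : PowerSeries.coeff 1 (bernSeries ^ 2) = -1 := by
    norm_num [s, Finset.sum_range_succ, h0, h1]
  have s2 : PowerSeries.coeff 2 (bernSeries ^ 2) = 5 / 12 := by
    norm_num [s, Finset.sum_range_succ, h0, h1, h2]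
  have s3 : PowerSeries.coeff 3 (bernSeries ^ 2) = -1 / 12 := by
    norm_num [s, Finset.sum_range_succ, h0, h1, h2, h3]
  have s4 : PowerSeries.coeff 4 (bernSeries ^ 2) = 1 / 240 := by
    norm_num [s, Finset.sum_range_succ, h0, h1, h2, h3, h4]
  have s5 : PowerSeries.coeff 5 (bernSeries ^ 2) = 1 / 720 := by
    norm_num [s, Finset.sum_range_succ, h0, h1, h2, h3, h4, h5]
  have s6 : PowerSeries.coeff 6 (bernSeries ^ 2) = -1 / 6048 := by
    norm_num [s, Finset.sum_range_succ, h0, h1, h2, h3, h4, h5, h6]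
  have c4 : PowerSeries.coeff 4 (bernSeries ^ 3) = 19 / 240 := by
    norm_num [c, Finset.sum_range_succ, h0, h1, h2, h3, h4, s0, s1, s2, s3, s4]
  have c5 : PowerSeries.coeff 5 (bernSeries ^ 3) = -1 / 160 := by
    norm_num [c, Finset.sum_range_succ, h0, h1, h2, h3, h4, h5, s0, s1, s2, s3, s4, s5]
  have q5 : PowerSeries.coeff 5 (bernSeries ^ 4) = -3 / 40 := by
    norm_num [q, Finset.sum_range_succ, s0, s1, s2, s3, s4, s5]
  have q6 : PowerSeries.coeff 6 (bernSeries ^ 4) = 221 / 30240 := by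
    norm_num [q, Finset.sum_range_succ, s0, s1, s2, s3, s4, s5, s6]
  have c3 : PowerSeries.coeff 3 (bernSeries ^ 3) = -3 / 8 := by
    norm_num [c, Finset.sum_range_succ, h0, h1, h2, h3, s0, s1, s2, s3]
  refine ⟨?_, ?_, ?_, ?_, ?_, ?_⟩
  · have := e2 1
    norm_num [s3, h2] at this
    simpa using this
  · have := e2 2
    norm_num [c4, s3] at this
    simpa [neg_div] using this
  · have := e2 3
    norm_num [q5, c4] at this
    simpa using this
  · have := e3 1
    norm_num [s4, h3] at this
    simpa using this
  · have := e3 2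
    norm_num [c5, s4] at this
    simpa [neg_div] using this
  · have := e3 3
    norm_num [q6, c5] at this
    simpa using this

end HeisenbergTwoAdic
end

noncomputable section
namespace HeisenbergTwoAdic
open scoped Nat NNReal PowerSeries

/-! ### The states `h[-2]^(2r) h[-3]^(2s) 1` -/

/-- States involving only the first three creation operators. -/
def LowDegree (u : Heis) : Prop := ∀ j, 3 ≤ j → MvPolynomial.pderiv j u = 0

/-- The annihilation part of `h[n]` on states involving the first three creation operators. -/
def sqDer (n : ℤ) : Derivation ℚ_[2] Heis Heis :=
  ∑ k ∈ Finset.range 3, (sqCoeff n (k + 1) * (k + 1)) • MvPolynomial.pderiv k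

theorem sqDer_apply (n : ℤ) (u : Heis) : sqDer n u =
    ∑ k ∈ Finset.range 3, (sqCoeff n (k + 1) * (k + 1)) • MvPolynomial.pderiv k u := by
  simp [sqDer, Finset.sum_range_succ]

theorem mvPolynomial_C_ofNat (n : ℕ) [n.AtLeastTwo] :
    (MvPolynomial.C (ofNat(n) : ℚ_[2]) : Heis) = ofNat(n) :=
  map_ofNat _ n

theorem sqDer_linState (n : ℤ) (x : ℕ → ℚ_[2]) : sqDer n (linState x) =
    MvPolynomial.C (∑ k ∈ Finset.range 3, x k * (sqCoeff n (k + 1) * (k + 1))) := by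
  simp [sqDer_apply, linState, Finset.sum_range_succ, MvPolynomial.pderiv_X,
    MvPolynomial.smul_eq_C_mul, Pi.single_apply, mul_comm,
    mvPolynomial_C_ofNat]

theorem lowDegree_one : LowDegree 1 := fun j _ => (MvPolynomial.pderiv j).map_one_eq_zero

theorem lowDegree_linState (x : ℕ → ℚ_[2]) : LowDegree (linState x) := fun j hj => by
  have h0 : (0 : ℕ) ≠ j := by omega
  have h1 : (1 : ℕ) ≠ j := by omega
  have h2 : (2 : ℕ) ≠ j := by omega
  simp [linState, Finset.sum_range_succ, MvPolynomial.pderiv_X_of_ne h0,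
    MvPolynomial.pderiv_X_of_ne h1, MvPolynomial.pderiv_X_of_ne h2]

theorem LowDegree.mul {u v : Heis} (hu : LowDegree u) (hv : LowDegree v) :
    LowDegree (u * v) := fun j hj => by
  rw [Derivation.leibniz, hu j hj, hv j hj, smul_zero, smul_zero, add_zero]

theorem LowDegree.linState_mul_add_sqDer {u : Heis} (hu : LowDegree u) (x : ℕ → ℚ_[2]) (n : ℤ) :
    LowDegree (linState x * u + sqDer n u) := fun j hj => by
  rw [map_add, (lowDegree_linState x).mul hu j hj, zero_add, sqDer_apply, map_sum]
  refine Finset.sum_eq_zero fun k _ => ?_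
  rw [Derivation.map_smul, pderiv_comm, hu j hj, map_zero, smul_zero]

/-- On such states h(k) with k > 3 vanishes and, by `hx`, no creation operator beyond h(-3) occurs.
The mode becomes a multiplication plus a derivation. -/
theorem hSq_eq {n : ℤ} {x : ℕ → ℚ_[2]}
    (hx : ∀ k : ℕ, sqCoeff n (-(k + 1)) = if k < 3 then x k else 0)
    {u : Heis} (hu : LowDegree u) : hSq n u = linState x * u + sqDer n u := by
  have h0 : hMode 0 u = 0 := by rw [hMode_zero, LinearMap.zero_apply]
  rw [hSq, finsum_eq_sum_of_support_subset (s := Finset.Icc (-((3 : ℕ) : ℤ)) (3 : ℕ))]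
  · rw [sum_Icc_neg 3 _ (by rw [h0, smul_zero])]
    have h1 : Finset.Icc 1 3 = ({1, 2, 3} : Finset ℕ) := rfl
    have a1 := hMode_natCast_succ 0 u
    have a2 := hMode_natCast_succ 1 u
    have a3 := hMode_natCast_succ 2 u
    have b1 := hMode_neg_natCast_succ 0 u
    have b2 := hMode_neg_natCast_succ 1 u
    have b3 := hMode_neg_natCast_succ 2 u
    have c1 := hx 0
    have c2 := hx 1
    have c3 := hx 2
    norm_num at a1 a2 a3 b1 b2 b3 c1 c2 c3
    simp [h1, linState, sqDer_apply, Finset.sum_range_succ, a1, a2, a3, b1, b2, b3, c1, c2, c3,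
      MvPolynomial.smul_eq_C_mul]
    norm_num [mvPolynomial_C_ofNat]
    ring
  · intro k hk
    by_contra hk'
    refine hk ?_
    rcases int_trichotomy_succ k with rfl | ⟨j, rfl⟩ | ⟨j, rfl⟩
    · simp [h0]
    · have : 3 ≤ j := by
        by_contra h
        refine hk' (Finset.mem_coe.2 (Finset.mem_Icc.2 ⟨?_, ?_⟩)) <;> push_cast <;> omega
      change sqCoeff n _ • hMode _ u = 0
      rw [hMode_natCast_succ, hu j this]
      simp
    · have : ¬ j < 3 := fun h => hk' (Finset.mem_coe.2 (Finset.mem_Icc.2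
        ⟨by push_cast; omega, by push_cast; omega⟩))
      change sqCoeff n _ • hMode _ u = 0
      rw [hx, if_neg this, zero_smul]

theorem iterate_hSq_eq {n : ℤ} {x : ℕ → ℚ_[2]}
    (hx : ∀ k : ℕ, sqCoeff n (-(k + 1)) = if k < 3 then x k else 0)
    {u : Heis} (hu : LowDegree u) (r : ℕ) :
    (hSq n)^[r] u = (fun u => linState x * u + sqDer n u)^[r] u ∧ LowDegree ((hSq n)^[r] u) := by
  induction r with
  | zero => exact ⟨rfl, hu⟩
  | succ r ih =>
    have h : (hSq n)^[r + 1] u = linState x * (hSq n)^[r] u + sqDer n ((hSq n)^[r] u) := by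
      rw [Function.iterate_succ_apply', hSq_eq hx ih.2]
    exact ⟨by rw [h, ih.1, Function.iterate_succ_apply'], h ▸ ih.2.linState_mul_add_sqDer x n⟩

theorem sqCoeff_neg_two_neg (k : ℕ) :
    sqCoeff (-2) (-(k + 1)) = if k < 3 then coeffA k else 0 := by
  have h := sqCoeff_neg_neg 1 k
  norm_num at h
  rw [show (-1 + -(k : ℤ)) = -(k + 1) by ring] at h
  rw [h, mul_pow, mul_assoc, PowerSeries.coeff_X_pow_mul']
  rcases k with _ | _ | k
  · simp [coeffA, PowerSeries.coeff_exp]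
  · simp [coeffA, expQuot, PowerSeries.coeff_mul]
  · rw [if_neg (by omega)]
    simp [coeffA]

theorem sqCoeff_neg_three_neg (k : ℕ) :
    sqCoeff (-3) (-(k + 1)) = if k < 3 then coeffB k else 0 := by
  have h := sqCoeff_neg_neg 2 k
  norm_num at h
  rw [show (-1 + -(k : ℤ)) = -(k + 1) by ring] at h
  rw [h, mul_pow, mul_assoc, PowerSeries.coeff_X_pow_mul']
  rcases k with _ | _ | _ | k
  · simp [coeffB, PowerSeries.coeff_exp]
  · norm_num [coeffB, expQuot, coeff_mul_explicit, Finset.sum_range_succ, PowerSeries.coeff_exp]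
  · norm_num [coeffB, expQuot, coeff_mul_explicit]
  · rw [if_neg (by omega), if_neg (by omega)]

/-- These contraction constants become the constant terms of the Eisenstein series: (-1/2)(-1/120) =
1/240 in `polyA`, and 2(-1/1008) = -1/504 in `polyB`. -/
theorem sqDer_neg_two_A : sqDer (-2) (linState coeffA) = MvPolynomial.C (-1 / 120) := by
  obtain ⟨h1, h2, h3, -⟩ := sqCoeff_values
  rw [sqDer_linState]
  norm_num [Finset.sum_range_succ, coeffA, h1, h2, h3]

theorem sqDer_neg_two_B : sqDer (-2) (linState coeffB) = 0 := by
  obtain ⟨h1, h2, h3, -⟩ := sqCoeff_values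
  rw [sqDer_linState]
  norm_num [Finset.sum_range_succ, coeffB, h1, h2, h3]

theorem sqDer_neg_three_B : sqDer (-3) (linState coeffB) = MvPolynomial.C (-1 / 1008) := by
  obtain ⟨-, -, -, h1, h2, h3⟩ := sqCoeff_values
  rw [sqDer_linState]
  norm_num [Finset.sum_range_succ, coeffB, h1, h2, h3]

/-- The linear map sending `X ^ l` to `x ^ (2l) / (2l-1)‼`. -/
def evenPower (x : Heis) : Polynomial ℚ_[2] →ₗ[ℚ_[2]] Heis :=
  (Polynomial.basisMonomials ℚ_[2]).constr ℚ_[2] fun l =>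
    (((2 * l - 1)‼ : ℕ) : ℚ_[2])⁻¹ • x ^ (2 * l)

theorem evenPower_X_pow (x : Heis) (l : ℕ) : evenPower x (Polynomial.X ^ l) =
    (((2 * l - 1)‼ : ℕ) : ℚ_[2])⁻¹ • x ^ (2 * l) := by
  have := (Polynomial.basisMonomials ℚ_[2]).constr_basis ℚ_[2]
    (fun l => (((2 * l - 1)‼ : ℕ) : ℚ_[2])⁻¹ • x ^ (2 * l)) l
  simp only [Polynomial.coe_basisMonomials, Polynomial.monomial_one_right_eq_X_pow] at this
  exact this

theorem evenPower_one (x : Heis) : evenPower x 1 = 1 := by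
  simpa using evenPower_X_pow x 0

theorem polynomial_linearMap_ext {M : Type*} [AddCommMonoid M] [Module ℚ_[2] M]
    {f g : Polynomial ℚ_[2] →ₗ[ℚ_[2]] M} (h : ∀ l : ℕ, f (Polynomial.X ^ l) = g (Polynomial.X ^ l)) :
    f = g :=
  (Polynomial.basisMonomials ℚ_[2]).ext fun l => by
    simp only [Polynomial.coe_basisMonomials, Polynomial.monomial_one_right_eq_X_pow, h]

theorem doubleFactorial_two_mul_succ (k : ℕ) :
    (2 * (k + 1) - 1)‼ = (2 * k + 1) * (2 * k - 1)‼ := by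
  rcases k with _ | k
  · rfl
  · rw [show 2 * (k + 1 + 1) - 1 = 2 * k + 1 + 2 by omega, Nat.doubleFactorial_add_two]
    rfl

theorem natCast_doubleFactorial_ne_zero (k : ℕ) : ((k‼ : ℕ) : ℚ_[2]) ≠ 0 :=
  Nat.cast_ne_zero.2 (Nat.doubleFactorial_pos k).ne'

/-- Multiplication by `x` plus a derivation. -/
def twisted (D : Derivation ℚ_[2] Heis Heis) (x : Heis) : Heis →ₗ[ℚ_[2]] Heis :=
  LinearMap.mulLeft ℚ_[2] x + D.toLinearMap

theorem twisted_apply (D : Derivation ℚ_[2] Heis Heis) (x u : Heis) :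
    twisted D x u = x * u + D u := rfl

theorem twisted_twisted_pow (D : Derivation ℚ_[2] Heis Heis) {x y : Heis} {c : ℚ_[2]}
    (hx : D x = MvPolynomial.C c) (hy : D y = 0) (l : ℕ) :
    twisted D x (twisted D x (x ^ (2 * l) * y)) =
      (x ^ (2 * (l + 1)) + MvPolynomial.C ((4 * l + 1) * c) * x ^ (2 * l) +
        MvPolynomial.C (2 * l * (2 * l - 1) * c ^ 2) * x ^ (2 * (l - 1))) * y := by
  simp only [twisted_apply]
  rcases l with _ | l
  · simp [hx, hy, Derivation.leibniz]
    ring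
  · have h1 : D (x ^ (2 * (l + 1))) = MvPolynomial.C ((2 * l + 2) * c) * x ^ (2 * l + 1) := by
      rw [Derivation.leibniz_pow, hx, show 2 * (l + 1) - 1 = 2 * l + 1 by omega]
      simp [mvPolynomial_C_ofNat]
      ring
    have h2 : D (x ^ (2 * l + 1)) = MvPolynomial.C ((2 * l + 1) * c) * x ^ (2 * l) := by
      rw [Derivation.leibniz_pow, hx, Nat.add_sub_cancel]
      simp [mvPolynomial_C_ofNat]
      ring
    have h3 : ∀ a : ℚ_[2], D (MvPolynomial.C a) = 0 := fun a => D.map_algebraMap a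
    simp only [Derivation.leibniz, h1, h2, h3, hx, hy, map_add, smul_eq_mul, mul_zero, zero_add,
      add_zero, Nat.add_sub_cancel]
    push_cast
    simp only [map_add, map_mul, map_sub, map_pow, map_one, mvPolynomial_C_ofNat, map_natCast]
    ring

/-- Dividing by (2l-1)‼ absorbs the quadratic coefficients in l, so that on the polynomial side two
applications of the operator amount to a first order differential operator. -/
theorem twisted_twisted_evenPower (D : Derivation ℚ_[2] Heis Heis) {x y : Heis} {c : ℚ_[2]}
    (hx : D x = MvPolynomial.C c) (hy : D y = 0) (p : Polynomial ℚ_[2]) :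
    twisted D x (twisted D x (evenPower x p * y)) =
      evenPower x (2 * (Polynomial.X + Polynomial.C c) ^ 2 * Polynomial.derivative p +
        (Polynomial.X + Polynomial.C c) * p) * y := by
  induction p using Polynomial.induction_on' with
  | add p q hp hq =>
    rw [map_add, add_mul, map_add, map_add, hp, hq, ← add_mul, ← map_add]
    congr 2
    rw [map_add]
    ring
  | monomial l a =>
    have h1 : 2 * (Polynomial.X + Polynomial.C c) ^ 2 *
          Polynomial.derivative (Polynomial.X ^ l) +
          (Polynomial.X + Polynomial.C c) * Polynomial.X ^ l =
        (2 * l + 1 : ℚ_[2]) • Polynomial.X ^ (l + 1) + ((4 * l + 1) * c) • Polynomial.X ^ l +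
          (2 * l * c ^ 2) • Polynomial.X ^ (l - 1) := by
      have h2 : (Polynomial.C (2 : ℚ_[2])) = 2 := map_ofNat _ 2
      have h4 : (Polynomial.C (4 : ℚ_[2])) = 4 := map_ofNat _ 4
      rcases l with _ | l
      · simp [Polynomial.smul_eq_C_mul]
      · simp [Polynomial.smul_eq_C_mul, h2, h4]
        ring
    have e1 : (2 * l + 1 : ℚ_[2]) * (((2 * (l + 1) - 1)‼ : ℕ) : ℚ_[2])⁻¹ =
        (((2 * l - 1)‼ : ℕ) : ℚ_[2])⁻¹ := by
      have h0 : (2 * l + 1 : ℚ_[2]) ≠ 0 := by exact_mod_cast (2 * l).succ_ne_zero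
      have hd := natCast_doubleFactorial_ne_zero (2 * l - 1)
      rw [doubleFactorial_two_mul_succ]
      push_cast
      field_simp
    have e2 : (2 * l * c ^ 2) * (((2 * (l - 1) - 1)‼ : ℕ) : ℚ_[2])⁻¹ =
        (((2 * l - 1)‼ : ℕ) : ℚ_[2])⁻¹ * (2 * l * (2 * l - 1) * c ^ 2) := by
      rcases l with _ | l
      · simp
      · have h0 : (2 * l + 1 : ℚ_[2]) ≠ 0 := by exact_mod_cast (2 * l).succ_ne_zero
        have hd := natCast_doubleFactorial_ne_zero (2 * l - 1)
        rw [doubleFactorial_two_mul_succ, Nat.add_sub_cancel]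
        push_cast
        field_simp
        ring
    rw [← Polynomial.C_mul_X_pow_eq_monomial, ← Polynomial.smul_eq_C_mul,
      Polynomial.derivative_smul, mul_smul_comm, mul_smul_comm, ← smul_add, h1]
    rw [map_smul, map_smul, smul_mul_assoc, smul_mul_assoc, map_smul, map_smul]
    congr 1
    simp only [map_smul, map_add, evenPower_X_pow, smul_mul_assoc, twisted_twisted_pow D hx hy,
      smul_smul]
    rw [e1, e2, ← mul_assoc]
    simp only [MvPolynomial.smul_eq_C_mul, map_mul]
    ring

/-- That differential operator sends (X + c)^r to (2r + 1)(X + c)^(r+1). The Hermite-type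
polynomials produced by iteration thus become pure powers, while y is carried along as a constant.
-/
theorem iterate_twisted (D : Derivation ℚ_[2] Heis Heis) {x y : Heis} {c : ℚ_[2]}
    (hx : D x = MvPolynomial.C c) (hy : D y = 0) (r : ℕ) :
    (fun u => x * u + D u)^[2 * r] y =
      (((2 * r - 1)‼ : ℕ) : ℚ_[2]) • (evenPower x ((Polynomial.X + Polynomial.C c) ^ r) * y) := by
  change (twisted D x)^[2 * r] y = _
  induction r with
  | zero => simp [evenPower_one]
  | succ r ih =>
    have h : 2 * (Polynomial.X + Polynomial.C c) ^ 2 *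
          Polynomial.derivative ((Polynomial.X + Polynomial.C c) ^ r) +
          (Polynomial.X + Polynomial.C c) * (Polynomial.X + Polynomial.C c) ^ r =
        ((2 * r + 1 : ℕ) : ℚ_[2]) • (Polynomial.X + Polynomial.C c) ^ (r + 1) := by
      have h2 : (Polynomial.C (2 : ℚ_[2])) = 2 := map_ofNat _ 2
      rcases r with _ | r
      · simp
      · simp [Polynomial.derivative_pow, Polynomial.smul_eq_C_mul, h2]
        ring
    rw [show 2 * (r + 1) = 2 * r + 1 + 1 by ring, Function.iterate_succ_apply',
      Function.iterate_succ_apply', ih, show 2 * r + 1 + 1 = 2 * (r + 1) by ring, map_smul,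
      map_smul, twisted_twisted_evenPower D hx hy, h, map_smul, smul_mul_assoc, smul_smul,
      doubleFactorial_two_mul_succ, Nat.cast_mul, mul_comm (((2 * r + 1 : ℕ) : ℚ_[2]))]

/-- The polynomial attached to `α₁`. -/
def polyA : Polynomial ℚ_[2] := Polynomial.C (1 / 240) - Polynomial.C (1 / 2) * Polynomial.X

/-- The polynomial attached to `β₁`. -/
def polyB : Polynomial ℚ_[2] := Polynomial.C 2 * Polynomial.X - Polynomial.C (1 / 504)

theorem iterate_hSq_neg_three (s : ℕ) : betaScalar s • (hSq (-3))^[2 * s] 1 =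
    evenPower stateB (polyB ^ s) := by
  have hd := natCast_doubleFactorial_ne_zero (2 * s - 1)
  rw [(iterate_hSq_eq sqCoeff_neg_three_neg lowDegree_one (2 * s)).1,
    iterate_twisted _ sqDer_neg_three_B (sqDer (-3)).map_one_eq_zero, mul_one, betaScalar,
    smul_smul, div_mul_cancel₀ _ hd, ← map_smul, Polynomial.smul_eq_C_mul, map_pow, ← mul_pow,
    stateB, polyB]
  congr 2
  rw [mul_add, ← map_mul, sub_eq_add_neg, ← map_neg]
  norm_num

theorem sqDer_evenPower {n : ℤ} {x : Heis} (hx : sqDer n x = 0) (p : Polynomial ℚ_[2]) :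
    sqDer n (evenPower x p) = 0 := by
  have : (sqDer n).toLinearMap ∘ₗ evenPower x = 0 := polynomial_linearMap_ext fun l => by
    simp [evenPower_X_pow, Derivation.leibniz_pow, hx]
  exact LinearMap.congr_fun this p

theorem alphaBeta_eq (r s : ℕ) : alphaBeta r s =
    evenPower stateA (polyA ^ r) * evenPower stateB (polyB ^ s) := by
  have hd := natCast_doubleFactorial_ne_zero (2 * r - 1)
  -- The annihilation part of h[-2] contracts to zero with `stateB`, so states built by h[-3] act as
  -- constants for h[-2].
  have hB : sqDer (-2) ((hSq (-3))^[2 * s] 1) = 0 := by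
    have hs : betaScalar s ≠ 0 :=
      div_ne_zero (pow_ne_zero _ two_ne_zero) (natCast_doubleFactorial_ne_zero _)
    have h := sqDer_evenPower sqDer_neg_two_B (polyB ^ s)
    rw [← stateB, ← iterate_hSq_neg_three, Derivation.map_smul] at h
    exact (smul_eq_zero.1 h).resolve_left hs
  rw [alphaBeta, (iterate_hSq_eq sqCoeff_neg_two_neg
      (iterate_hSq_eq sqCoeff_neg_three_neg lowDegree_one (2 * s)).2 (2 * r)).1,
    iterate_twisted _ sqDer_neg_two_A hB, ← iterate_hSq_neg_three, alphaScalar, smul_smul,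
    mul_right_comm, ← smul_smul, ← mul_smul_comm, ← smul_mul_assoc, ← map_smul]
  congr 2
  rw [div_mul_eq_mul_div, mul_div_mul_right _ _ hd, ← div_pow, Polynomial.smul_eq_C_mul, map_pow,
    ← mul_pow, polyA]
  congr 1
  rw [mul_add, ← map_mul, sub_eq_neg_add, ← neg_mul, ← map_neg]
  norm_num

theorem alpha_eq (r : ℕ) : alpha r = evenPower stateA (polyA ^ r) := by
  have h := alphaBeta_eq r 0
  rw [pow_zero, evenPower_one, mul_one] at h
  rw [← h, alphaBeta, alpha]
  simp [betaScalar]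

/-- The factor 1/(2l-1)‼ in `evenPower` cancels the number of pairings in Wick's theorem, so the
character becomes evaluation of polynomials. By bilinearity it suffices to treat powers of X. -/
theorem character_evenPower_mul (p q : Polynomial ℚ_[2]) :
    character (evenPower stateA p * evenPower stateB q) =
      Polynomial.aeval ((-2 : ℚ_[2]) • sigmaSeries 3) p *
        Polynomial.aeval ((1 / 2 : ℚ_[2]) • sigmaSeries 5) q := by
  let ch : Heis →ₗ[ℚ_[2]] ℚ_[2]⟦X⟧ :=
    { toFun := character, map_add' := character_add, map_smul' := character_smul }
  let f : Polynomial ℚ_[2] →ₗ[ℚ_[2]] Polynomial ℚ_[2] →ₗ[ℚ_[2]] ℚ_[2]⟦X⟧ :=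
    ((LinearMap.mul ℚ_[2] Heis).compl₁₂ (evenPower stateA) (evenPower stateB)).compr₂ ch
  let g : Polynomial ℚ_[2] →ₗ[ℚ_[2]] Polynomial ℚ_[2] →ₗ[ℚ_[2]] ℚ_[2]⟦X⟧ :=
    (LinearMap.mul ℚ_[2] ℚ_[2]⟦X⟧).compl₁₂
      (Polynomial.aeval ((-2 : ℚ_[2]) • sigmaSeries 3)).toLinearMap
      (Polynomial.aeval ((1 / 2 : ℚ_[2]) • sigmaSeries 5)).toLinearMap
  suffices f = g from LinearMap.congr_fun (LinearMap.congr_fun this p) q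
  refine polynomial_linearMap_ext fun k => polynomial_linearMap_ext fun l => ?_
  change character (evenPower stateA (Polynomial.X ^ k) * evenPower stateB (Polynomial.X ^ l)) =
      Polynomial.aeval ((-2 : ℚ_[2]) • sigmaSeries 3) (Polynomial.X ^ k) *
        Polynomial.aeval ((1 / 2 : ℚ_[2]) • sigmaSeries 5) (Polynomial.X ^ l)
  have hk := natCast_doubleFactorial_ne_zero (2 * k - 1)
  have hl := natCast_doubleFactorial_ne_zero (2 * l - 1)
  rw [evenPower_X_pow, evenPower_X_pow, smul_mul_smul_comm, character_smul,
    character_stateA_pow_mul_stateB_pow, map_pow, map_pow, Polynomial.aeval_X, Polynomial.aeval_X,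
    ← map_natCast (PowerSeries.C (R := ℚ_[2])), PowerSeries.smul_eq_C_mul, mul_assoc, ← mul_assoc,
    ← map_mul]
  push_cast
  rw [← mul_inv, inv_mul_cancel₀ (mul_ne_zero hk hl), map_one, one_mul]

/-- `polyA` at -2 Σ σ₃(n) qⁿ is 1/240 + Σ σ₃(n) qⁿ, and `polyB` at ½ Σ σ₅(n) qⁿ is -1/504 + Σ σ₅(n)
qⁿ. -/
theorem character_alphaBeta (r s : ℕ) : character (alphaBeta r s) =
    ((1 / 240 : ℚ_[2]) • eisenstein ℚ_[2] 240 3) ^ r *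
      ((-1 / 504 : ℚ_[2]) • eisenstein ℚ_[2] (-504) 5) ^ s := by
  rw [alphaBeta_eq, character_evenPower_mul, map_pow, map_pow]
  congr 2
  · ext n
    simp only [polyA, map_sub, map_mul, Polynomial.aeval_C, Polynomial.aeval_X, PowerSeries.coeff_smul,
      PowerSeries.algebraMap_apply, PowerSeries.coeff_C_mul, PowerSeries.coeff_C, eisenstein,
      PowerSeries.coeff_mk, sigmaSeries]
    rcases eq_or_ne n 0 with rfl | hn
    · simp
    · simp [hn]
  · ext n
    simp only [polyB, map_sub, map_mul, Polynomial.aeval_C, Polynomial.aeval_X, PowerSeries.coeff_smul,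
      PowerSeries.algebraMap_apply, PowerSeries.coeff_C_mul, PowerSeries.coeff_C, eisenstein,
      PowerSeries.coeff_mk, sigmaSeries]
    rcases eq_or_ne n 0 with rfl | hn
    · simp [neg_div]
    · simp [hn]
      ring_nf

end HeisenbergTwoAdic
end

noncomputable section
namespace HeisenbergTwoAdic
open scoped Nat NNReal PowerSeries

/-! ### The coefficients of the pre-images -/

/-- The coefficient of `(-t)^j` in the `x`-th power sum of the roots of `Y^3 - Y^2 + t`. -/
def waringCoeff (x : ℤ_[2]) : ℕ → ℤ_[2]
  | 0 => 1
  | j + 1 => Ring.choose (x - 2 * (j + 1)) (j + 1) + 2 * Ring.choose (x - 2 * j - 3) j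

theorem waringCoeff_natCast_succ (a j : ℕ) : waringCoeff ((a + 2 * j + 3 : ℕ)) (j + 1) =
    (((a + 1).choose (j + 1) + 2 * a.choose j : ℕ) : ℤ_[2]) := by
  have h1 : (((a + 2 * j + 3 : ℕ) : ℤ_[2]) - 2 * (j + 1)) = ((a + 1 : ℕ) : ℤ_[2]) := by
    push_cast
    ring
  have h2 : (((a + 2 * j + 3 : ℕ) : ℤ_[2]) - 2 * j - 3) = ((a : ℕ) : ℤ_[2]) := by
    push_cast
    ring
  rw [waringCoeff, h1, h2, Ring.choose_natCast, Ring.choose_natCast]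
  push_cast
  rfl

/-- `waringCoeff` writes Waring's fraction as an integral combination of binomial coefficients, so
it has values in ℤ₂ and is continuous in x. The bound j ≤ L keeps 3L - 2j positive. -/
theorem coe_waringCoeff_natCast {L j : ℕ} (hL : 0 < L) (hj : j ≤ L) :
    ((waringCoeff ((3 * L : ℕ)) j : ℤ_[2]) : ℚ_[2]) =
      ((3 * L - 2 * j).choose j : ℚ_[2]) * ((3 * L) / (3 * L - 2 * j)) := by
  rcases j with _ | j
  · have : (L : ℚ_[2]) ≠ 0 := Nat.cast_ne_zero.2 hL.ne'
    simp [waringCoeff, this]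
  · obtain ⟨a, ha⟩ : ∃ a, 3 * L = a + 2 * j + 3 := ⟨3 * L - 2 * j - 3, by omega⟩
    have h1 : ((a + 1 : ℕ) : ℚ_[2]) ≠ 0 := Nat.cast_ne_zero.2 a.succ_ne_zero
    have h2 : (3 * L : ℚ_[2]) = (a + 2 * j + 3 : ℕ) := by exact_mod_cast ha
    have h3 : ((a + 1 : ℕ) : ℚ_[2]) * a.choose j = (a + 1).choose (j + 1) * ((j + 1 : ℕ) : ℚ_[2]) := by
      exact_mod_cast Nat.add_one_mul_choose_eq a j
    have h4 : (((a + 2 * j + 3 : ℕ) : ℚ_[2]) - 2 * ((j + 1 : ℕ) : ℚ_[2])) = ((a + 1 : ℕ) : ℚ_[2]) := by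
      push_cast
      ring
    rw [h2, ha, waringCoeff_natCast_succ, h4, show a + 2 * j + 3 - 2 * (j + 1) = a + 1 by omega,
      mul_div_assoc', eq_div_iff h1, PadicInt.coe_natCast]
    push_cast at h3 ⊢
    linear_combination 2 * h3

/-- The summands of `cScaled`. -/
def cTerm (n m i j : ℕ) : ℚ_[2] :=
  15 ^ (3 * 2 ^ m) * (-1) ^ i * (n + j).choose i *
    (waringCoeff (3 * 2 ^ m - 3 * n) j : ℤ_[2]) * (-256) ^ j / 1728 ^ (n + j)

/-- The coefficients `c_{n,m,i}` divided by `240 ^ (3·2^m - 3i) * 504 ^ (2i)`. -/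
def cScaled (n m i : ℕ) : ℚ_[2] := ∑ j ∈ Finset.range (2 ^ m + 1 - n), cTerm n m i j

/-- The prime powers are regrouped by 240 = 2⁴·3·5, 504 = 2³·3²·7, 1728 = 2⁶·3³ and 256 = 2⁸. The
leftover 15^(3·2^m) tends to 1 in ℤ₂. -/
theorem Psi_eq {n m j : ℕ} (h : n < 2 ^ m) (hj : j ≤ 2 ^ m - n) (i : ℕ) :
    Psi n m i j = 240 ^ (3 * 2 ^ m - 3 * i : ℤ) * 504 ^ (2 * i) * cTerm n m i j := by
  have hw := coe_waringCoeff_natCast (Nat.sub_pos_of_lt h) hj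
  have e1 : ((3 * (2 ^ m - n) : ℕ) : ℤ_[2]) = 3 * 2 ^ m - 3 * n := by
    push_cast [h.le]
    ring
  have e2 : (((2 ^ m - n : ℕ) : ℚ_[2])) = 2 ^ m - n := by
    push_cast [h.le]
    ring
  have e3 : 3 * (2 ^ m - n) - 2 * j = 3 * 2 ^ m - 3 * n - 2 * j := by omega
  rw [e1, e2, e3, show (3 * ((2 : ℚ_[2]) ^ m - n)) = 3 * 2 ^ m - 3 * n by ring] at hw
  rw [Psi, cTerm, hw]
  generalize (3 * 2 ^ m - 3 * n : ℚ_[2]) / (3 * 2 ^ m - 3 * n - 2 * j) = w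
  have p2 : (2 : ℚ_[2]) ^ (12 * 2 ^ m - 6 * n - 6 * i + 2 * j : ℤ) * 2 ^ (6 * (n + j)) =
      (2 ^ 4) ^ (3 * 2 ^ m - 3 * i : ℤ) * (2 ^ 3) ^ (2 * i) * (2 ^ 8) ^ j := by
    simp only [← zpow_natCast, ← zpow_mul, ← zpow_add₀ (two_ne_zero (α := ℚ_[2]))]
    congr 1
    push_cast
    ring
  have p3 : (3 : ℚ_[2]) ^ (6 * 2 ^ m - 3 * n + i - 3 * j : ℤ) * 3 ^ (3 * (n + j)) =
      3 ^ (3 * 2 ^ m - 3 * i : ℤ) * (3 ^ 2) ^ (2 * i) * 3 ^ (3 * 2 ^ m) := by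
    simp only [← zpow_natCast, ← zpow_mul, ← zpow_add₀ (three_ne_zero (α := ℚ_[2]))]
    congr 1
    push_cast
    ring
  have p5 : (5 : ℚ_[2]) ^ (6 * 2 ^ m - 3 * i : ℤ) =
      5 ^ (3 * 2 ^ m - 3 * i : ℤ) * 5 ^ (3 * 2 ^ m) := by
    simp only [← zpow_natCast, ← zpow_add₀ (show (5 : ℚ_[2]) ≠ 0 by norm_num)]
    congr 1
    push_cast
    ring
  have h240 : (240 : ℚ_[2]) = 2 ^ 4 * 3 * 5 := by norm_num
  have h504 : (504 : ℚ_[2]) = 2 ^ 3 * 3 ^ 2 * 7 := by norm_num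
  have h1728 : (1728 : ℚ_[2]) ^ (n + j) = 2 ^ (6 * (n + j)) * 3 ^ (3 * (n + j)) := by
    rw [pow_mul, pow_mul, ← mul_pow]
    norm_num
  have h256 : (-256 : ℚ_[2]) ^ j = (-1) ^ j * (2 ^ 8) ^ j := by
    rw [← mul_pow]
    norm_num
  have h15 : (15 : ℚ_[2]) ^ (3 * 2 ^ m) = 3 ^ (3 * 2 ^ m) * 5 ^ (3 * 2 ^ m) := by
    rw [← mul_pow]
    norm_num
  rw [h240, h504, h1728, h256, h15, mul_zpow, mul_zpow, mul_pow, mul_pow, mul_div_assoc',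
    eq_div_iff (mul_ne_zero (pow_ne_zero _ two_ne_zero) (pow_ne_zero _ three_ne_zero)), p5, pow_add]
  linear_combination (((n + j).choose i : ℚ_[2]) *
    ((3 * 2 ^ m - 3 * n - 2 * j).choose j : ℚ_[2]) *
    w * (-1) ^ i * (-1) ^ j *
    5 ^ (3 * 2 ^ m - 3 * i : ℤ) * 5 ^ (3 * 2 ^ m) * 7 ^ (2 * i)) * (
      (3 : ℚ_[2]) ^ (6 * 2 ^ m - 3 * n + i - 3 * j : ℤ) * 3 ^ (3 * (n + j)) * p2 +
      (2 ^ 4) ^ (3 * 2 ^ m - 3 * i : ℤ) * (2 ^ 3) ^ (2 * i) * (2 ^ 8) ^ j * p3)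

theorem cCoeff_eq {n m : ℕ} (h : n < 2 ^ m) (i : ℕ) :
    cCoeff n m i = 240 ^ (3 * 2 ^ m - 3 * i : ℤ) * 504 ^ (2 * i) * cScaled n m i := by
  rw [cCoeff, cScaled, Finset.mul_sum]
  refine Finset.sum_congr rfl fun j hj => Psi_eq h ?_ i
  have := Finset.mem_range.1 hj
  omega

theorem cScaled_eq_zero {n m i : ℕ} (h : n ≤ 2 ^ m) (hi : 2 ^ m < i) : cScaled n m i = 0 :=
  Finset.sum_eq_zero fun j hj => by
    have := Finset.mem_range.1 hj
    rw [cTerm, Nat.choose_eq_zero_of_lt (by omega)]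
    simp

/-- The state `240^r 504^s α_r β_s`. -/
def unitState (r s : ℕ) : Heis :=
  evenPower stateA ((1 - 120 * Polynomial.X) ^ r) * evenPower stateB ((1008 * Polynomial.X - 1) ^ s)

theorem alphaBeta_eq_smul (r s : ℕ) :
    alphaBeta r s = ((240 : ℚ_[2]) ^ r * 504 ^ s)⁻¹ • unitState r s := by
  have hA : polyA = (240 : ℚ_[2])⁻¹ • (1 - 120 * Polynomial.X) := by
    have h : (120 : Polynomial ℚ_[2]) = Polynomial.C 120 := (map_ofNat _ 120).symm
    rw [polyA, Polynomial.smul_eq_C_mul, mul_sub, h, ← mul_assoc, ← map_mul, mul_one]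
    norm_num
  have hB : polyB = (504 : ℚ_[2])⁻¹ • (1008 * Polynomial.X - 1) := by
    have h : (1008 : Polynomial ℚ_[2]) = Polynomial.C 1008 := (map_ofNat _ 1008).symm
    rw [polyB, Polynomial.smul_eq_C_mul, mul_sub, h, ← mul_assoc, ← map_mul, mul_one]
    norm_num
  rw [alphaBeta_eq, hA, hB, smul_pow, smul_pow, map_smul, map_smul, smul_mul_smul_comm, unitState,
    mul_inv, inv_pow, inv_pow]

theorem cCoeff_smul_alphaBeta {n m : ℕ} (h : n < 2 ^ m) (i : ℕ) :
    cCoeff n m i • alphaBeta (3 * 2 ^ m - 3 * i) (2 * i) =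
      cScaled n m i • unitState (3 * 2 ^ m - 3 * i) (2 * i) := by
  rcases le_or_gt i (2 ^ m) with hi | hi
  · have e : (3 * 2 ^ m - 3 * i : ℤ) = ((3 * 2 ^ m - 3 * i : ℕ) : ℤ) := by
      push_cast [show 3 * i ≤ 3 * 2 ^ m by omega]
      ring
    rw [cCoeff_eq h, alphaBeta_eq_smul, smul_smul, e, zpow_natCast, mul_right_comm,
      mul_inv_cancel₀ (mul_ne_zero (pow_ne_zero _ (by norm_num)) (pow_ne_zero _ (by norm_num))), one_mul]
  -- Beyond 2^m the natural subtraction truncates while the integer exponent turns negative, but the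
  -- coefficient is zero.
  · rw [cCoeff_eq h, cScaled_eq_zero h.le hi, mul_zero, zero_smul, zero_smul]

theorem preimage_eq {n m : ℕ} (h : n < 2 ^ m) : preimage n m =
    ∑ i ∈ Finset.range (2 ^ m + 2), cScaled n m i • unitState (3 * 2 ^ m - 3 * i) (2 * i) :=
  Finset.sum_congr rfl fun i _ => cCoeff_smul_alphaBeta h i

end HeisenbergTwoAdic
end

noncomputable section
namespace HeisenbergTwoAdic
open scoped Nat NNReal PowerSeries

/-! ### Power sums of the roots of `Y^3 - Y^2 + t` -/

section PowerSums

variable {R : Type*} [CommRing R]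

/-- The sums `∑ⱼ (N - 2j choose j) (-t)^j`. -/
def chooseSum (t : R) (N : ℕ) : R :=
  ∑ j ∈ Finset.range (N + 1), ((N - 2 * j).choose j : R) * (-t) ^ j

theorem chooseSum_eq (t : R) {N K : ℕ} (h : N < 3 * K) :
    chooseSum t N = ∑ j ∈ Finset.range K, ((N - 2 * j).choose j : R) * (-t) ^ j := by
  have key : ∀ K', K ≤ K' → ∑ j ∈ Finset.range K, ((N - 2 * j).choose j : R) * (-t) ^ j =
      ∑ j ∈ Finset.range K', ((N - 2 * j).choose j : R) * (-t) ^ j := fun K' hK =>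
    Finset.sum_subset (Finset.range_subset_range.2 hK) fun j _ hj => by
      rw [Finset.mem_range, not_lt] at hj
      rw [Nat.choose_eq_zero_of_lt (by omega)]
      simp
  rw [key (max K (N + 1)) (le_max_left _ _), chooseSum]
  refine Finset.sum_subset (Finset.range_subset_range.2 (le_max_right _ _)) fun j _ hj => ?_
  rw [Finset.mem_range, not_lt] at hj
  rw [Nat.choose_eq_zero_of_lt (by omega)]
  simp

/-- Pascal's rule. The generating function of these sums is 1/(1 - x + t x³): they are the complete
homogeneous symmetric functions of the roots of Y³ - Y² + t. -/
theorem chooseSum_add_three (t : R) (N : ℕ) :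
    chooseSum t (N + 3) = chooseSum t (N + 2) - t * chooseSum t N := by
  rw [chooseSum_eq t (N := N + 3) (K := N + 2) (by omega),
    chooseSum_eq t (N := N + 2) (K := N + 2) (by omega), chooseSum, Finset.sum_range_succ',
    Finset.sum_range_succ' (fun j => ((N + 2 - 2 * j).choose j : R) * (-t) ^ j), Finset.mul_sum,
    add_sub_right_comm, ← Finset.sum_sub_distrib]
  congr 1
  refine Finset.sum_congr rfl fun j _ => ?_
  have h : (N + 3 - 2 * (j + 1)).choose (j + 1) =
      (N + 2 - 2 * (j + 1)).choose (j + 1) + (N - 2 * j).choose j := by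
    rcases le_or_gt (2 * j) N with hj | hj
    · rw [show N + 3 - 2 * (j + 1) = N - 2 * j + 1 by omega,
        show N + 2 - 2 * (j + 1) = N - 2 * j by omega, Nat.choose_succ_succ, add_comm]
    · rw [Nat.choose_eq_zero_of_lt (by omega), Nat.choose_eq_zero_of_lt (by omega),
        Nat.choose_eq_zero_of_lt (by omega)]
  rw [h]
  push_cast
  ring

/-- The power sums of the two roots of `Y^3 - Y^2 + t` other than `w`, where `t = w^2 - w^3`. -/
def cofactorSum (w : R) : ℕ → R
  | 0 => 2
  | 1 => 1 - w
  | N + 2 => (1 - w) * (cofactorSum w (N + 1) + w * cofactorSum w N)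

/-- For t = w² - w³ the cubic is (Y - w)(Y² - (1-w) Y - w(1-w)), so the left side is the power sum
of all three roots. Both sides satisfy the recurrence of the cubic and agree at three initial
values. -/
theorem pow_add_cofactorSum (w : R) : ∀ N : ℕ, w ^ (N + 3) + cofactorSum w (N + 3) =
    chooseSum (w ^ 2 - w ^ 3) (N + 3) - 2 * (w ^ 2 - w ^ 3) * chooseSum (w ^ 2 - w ^ 3) N
  | 0 => by
    rw [chooseSum_add_three]
    simp [chooseSum, cofactorSum, Finset.sum_range_succ]
    ring
  | 1 => by
    rw [chooseSum_add_three, chooseSum_add_three]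
    simp [chooseSum, cofactorSum, Finset.sum_range_succ]
    ring
  | 2 => by
    rw [chooseSum_add_three, chooseSum_add_three, chooseSum_add_three]
    simp [chooseSum, cofactorSum, Finset.sum_range_succ]
    ring
  | N + 3 => by
    have h1 := pow_add_cofactorSum w N
    have h2 := pow_add_cofactorSum w (N + 2)
    have e1 := chooseSum_add_three (w ^ 2 - w ^ 3) (N + 3)
    have e2 := chooseSum_add_three (w ^ 2 - w ^ 3) N
    have s1 : cofactorSum w (N + 3 + 3) =
      (1 - w) * (cofactorSum w (N + 2 + 3) + w * cofactorSum w (N + 1 + 3)) := rfl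
    have s2 : cofactorSum w (N + 2 + 3) =
      (1 - w) * (cofactorSum w (N + 1 + 3) + w * cofactorSum w (N + 3)) := rfl
    rw [show N + 3 + 2 = N + 2 + 3 by ring] at e1
    linear_combination h2 - (w ^ 2 - w ^ 3) * h1 - w * s2 + s1 - e1 + 2 * (w ^ 2 - w ^ 3) * e2

/-- Both coefficients of the recurrence contain 1 - w, so every two steps gain a factor x. -/
theorem pow_dvd_cofactorSum {w x : R} (h : x ∣ 1 - w) : ∀ N : ℕ, x ^ (N / 2) ∣ cofactorSum w N
  | 0 => by simp
  | 1 => by simp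
  | N + 2 => by
    rw [show (N + 2) / 2 = N / 2 + 1 by omega, pow_succ', cofactorSum]
    refine mul_dvd_mul h (dvd_add ?_ ((pow_dvd_cofactorSum h N).mul_left w))
    exact (pow_dvd_pow x (by omega)).trans (pow_dvd_cofactorSum h (N + 1))

end PowerSums

theorem sum_waringCoeff (t : ℚ_[2]⟦X⟧) {L : ℕ} (hL : 0 < L) :
    ∑ j ∈ Finset.range (L + 1), ((waringCoeff ((3 * L : ℕ)) j : ℤ_[2]) : ℚ_[2]) • (-t) ^ j =
      chooseSum t (3 * L) - 2 * t * chooseSum t (3 * L - 3) := by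
  obtain ⟨L, rfl⟩ := Nat.exists_eq_succ_of_ne_zero hL.ne'
  rw [Nat.succ_eq_add_one, chooseSum_eq t (N := 3 * (L + 1)) (K := L + 2) (by omega),
    chooseSum_eq t (N := 3 * (L + 1) - 3) (K := L + 1) (by omega), Finset.sum_range_succ',
    Finset.sum_range_succ' (fun j => ((3 * (L + 1) - 2 * j).choose j : ℚ_[2]⟦X⟧) * (-t) ^ j),
    Finset.mul_sum, add_sub_right_comm, ← Finset.sum_sub_distrib]
  congr 1
  · refine Finset.sum_congr rfl fun j hj => ?_
    have hj' := Finset.mem_range.1 hj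
    obtain ⟨a, ha⟩ : ∃ a, 3 * L = a + 2 * j := ⟨3 * L - 2 * j, by omega⟩
    rw [show 3 * (L + 1) = a + 2 * j + 3 by omega, waringCoeff_natCast_succ, PadicInt.coe_natCast,
      show a + 2 * j + 3 - 2 * (j + 1) = a + 1 by omega,
      show a + 2 * j + 3 - 3 - 2 * j = a by omega, PowerSeries.smul_eq_C_mul, map_natCast]
    push_cast
    ring
  · simp [waringCoeff]

/-! ### The Hauptmodul -/

theorem constantCoeff_eulerSeries (R : Type*) [CommRing R] :
    PowerSeries.constantCoeff (eulerSeries R) = 1 := by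
  rw [← PowerSeries.coeff_zero_eq_constantCoeff_apply]
  simp [eulerSeries]

theorem hauptmodul_mul_deltaSeries : hauptmodul * deltaSeries ℚ_[2] =
    PowerSeries.expand 2 two_ne_zero (deltaSeries ℚ_[2]) := by
  have h : (eulerSeries ℚ_[2])⁻¹ * eulerSeries ℚ_[2] = 1 :=
    PowerSeries.inv_mul_cancel _ (by rw [constantCoeff_eulerSeries]; exact one_ne_zero)
  rw [hauptmodul, deltaSeries, map_mul, map_pow, PowerSeries.expand_X, etaProd_eq]
  calc _ = PowerSeries.X ^ 2 * (PowerSeries.expand 2 two_ne_zero (eulerSeries ℚ_[2])) ^ 24 *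
        ((eulerSeries ℚ_[2])⁻¹ * eulerSeries ℚ_[2]) ^ 24 := by ring
    _ = _ := by rw [h, one_pow, mul_one]

theorem deltaSeries_ne_zero : deltaSeries ℚ_[2] ≠ 0 := by
  refine mul_ne_zero PowerSeries.X_ne_zero (pow_ne_zero _ fun h => ?_)
  have := constantCoeff_eulerSeries ℚ_[2]
  rw [h, map_zero] at this
  exact zero_ne_one this

theorem eisenstein_cube_mul_hauptmodul : eisenstein ℚ_[2] 240 3 ^ 3 * hauptmodul =
    deltaSeries ℚ_[2] * (1 + 256 * hauptmodul) ^ 3 := by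
  have h := level_two_relation ℚ_[2]
  rw [← hauptmodul_mul_deltaSeries] at h
  refine mul_left_cancel₀ (pow_ne_zero 2 deltaSeries_ne_zero) ?_
  linear_combination h

/-- The inverse of `1 + 256 λ`. -/
def hauptInv : ℚ_[2]⟦X⟧ := (1 + 256 * hauptmodul)⁻¹

theorem constantCoeff_hauptmodul : PowerSeries.constantCoeff hauptmodul = 0 := by
  simp [hauptmodul]

theorem hauptInv_mul : hauptInv * (1 + 256 * hauptmodul) = 1 :=
  PowerSeries.inv_mul_cancel _ (by simp [constantCoeff_hauptmodul])

theorem deltaSeries_eq : deltaSeries ℚ_[2] =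
    eisenstein ℚ_[2] 240 3 ^ 3 * hauptmodul * hauptInv ^ 3 := by
  have h := hauptInv_mul
  calc _ = deltaSeries ℚ_[2] * (hauptInv * (1 + 256 * hauptmodul)) ^ 3 := by rw [h]; ring
    _ = _ := by rw [eisenstein_cube_mul_hauptmodul]; ring

/-- Uses 256 λ w = 1 - w for w = `hauptInv`. It shows that 256 Δ/E₄³ is exactly the parameter t = w²
- w³ for which w is a root of Y³ - Y² + t. -/
theorem deltaSeries_mul_256 : 256 * deltaSeries ℚ_[2] =
    eisenstein ℚ_[2] 240 3 ^ 3 * (hauptInv ^ 2 - hauptInv ^ 3) := by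
  have h := hauptInv_mul
  rw [deltaSeries_eq]
  linear_combination eisenstein ℚ_[2] 240 3 ^ 3 * hauptInv ^ 2 * h

theorem X_dvd_one_sub_hauptInv : PowerSeries.X ∣ 1 - hauptInv := by
  have h := hauptInv_mul
  have h1 : 1 - hauptInv = PowerSeries.X * (256 * hauptInv *
      (PowerSeries.expand 2 two_ne_zero etaProd * etaProd⁻¹) ^ 24) := by
    rw [hauptmodul] at h
    linear_combination -h
  exact ⟨_, h1⟩

/-! ### The characters of the pre-images -/

/-- The character as a linear map. -/
def characterLin : Heis →ₗ[ℚ_[2]] ℚ_[2]⟦X⟧ where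
  toFun := character
  map_add' := character_add
  map_smul' := character_smul

theorem character_unitState (r s : ℕ) : character (unitState r (2 * s)) =
    eisenstein ℚ_[2] 240 3 ^ r * (eisenstein ℚ_[2] (-504) 5 ^ 2) ^ s := by
  have h0 : (240 : ℚ_[2]) ^ r * 504 ^ (2 * s) ≠ 0 :=
    mul_ne_zero (pow_ne_zero _ (by norm_num)) (pow_ne_zero _ (by norm_num))
  have h : unitState r (2 * s) = ((240 : ℚ_[2]) ^ r * 504 ^ (2 * s)) • alphaBeta r (2 * s) := by
    rw [alphaBeta_eq_smul, smul_smul, mul_inv_cancel₀ h0, one_smul]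
  rw [h, character_smul, character_alphaBeta, smul_pow, smul_pow, smul_mul_smul_comm, smul_smul,
    ← pow_mul, mul_mul_mul_comm, ← mul_pow, ← mul_pow]
  norm_num

/-- Binomial theorem for (E₄³ - E₆²)^k; the terms with i > k are zero and pad the range. -/
theorem sum_choose_eisenstein {k M : ℕ} (h : k ≤ M) :
    ∑ i ∈ Finset.range (M + 2), ((-1) ^ i * k.choose i : ℚ_[2]) •
      (eisenstein ℚ_[2] 240 3 ^ (3 * M - 3 * i) * (eisenstein ℚ_[2] (-504) 5 ^ 2) ^ i) =
      eisenstein ℚ_[2] 240 3 ^ (3 * (M - k)) * (1728 * deltaSeries ℚ_[2]) ^ k := by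
  rw [← eisenstein_cube_sub_sq, sub_eq_neg_add, add_pow, Finset.mul_sum]
  symm
  refine (Finset.sum_subset (Finset.range_subset_range.2 (show k + 1 ≤ M + 2 by omega))
    fun i _ hi => ?_).trans (Finset.sum_congr rfl fun i _ => ?_)
  · rw [Finset.mem_range, not_lt] at hi
    rw [Nat.choose_eq_zero_of_lt (by omega)]
    simp
  · rcases le_or_gt i k with hi | hi
    · rw [show 3 * M - 3 * i = 3 * (M - k) + 3 * (k - i) by omega, pow_add,
        PowerSeries.smul_eq_C_mul, map_mul, map_pow, map_neg, map_one, map_natCast,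
        neg_pow (eisenstein ℚ_[2] (-504) 5 ^ 2), pow_mul _ 3 (k - i)]
      ring
    · rw [Nat.choose_eq_zero_of_lt hi]
      simp

/-- Summing over i first collapses the double sum, and the resulting 1728^(n+j) cancels the
denominator of `cTerm`. -/
theorem character_preimage {n m : ℕ} (h : n < 2 ^ m) : character (preimage n m) =
    (15 ^ (3 * 2 ^ m) : ℚ_[2]) • (deltaSeries ℚ_[2] ^ n *
      ∑ j ∈ Finset.range (2 ^ m - n + 1),
        ((waringCoeff ((3 * (2 ^ m - n) : ℕ)) j : ℤ_[2]) : ℚ_[2]) •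
          (eisenstein ℚ_[2] 240 3 ^ (3 * (2 ^ m - n - j)) * (-(256 * deltaSeries ℚ_[2])) ^ j)) := by
  have h1 : character (preimage n m) = ∑ i ∈ Finset.range (2 ^ m + 2),
      cScaled n m i • (eisenstein ℚ_[2] 240 3 ^ (3 * 2 ^ m - 3 * i) *
        (eisenstein ℚ_[2] (-504) 5 ^ 2) ^ i) := by
    change characterLin _ = _
    rw [preimage_eq h, map_sum]
    refine Finset.sum_congr rfl fun i _ => ?_
    rw [map_smul, ← character_unitState]
    rfl
  have e1 : ((3 * (2 ^ m - n) : ℕ) : ℤ_[2]) = 3 * 2 ^ m - 3 * n := by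
    push_cast [h.le]
    ring
  rw [h1]
  simp only [cScaled, Finset.sum_smul]
  rw [Finset.sum_comm, show 2 ^ m - n + 1 = 2 ^ m + 1 - n by omega, Finset.mul_sum,
    Finset.smul_sum]
  refine Finset.sum_congr rfl fun j hj => ?_
  have hj' := Finset.mem_range.1 hj
  have e2 : ∀ i, cTerm n m i j = (15 ^ (3 * 2 ^ m) * (waringCoeff (3 * 2 ^ m - 3 * n) j : ℤ_[2]) *
      (-256) ^ j / 1728 ^ (n + j)) * ((-1) ^ i * (n + j).choose i) := fun i => by
    rw [cTerm]
    ring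
  simp only [e2, mul_smul, ← Finset.smul_sum]
  simp only [← mul_smul]
  have h1728 : (1728 * deltaSeries ℚ_[2]) = (1728 : ℚ_[2]) • deltaSeries ℚ_[2] := by
    rw [PowerSeries.smul_eq_C_mul, map_ofNat]
  have h256 : -(256 * deltaSeries ℚ_[2]) = (-256 : ℚ_[2]) • deltaSeries ℚ_[2] := by
    rw [PowerSeries.smul_eq_C_mul, map_neg, map_ofNat, neg_mul]
  rw [sum_choose_eisenstein (by omega), e1, show 2 ^ m - n - j = 2 ^ m - (n + j) by omega, h1728,
    h256, smul_pow, smul_pow, mul_smul_comm, mul_smul_comm, mul_smul_comm, mul_smul_comm,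
    smul_smul, smul_smul, smul_smul, div_mul_cancel₀ _ (pow_ne_zero _ (by norm_num)), pow_add]
  congr 1
  ring

theorem character_preimage_eq {n m : ℕ} (h : n < 2 ^ m) : ∃ g : ℚ_[2]⟦X⟧,
    character (preimage n m) =
      hauptmodul ^ n * ((15 * eisenstein ℚ_[2] 240 3 * hauptInv) ^ 3) ^ (2 ^ m) +
        PowerSeries.X ^ (3 * (2 ^ m - n) / 2) * g := by
  obtain ⟨g, hg⟩ := pow_dvd_cofactorSum X_dvd_one_sub_hauptInv (3 * (2 ^ m - n))
  refine ⟨(15 ^ (3 * 2 ^ m) : ℚ_[2]) • (deltaSeries ℚ_[2] ^ n *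
    eisenstein ℚ_[2] 240 3 ^ (3 * (2 ^ m - n)) * g), ?_⟩
  have h1 : ∑ j ∈ Finset.range (2 ^ m - n + 1),
      ((waringCoeff ((3 * (2 ^ m - n) : ℕ)) j : ℤ_[2]) : ℚ_[2]) •
        (eisenstein ℚ_[2] 240 3 ^ (3 * (2 ^ m - n - j)) * (-(256 * deltaSeries ℚ_[2])) ^ j) =
      eisenstein ℚ_[2] 240 3 ^ (3 * (2 ^ m - n)) *
        (hauptInv ^ (3 * (2 ^ m - n)) + PowerSeries.X ^ (3 * (2 ^ m - n) / 2) * g) := by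
    have h2 := pow_add_cofactorSum hauptInv (3 * (2 ^ m - n) - 3)
    rw [show 3 * (2 ^ m - n) - 3 + 3 = 3 * (2 ^ m - n) by omega,
      ← sum_waringCoeff _ (Nat.sub_pos_of_lt h), hg] at h2
    rw [h2, Finset.mul_sum]
    refine Finset.sum_congr rfl fun j hj => ?_
    have hj' := Finset.mem_range.1 hj
    rw [deltaSeries_mul_256, mul_smul_comm]
    congr 1
    rw [show 3 * (2 ^ m - n) = 3 * (2 ^ m - n - j) + 3 * j by omega, pow_add _ _ (3 * j),
      ← mul_neg, mul_pow, ← pow_mul]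
    ring
  have h3 : (15 * eisenstein ℚ_[2] 240 3 * hauptInv) ^ 3 =
      (15 ^ 3 : ℚ_[2]) • (eisenstein ℚ_[2] 240 3 * hauptInv) ^ 3 := by
    rw [PowerSeries.smul_eq_C_mul, map_pow, map_ofNat]
    ring
  rw [character_preimage h, h1, h3, smul_pow, ← pow_mul 15, mul_smul_comm, mul_smul_comm, ← smul_add]
  congr 1
  -- With Δ = E₄³ λ w³, the exponents n and 2^m - n of E₄³ w³ add up to 2^m.
  have key : ∀ e l w y : ℚ_[2]⟦X⟧, (e ^ 3 * l * w ^ 3) ^ n *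
      (e ^ (3 * (2 ^ m - n)) * (w ^ (3 * (2 ^ m - n)) + y)) =
      l ^ n * ((e * w) ^ 3) ^ 2 ^ m +
        (e ^ 3 * l * w ^ 3) ^ n * e ^ (3 * (2 ^ m - n)) * y := fun e l w y => by
    have h4 : 2 ^ m = n + (2 ^ m - n) := by omega
    generalize 2 ^ m - n = k at h4 ⊢
    rw [h4]
    ring
  rw [deltaSeries_eq, key]
  generalize eisenstein ℚ_[2] 240 3 = e
  generalize hauptInv = w
  generalize hauptmodul = l
  ring

/-! ### The limit of the characters -/

/-- The power series with integral coefficients. -/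
def integralSeries : Subring ℚ_[2]⟦X⟧ := (PowerSeries.map (Int.castRingHom ℚ_[2])).range

theorem norm_coeff_le_one_of_mem {f : ℚ_[2]⟦X⟧} (hf : f ∈ integralSeries) (N : ℕ) :
    ‖PowerSeries.coeff N f‖ ≤ 1 := by
  obtain ⟨g, rfl⟩ := hf
  rw [PowerSeries.coeff_map]
  exact Padic.norm_int_le_one _

theorem inv_mem_integralSeries {f : ℚ_[2]⟦X⟧} (hf : f ∈ integralSeries)
    (h : PowerSeries.constantCoeff f = 1) : f⁻¹ ∈ integralSeries := by
  obtain ⟨g, rfl⟩ := hf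
  have hg : PowerSeries.constantCoeff g = ((1 : ℤˣ) : ℤ) := by
    have h' : ((PowerSeries.constantCoeff g : ℤ) : ℚ_[2]) = 1 := by
      rw [← PowerSeries.coeff_zero_eq_constantCoeff_apply, PowerSeries.coeff_map] at h
      simpa using h
    exact_mod_cast h'
  refine ⟨PowerSeries.invOfUnit g 1, ?_⟩
  rw [PowerSeries.eq_inv_iff_mul_eq_one (by rw [h]; exact one_ne_zero), ← map_mul,
    PowerSeries.invOfUnit_mul _ _ hg, map_one]

theorem hauptmodul_mem_integralSeries : hauptmodul ∈ integralSeries := by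
  refine mul_mem ⟨PowerSeries.X, PowerSeries.map_X _⟩ (pow_mem (mul_mem ?_ ?_) _)
  · exact ⟨PowerSeries.expand 2 two_ne_zero (eulerSeries ℤ), by
      rw [map_expand_two, map_eulerSeries, etaProd_eq]⟩
  · rw [etaProd_eq]
    exact inv_mem_integralSeries ⟨_, map_eulerSeries _⟩ (constantCoeff_eulerSeries _)

theorem hauptInv_mem_integralSeries : hauptInv ∈ integralSeries :=
  inv_mem_integralSeries (add_mem (one_mem _)
    (mul_mem (ofNat_mem _ 256) hauptmodul_mem_integralSeries))
    (by simp [constantCoeff_hauptmodul])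

/-- In a commutative ring, the `2^m`-th power of an element `≡ 1 mod 2` is `≡ 1 mod 2^(m+1)`. -/
theorem exists_one_add_two_mul_pow {R : Type*} [CommRing R] (v : R) (m : ℕ) :
    ∃ w : R, (1 + 2 * v) ^ 2 ^ m = 1 + 2 ^ (m + 1) * w := by
  induction m with
  | zero => exact ⟨v, by ring⟩
  | succ m ih =>
    obtain ⟨w, hw⟩ := ih
    exact ⟨w + 2 ^ m * w ^ 2, by rw [pow_succ 2 m, pow_mul, hw]; ring⟩

/-- Each of the three factors is 1 modulo 2: 15 is odd, E₄ - 1 is divisible by 240, and w = 1 - 256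
λ w. -/
theorem exists_cube_eq : ∃ v : integralSeries,
    (15 * eisenstein ℚ_[2] 240 3 * hauptInv) ^ 3 = ((1 + 2 * v : integralSeries) : ℚ_[2]⟦X⟧) := by
  have h1 : ∃ f : integralSeries, eisenstein ℚ_[2] 240 3 = ((1 + 2 * f : integralSeries) : ℚ_[2]⟦X⟧) := by
    refine ⟨⟨PowerSeries.mk fun n => 120 * (ArithmeticFunction.sigma 3 n : ℕ),
      PowerSeries.mk fun n => 120 * (ArithmeticFunction.sigma 3 n : ℕ), by ext n; simp⟩, ?_⟩
    ext n
    have h2 : (2 : ℚ_[2]⟦X⟧) = PowerSeries.C 2 := (map_ofNat _ 2).symm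
    change _ = PowerSeries.coeff n (1 + 2 * PowerSeries.mk fun n =>
      120 * ((ArithmeticFunction.sigma 3 n : ℕ) : ℚ_[2]))
    rw [h2, map_add, PowerSeries.coeff_C_mul, PowerSeries.coeff_one]
    rcases eq_or_ne n 0 with rfl | hn
    · simp [eisenstein]
    · simp [eisenstein, hn]
      ring
  obtain ⟨f, hf⟩ := h1
  let w : integralSeries := ⟨hauptInv, hauptInv_mem_integralSeries⟩
  let l : integralSeries := ⟨hauptmodul, hauptmodul_mem_integralSeries⟩
  have hw : w = 1 + 2 * (-128 * w * l) := by
    refine Subtype.ext ?_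
    have := hauptInv_mul
    change hauptInv = 1 + 2 * (-128 * hauptInv * hauptmodul)
    linear_combination this
  have key : ∃ v : integralSeries, (15 * (1 + 2 * f) * w) ^ 3 = 1 + 2 * v := by
    rw [hw]
    generalize -128 * w * l = y
    -- For x = 15 (1 + 2f)(1 + 2y), the witness is half of x³ - 1 = (x - 1)(x² + x + 1), with the
    -- first factor halved.
    exact ⟨(7 + f * 15 + y * 15 + f * y * 30) * ((15 * (1 + 2 * f) * (1 + 2 * y)) ^ 2 +
      (15 * (1 + 2 * f) * (1 + 2 * y)) + 1), by ring⟩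
  obtain ⟨v, hv⟩ := key
  refine ⟨v, ?_⟩
  rw [← hv, hf]
  rfl

/-- Once 2^m > n + N, the error exponent 3(2^m - n)/2 exceeds N, and the remaining difference is
2^(m+1) times an integral series. -/
theorem tendsto_coeff_character_preimage (n N : ℕ) :
    Filter.Tendsto (fun m => PowerSeries.coeff N (character (preimage n m))) Filter.atTop
      (nhds (PowerSeries.coeff N (hauptmodul ^ n))) := by
  obtain ⟨v, hv⟩ := exists_cube_eq
  have hpow : Filter.Tendsto (fun m : ℕ => ‖(2 : ℚ_[2])‖ ^ (m + 1)) Filter.atTop (nhds 0) :=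
    (tendsto_pow_atTop_nhds_zero_of_lt_one (norm_nonneg _) Padic.norm_p_lt_one).comp
      (Filter.tendsto_add_atTop_nat 1)
  refine tendsto_iff_norm_sub_tendsto_zero.2 (squeeze_zero' (Filter.Eventually.of_forall
    fun m => norm_nonneg _) ?_ hpow)
  have hlarge : ∀ᶠ m : ℕ in Filter.atTop, n + N < 2 ^ m :=
    (Filter.eventually_ge_atTop (n + N)).mono fun m hm => lt_of_le_of_lt hm Nat.lt_two_pow_self
  filter_upwards [hlarge] with m hm
  obtain ⟨g, hg⟩ := character_preimage_eq (show n < 2 ^ m by omega)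
  obtain ⟨w, hw⟩ := exists_one_add_two_mul_pow v m
  have hw' : ((15 * eisenstein ℚ_[2] 240 3 * hauptInv) ^ 3) ^ (2 ^ m) =
      1 + PowerSeries.C ((2 : ℚ_[2]) ^ (m + 1)) * (w : ℚ_[2]⟦X⟧) := by
    rw [hv, map_pow, map_ofNat]
    exact congrArg Subtype.val hw
  rw [hg, hw', map_add, PowerSeries.coeff_X_pow_mul', if_neg (by omega), add_zero, mul_add, mul_one,
    map_add, add_sub_cancel_left, mul_left_comm, PowerSeries.coeff_C_mul, norm_mul, norm_pow]
  exact mul_le_of_le_one_right (by positivity) (norm_coeff_le_one_of_mem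
    (mul_mem (pow_mem hauptmodul_mem_integralSeries n) w.2) N)

end HeisenbergTwoAdic
end

noncomputable section
namespace HeisenbergTwoAdic
open scoped Nat NNReal PowerSeries

/-! ### Ultrametric limits of finite sums -/

section Ultrametric

variable {E : Type*} [SeminormedAddCommGroup E]

theorem norm_sub_le_max [IsUltrametricDist E] (x y : E) : ‖x - y‖ ≤ max ‖x‖ ‖y‖ := by
  have h := IsUltrametricDist.norm_add_le_max x (-y)
  rwa [← sub_eq_add_neg, norm_neg] at h

/-- The geometric bound, uniform in m, settles all large i at once and leaves finitely many limits.
-/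
theorem eventually_forall_norm_le {u : ℕ → ℕ → E} {C : ℝ}
    (hb : ∀ m i, ‖u m i‖ ≤ C * (1 / 4) ^ i)
    (hu : ∀ i, Filter.Tendsto (fun m => u m i) Filter.atTop (nhds 0)) {ε : ℝ} (hε : 0 < ε) :
    ∀ᶠ m in Filter.atTop, ∀ i, ‖u m i‖ ≤ ε := by
  have h1 : Filter.Tendsto (fun i : ℕ => C * (1 / 4 : ℝ) ^ i) Filter.atTop (nhds 0) := by
    simpa using (tendsto_pow_atTop_nhds_zero_of_lt_one (by norm_num : (0 : ℝ) ≤ 1 / 4)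
      (by norm_num)).const_mul C
  obtain ⟨i₀, hi₀⟩ := Filter.eventually_atTop.1 (h1.eventually (ge_mem_nhds hε))
  have h2 : ∀ i ∈ Finset.range i₀, ∀ᶠ m in Filter.atTop, ‖u m i‖ ≤ ε := fun i _ => by
    have := (hu i).norm
    rw [norm_zero] at this
    exact this.eventually (ge_mem_nhds hε)
  filter_upwards [(Filter.eventually_all_finset _).2 h2] with m hm i
  rcases lt_or_ge i i₀ with hi | hi
  · exact hm i (Finset.mem_range.2 hi)
  · exact (hb m i).trans (hi₀ i hi)

/-- An ultrametric sum is bounded by its largest term, so uniform smallness of the terms suffices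
although their number grows with m. -/
theorem tendsto_sum_sub [IsUltrametricDist E] {u : ℕ → ℕ → E} {C : ℝ} {K : ℕ → ℕ}
    (hb : ∀ m i, ‖u m i‖ ≤ C * (1 / 4) ^ i)
    (hu : ∀ i, Filter.Tendsto (fun m => u (m + 1) i - u m i) Filter.atTop (nhds 0))
    (hK : Monotone K) (h0 : ∀ᶠ m in Filter.atTop, ∀ i, K m ≤ i → u m i = 0) :
    Filter.Tendsto (fun m => ∑ i ∈ Finset.range (K (m + 1)), u (m + 1) i -
      ∑ i ∈ Finset.range (K m), u m i) Filter.atTop (nhds 0) := by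
  rw [tendsto_zero_iff_norm_tendsto_zero, Metric.tendsto_atTop']
  intro ε hε
  have hb' : ∀ m i, ‖u (m + 1) i - u m i‖ ≤ C * (1 / 4) ^ i := fun m i =>
    (norm_sub_le_max _ _).trans (max_le (hb _ _) (hb _ _))
  have h := (eventually_forall_norm_le hb' hu (half_pos hε)).and h0
  obtain ⟨m₀, hm₀⟩ := Filter.eventually_atTop.1 h
  refine ⟨m₀, fun m hm => ?_⟩
  obtain ⟨h1, h2⟩ := hm₀ m hm.le
  have h3 : ∑ i ∈ Finset.range (K m), u m i = ∑ i ∈ Finset.range (K (m + 1)), u m i :=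
    Finset.sum_subset (Finset.range_subset_range.2 (hK m.le_succ)) fun i _ hi =>
      h2 i (by simpa using hi)
  rw [dist_zero_right, norm_norm, h3, ← Finset.sum_sub_distrib]
  exact (IsUltrametricDist.norm_sum_le_of_forall_le_of_nonneg (half_pos hε).le
    fun i _ => h1 i).trans_lt (half_lt_self hε)

end Ultrametric

/-! ### Estimates for the coefficients -/

theorem norm_two_padic : ‖(2 : ℚ_[2])‖ = 1 / 2 := by
  have := Padic.norm_p (p := 2)
  norm_num at this ⊢
  exact this

theorem norm_odd_natCast {k : ℕ} (hk : Odd k) : ‖(k : ℚ_[2])‖ = 1 :=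
  Padic.norm_natCast_eq_one_iff.2 (Nat.coprime_two_left.2 hk)

theorem norm_two_pow_mul_odd (a : ℕ) {k : ℕ} (hk : Odd k) :
    ‖(2 ^ a * k : ℚ_[2])‖ = (1 / 2) ^ a := by
  rw [norm_mul, norm_pow, norm_two_padic, norm_odd_natCast hk, mul_one]

theorem norm_neg_256 : ‖(-256 : ℚ_[2])‖ = (1 / 2) ^ 8 := by
  rw [norm_neg, ← norm_two_pow_mul_odd 8 odd_one]
  norm_num

theorem norm_1728 : ‖(1728 : ℚ_[2])‖ = (1 / 2) ^ 6 := by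
  rw [← norm_two_pow_mul_odd 6 (show Odd 27 by decide)]
  norm_num

theorem norm_240 : ‖(240 : ℚ_[2])‖ = (1 / 2) ^ 4 := by
  rw [← norm_two_pow_mul_odd 4 (show Odd 15 by decide)]
  norm_num

theorem norm_504 : ‖(504 : ℚ_[2])‖ = (1 / 2) ^ 3 := by
  rw [← norm_two_pow_mul_odd 3 (show Odd 63 by decide)]
  norm_num

/-- The factor 256^j / 1728^(n+j) has norm 2^(6n-2j); all other factors are 2-adic integers. -/
theorem norm_cTerm_le (n m i j : ℕ) : ‖cTerm n m i j‖ ≤ 64 ^ n * (1 / 4) ^ j := by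
  have h15 : ‖(15 : ℚ_[2])‖ = 1 := by simpa using norm_odd_natCast (show Odd 15 by decide)
  have h1 : ‖((n + j).choose i : ℚ_[2])‖ ≤ 1 := by
    simpa using Padic.norm_int_le_one (p := 2) ((n + j).choose i)
  have h2 := PadicInt.norm_le_one (waringCoeff (3 * 2 ^ m - 3 * n) j)
  rw [PadicInt.norm_def] at h2
  rw [cTerm, norm_div, norm_mul, norm_mul, norm_mul, norm_mul, norm_pow, norm_pow, norm_pow,
    norm_pow, norm_neg 1, norm_one, one_pow, mul_one, h15, one_pow, one_mul, norm_neg_256,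
    norm_1728]
  calc _ ≤ 1 * 1 * ((1 / 2 : ℝ) ^ 8) ^ j / ((1 / 2) ^ 6) ^ (n + j) := by gcongr
    _ = 64 ^ n * (1 / 4) ^ j := by
      rw [pow_add, one_mul, one_mul, div_eq_iff (by positivity)]
      calc ((1 / 2 : ℝ) ^ 8) ^ j = (64 * (1 / 2) ^ 6) ^ n * (1 / 4 * (1 / 2) ^ 6) ^ j := by norm_num
        _ = _ := by rw [mul_pow, mul_pow]; ring

/-- The binomial coefficient vanishes unless i ≤ n + j, which converts decay in j into decay in i at
the cost of 4ⁿ. -/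
theorem norm_cTerm_le' (n m i j : ℕ) : ‖cTerm n m i j‖ ≤ 256 ^ n * (1 / 4) ^ i := by
  rcases lt_or_ge (n + j) i with hi | hi
  · rw [cTerm, Nat.choose_eq_zero_of_lt hi]
    simp only [Nat.cast_zero, mul_zero, zero_mul, zero_div, norm_zero]
    positivity
  · refine (norm_cTerm_le n m i j).trans ?_
    calc (64 : ℝ) ^ n * (1 / 4) ^ j = 256 ^ n * (1 / 4) ^ (n + j) := by
          rw [pow_add, ← mul_assoc, ← mul_pow]
          norm_num
      _ ≤ 256 ^ n * (1 / 4) ^ i := by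
          gcongr ?_ * ?_
          exact pow_le_pow_of_le_one (by norm_num) (by norm_num) hi

theorem norm_cScaled_le (n m i : ℕ) : ‖cScaled n m i‖ ≤ 256 ^ n * (1 / 4) ^ i :=
  IsUltrametricDist.norm_sum_le_of_forall_le_of_nonneg (by positivity) fun j _ =>
    norm_cTerm_le' n m i j

theorem norm_cScaled_le' (n m i : ℕ) : ‖cScaled n m i‖ ≤ 256 ^ n :=
  (norm_cScaled_le n m i).trans
    (mul_le_of_le_one_right (by positivity) (pow_le_one₀ (by norm_num) (by norm_num)))

theorem continuous_waringCoeff (j : ℕ) : Continuous fun x => waringCoeff x j := by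
  rcases j with _ | j
  · exact continuous_const
  · simp only [waringCoeff]
    exact ((PadicInt.continuous_choose _).comp (by fun_prop)).add
      (continuous_const.mul ((PadicInt.continuous_choose _).comp (by fun_prop)))

theorem tendsto_two_pow_padicInt :
    Filter.Tendsto (fun m : ℕ => (2 : ℤ_[2]) ^ m) Filter.atTop (nhds 0) :=
  tendsto_pow_atTop_nhds_zero_of_norm_lt_one (by
    simpa using PadicInt.norm_natCast_lt_one_iff.2 (dvd_refl 2))

theorem tendsto_fifteen_pow :
    Filter.Tendsto (fun m : ℕ => (15 : ℤ_[2]) ^ (3 * 2 ^ m)) Filter.atTop (nhds 1) := by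
  have h1 : Filter.Tendsto (fun m : ℕ => (15 : ℤ_[2]) ^ (2 ^ m)) Filter.atTop (nhds 1) := by
    rw [tendsto_iff_norm_sub_tendsto_zero]
    have h2 := (tendsto_two_pow_padicInt.comp (Filter.tendsto_add_atTop_nat 1)).norm
    rw [norm_zero] at h2
    refine squeeze_zero (fun m => norm_nonneg _) (fun m => ?_) h2
    obtain ⟨w, hw⟩ := exists_one_add_two_mul_pow (7 : ℤ_[2]) m
    rw [show (15 : ℤ_[2]) = 1 + 2 * 7 by norm_num, hw, add_sub_cancel_left, norm_mul]
    exact mul_le_of_le_one_right (norm_nonneg _) (PadicInt.norm_le_one w)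
  have h3 := h1.pow 3
  simp only [one_pow, ← pow_mul] at h3
  simpa only [mul_comm 3] using h3

/-- In ℤ₂ the argument 3·2^m - 3n tends to -3n and 15^(3·2^m) tends to 1; generalized binomial
coefficients are continuous. -/
theorem tendsto_cTerm (n i j : ℕ) : ∃ l, Filter.Tendsto (fun m => cTerm n m i j) Filter.atTop
    (nhds l) := by
  have hc : Continuous ((↑) : ℤ_[2] → ℚ_[2]) := continuous_subtype_val
  have h1 := (hc.tendsto _).comp tendsto_fifteen_pow
  have h2 : Filter.Tendsto (fun m : ℕ => ((waringCoeff (3 * 2 ^ m - 3 * n) j : ℤ_[2]) : ℚ_[2]))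
      Filter.atTop (nhds (waringCoeff (3 * 0 - 3 * n) j : ℤ_[2])) :=
    ((hc.comp (continuous_waringCoeff j)).tendsto _).comp
      ((tendsto_two_pow_padicInt.const_mul 3).sub_const (3 * n : ℤ_[2]))
  refine ⟨_, ((((h1.mul_const ((-1 : ℚ_[2]) ^ i)).mul_const ((n + j).choose i : ℚ_[2])).mul
    h2).mul_const ((-256 : ℚ_[2]) ^ j)).div_const (1728 ^ (n + j)) |>.congr fun m => ?_⟩
  have h15 : (((15 : ℤ_[2]) ^ (3 * 2 ^ m) : ℤ_[2]) : ℚ_[2]) = 15 ^ (3 * 2 ^ m) := by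
    rw [PadicInt.coe_pow]
    exact congrArg (· ^ _) (map_ofNat (PadicInt.Coe.ringHom (p := 2)) 15)
  rw [cTerm, ← h15]
  rfl

theorem tendsto_cScaled_sub (n i : ℕ) : Filter.Tendsto
    (fun m => cScaled n (m + 1) i - cScaled n m i) Filter.atTop (nhds 0) := by
  have hpow : Filter.Tendsto (fun m : ℕ => 2 ^ m) Filter.atTop Filter.atTop :=
    tendsto_pow_atTop_atTop_of_one_lt one_lt_two
  have hmono : Monotone fun m : ℕ => 2 ^ m + 1 - n := fun a b hab =>
    Nat.sub_le_sub_right (Nat.add_le_add_right (Nat.pow_le_pow_right two_pos hab) 1) n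
  -- The range is built into the terms because `cTerm` need not vanish beyond it.
  refine Filter.Tendsto.congr (fun m => ?_) (tendsto_sum_sub (C := 64 ^ n)
    (u := fun m j => if j < 2 ^ m + 1 - n then cTerm n m i j else 0)
    (K := fun m => 2 ^ m + 1 - n) (fun m j => ?_) (fun j => ?_) hmono
    (Filter.Eventually.of_forall fun m j hj => if_neg (not_lt.2 hj)))
  · rw [cScaled, cScaled]
    congr 1 <;> exact Finset.sum_congr rfl fun j hj => if_pos (Finset.mem_range.1 hj)
  · split_ifs
    · exact norm_cTerm_le n m i j
    · rw [norm_zero]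
      positivity
  · obtain ⟨l, hl⟩ := tendsto_cTerm n i j
    have h1 := (hl.comp (Filter.tendsto_add_atTop_nat 1)).sub hl
    rw [sub_self] at h1
    refine h1.congr' ?_
    filter_upwards [hpow.eventually_ge_atTop (j + n)] with m hm
    have := hmono m.le_succ
    rw [if_pos (by rw [Nat.succ_eq_add_one] at this; omega), if_pos (by omega)]
    rfl

/-! ### Estimates for the states -/

theorem supNorm_sum_le {ι : Type*} {s : Finset ι} {f : ι → Heis} {C : ℝ≥0}
    (h : ∀ i ∈ s, supNorm (f i) ≤ C) : supNorm (∑ i ∈ s, f i) ≤ C :=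
  Finset.sum_induction f (fun v => supNorm v ≤ C)
    (fun v w hv hw => (supNorm_add_le_max v w).trans (max_le hv hw)) (by simp [supNorm_zero]) h

theorem supNorm_mul_le (u v : Heis) : supNorm (u * v) ≤ supNorm u * supNorm v := by
  classical
  refine supNorm_le_iff.2 fun I => ?_
  rw [MvPolynomial.coeff_mul]
  refine IsUltrametricDist.nnnorm_sum_le_of_forall_le fun p _ => ?_
  rw [nnnorm_mul]
  exact mul_le_mul' (nnnorm_coeff_le u _) (nnnorm_coeff_le v _)

theorem supNorm_one_le : supNorm 1 ≤ 1 := norm_monomial_one 0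

theorem supNorm_mul_le_one {u v : Heis} (hu : supNorm u ≤ 1) (hv : supNorm v ≤ 1) :
    supNorm (u * v) ≤ 1 :=
  (supNorm_mul_le u v).trans (mul_le_one' hu hv)

theorem supNorm_pow_le_one {u : Heis} (hu : supNorm u ≤ 1) (k : ℕ) : supNorm (u ^ k) ≤ 1 := by
  induction k with
  | zero => simpa using supNorm_one_le
  | succ k ih => exact pow_succ u k ▸ supNorm_mul_le_one ih hu

theorem odd_doubleFactorial (k : ℕ) : Odd (2 * k - 1)‼ := by
  induction k with
  | zero => decide
  | succ k ih => exact doubleFactorial_two_mul_succ k ▸ (odd_two_mul_add_one k).mul ih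

/-- The double factorials (2l-1)‼ are odd, hence units in ℤ₂, so `evenPower` preserves integrality.
-/
theorem supNorm_evenPower_map_le {x : Heis} (hx : supNorm x ≤ 1) (p : Polynomial ℤ) :
    supNorm (evenPower x (p.map (Int.castRingHom ℚ_[2]))) ≤ 1 := by
  induction p using Polynomial.induction_on' with
  | add p q hp hq =>
    rw [Polynomial.map_add, map_add]
    exact (supNorm_add_le_max _ _).trans (max_le hp hq)
  | monomial l a =>
    have hd : ‖(((2 * l - 1)‼ : ℕ) : ℚ_[2])⁻¹‖₊ = 1 := by
      rw [nnnorm_inv, inv_eq_one]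
      exact NNReal.eq (norm_odd_natCast (odd_doubleFactorial l))
    have ha : ‖(a : ℚ_[2])‖₊ ≤ 1 := Padic.norm_int_le_one a
    rw [Polynomial.map_monomial, ← Polynomial.C_mul_X_pow_eq_monomial, ← Polynomial.smul_eq_C_mul,
      map_smul, evenPower_X_pow, supNorm_smul, supNorm_smul, hd, one_mul]
    exact mul_le_one' ha (supNorm_pow_le_one hx _)

theorem evenPower_comp (c : ℚ_[2]) (x : Heis) (p : Polynomial ℚ_[2]) :
    evenPower x (p.comp (Polynomial.C (c ^ 2) * Polynomial.X)) = evenPower (c • x) p := by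
  induction p using Polynomial.induction_on' with
  | add p q hp hq => rw [Polynomial.add_comp, map_add, map_add, hp, hq]
  | monomial l a =>
    rw [← Polynomial.C_mul_X_pow_eq_monomial, Polynomial.mul_comp, Polynomial.C_comp,
      Polynomial.X_pow_comp, mul_pow, ← map_pow, ← Polynomial.smul_eq_C_mul,
      ← Polynomial.smul_eq_C_mul, ← Polynomial.smul_eq_C_mul, map_smul, map_smul, map_smul,
      evenPower_X_pow, evenPower_X_pow, smul_pow, pow_mul c, smul_comm (((2 * l - 1)‼ : ℚ_[2])⁻¹)]

theorem supNorm_X_le (k : ℕ) : supNorm (MvPolynomial.X k) ≤ 1 := norm_monomial_one _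

theorem supNorm_linState_le {x : ℕ → ℚ_[2]} (hx : ∀ a ∈ Finset.range 3, ‖x a‖₊ ≤ 1) :
    supNorm (linState x) ≤ 1 :=
  supNorm_sum_le fun a ha => by
    rw [supNorm_smul]
    exact mul_le_one' (hx a ha) (supNorm_X_le a)

theorem supNorm_stateA_le : supNorm stateA ≤ 1 :=
  supNorm_linState_le fun a _ => by
    rw [coeffA]
    split_ifs <;> simp

theorem supNorm_two_smul_stateB_le : supNorm ((2 : ℚ_[2]) • stateB) ≤ 1 := by
  have h : (2 : ℚ_[2]) • stateB = linState fun a => 2 * coeffB a := by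
    simp [stateB, linState, Finset.smul_sum, smul_smul]
  have h3 : ‖(3 : ℚ_[2])‖₊ ≤ 1 := Padic.norm_int_le_one (p := 2) 3
  have h2 : ‖(2 : ℚ_[2])‖₊ ≤ 1 := Padic.norm_int_le_one (p := 2) 2
  rw [h]
  refine supNorm_linState_le fun a _ => ?_
  rw [coeffB]
  split_ifs
  · simp
  · rwa [mul_div_cancel₀ _ (two_ne_zero (α := ℚ_[2]))]
  · simpa using h2

/-- `stateB` has denominator 2, but 1008 = 4·252: the factor 2² of X can be moved into the state as
`2 • stateB`, which is integral. -/
theorem supNorm_evenPower_B_le (s : ℕ) :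
    supNorm (evenPower stateB ((1008 * Polynomial.X - 1) ^ s)) ≤ 1 := by
  have h : (1008 * Polynomial.X - 1 : Polynomial ℚ_[2]) ^ s =
      (((252 * Polynomial.X - 1 : Polynomial ℤ) ^ s).map (Int.castRingHom ℚ_[2])).comp
        (Polynomial.C (2 ^ 2) * Polynomial.X) := by
    have h2 : (Polynomial.C (2 : ℚ_[2])) = 2 := map_ofNat _ 2
    simp only [Polynomial.map_pow, Polynomial.map_sub, Polynomial.map_mul, Polynomial.map_X,
      Polynomial.map_one, Polynomial.map_ofNat, Polynomial.pow_comp, Polynomial.sub_comp,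
      Polynomial.mul_comp, Polynomial.X_comp, Polynomial.one_comp, Polynomial.ofNat_comp, map_pow,
      h2]
    ring
  rw [h, evenPower_comp]
  exact supNorm_evenPower_map_le supNorm_two_smul_stateB_le _

theorem map_one_sub_pow (r : ℕ) : ((1 - 120 * Polynomial.X : Polynomial ℤ) ^ r).map
    (Int.castRingHom ℚ_[2]) = (1 - 120 * Polynomial.X) ^ r := by
  simp

theorem supNorm_unitState_le (r s : ℕ) : supNorm (unitState r s) ≤ 1 := by
  rw [unitState, ← map_one_sub_pow]
  exact supNorm_mul_le_one (supNorm_evenPower_map_le supNorm_stateA_le _) (supNorm_evenPower_B_le s)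

theorem supNorm_unitState_sub_le (r m s : ℕ) :
    supNorm (unitState (r + 3 * 2 ^ m) s - unitState r s) ≤ (1 / 2) ^ (m + 1) := by
  -- The argument is half of (1 - 120X)³ - 1. The congruence (1 - 120X)^(3·2^m) ≡ 1 modulo 2^(m+1)
  -- already holds in ℤ[X], and `evenPower` transports it to states.
  obtain ⟨w, hw⟩ := exists_one_add_two_mul_pow
    (-180 * Polynomial.X + 21600 * Polynomial.X ^ 2 - 864000 * Polynomial.X ^ 3 : Polynomial ℤ) m
  have h1 : (1 - 120 * Polynomial.X : Polynomial ℤ) ^ (r + 3 * 2 ^ m) -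
      (1 - 120 * Polynomial.X) ^ r = 2 ^ (m + 1) * (w * (1 - 120 * Polynomial.X) ^ r) := by
    rw [pow_add, pow_mul, show (1 - 120 * Polynomial.X : Polynomial ℤ) ^ 3 = 1 + 2 *
      (-180 * Polynomial.X + 21600 * Polynomial.X ^ 2 - 864000 * Polynomial.X ^ 3) by ring, hw]
    ring
  have h2 := congrArg (Polynomial.map (Int.castRingHom ℚ_[2])) h1
  have h3 : (2 : Polynomial ℚ_[2]) = Polynomial.C 2 := (map_ofNat _ 2).symm
  rw [Polynomial.map_sub, map_one_sub_pow, map_one_sub_pow, Polynomial.map_mul, Polynomial.map_pow,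
    Polynomial.map_ofNat, h3, ← map_pow, ← Polynomial.smul_eq_C_mul] at h2
  rw [unitState, unitState, ← sub_mul, ← map_sub, h2, map_smul, smul_mul_assoc, supNorm_smul,
    nnnorm_pow]
  have h4 : ‖(2 : ℚ_[2])‖₊ = 1 / 2 := NNReal.eq norm_two_padic
  rw [h4]
  exact mul_le_of_le_one_right' (supNorm_mul_le_one
    (supNorm_evenPower_map_le supNorm_stateA_le _) (supNorm_evenPower_B_le s))

instance : IsUltrametricDist NormedHeis :=
  IsUltrametricDist.isUltrametricDist_of_forall_norm_add_le_max_norm fun v w =>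
    supNorm_add_le_max v w

end HeisenbergTwoAdic
end

noncomputable section
namespace HeisenbergTwoAdic
open scoped Nat NNReal PowerSeries

/-! ### Convergence of the pre-images -/

/-- A state, as an element of the normed space of states. -/
def toNormed : Heis →ₗ[ℚ_[2]] NormedHeis := LinearMap.id

theorem norm_toNormed (v : Heis) : ‖toNormed v‖ = supNorm v := rfl

theorem norm_smul_unitState_le (c : ℚ_[2]) (r s : ℕ) :
    ‖toNormed (c • unitState r s)‖ ≤ ‖c‖ := by
  rw [map_smul, norm_smul, norm_toNormed]
  exact mul_le_of_le_one_right (norm_nonneg _) (supNorm_unitState_le r s)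

theorem tendsto_half_pow :
    Filter.Tendsto (fun m : ℕ => (1 / 2 : ℝ) ^ (m + 1)) Filter.atTop (nhds 0) :=
  (tendsto_pow_atTop_nhds_zero_of_lt_one (by norm_num) (by norm_num)).comp
    (Filter.tendsto_add_atTop_nat 1)

theorem tendsto_two_pow_atTop : Filter.Tendsto (fun m : ℕ => 2 ^ m) Filter.atTop Filter.atTop :=
  tendsto_pow_atTop_atTop_of_one_lt one_lt_two

theorem norm_smul_sub_smul_le (n m i r s : ℕ) :
    ‖toNormed (cScaled n (m + 1) i • unitState (r + 3 * 2 ^ m) s -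
      cScaled n m i • unitState r s)‖ ≤
      max (256 ^ n * (1 / 2) ^ (m + 1)) ‖cScaled n (m + 1) i - cScaled n m i‖ := by
  have h : cScaled n (m + 1) i • unitState (r + 3 * 2 ^ m) s - cScaled n m i • unitState r s =
      cScaled n (m + 1) i • (unitState (r + 3 * 2 ^ m) s - unitState r s) +
        (cScaled n (m + 1) i - cScaled n m i) • unitState r s := by
    rw [smul_sub, sub_smul]
    abel
  rw [h, map_add]
  refine (IsUltrametricDist.norm_add_le_max _ _).trans
    (max_le_max ?_ (norm_smul_unitState_le _ _ _))
  rw [map_smul, norm_smul, norm_toNormed]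
  have h2 : (supNorm (unitState (r + 3 * 2 ^ m) s - unitState r s) : ℝ) ≤ (1 / 2) ^ (m + 1) := by
    exact_mod_cast supNorm_unitState_sub_le r m s
  exact mul_le_mul (norm_cScaled_le' _ _ _) h2 (NNReal.coe_nonneg _) (by positivity)

theorem tendsto_preimage_sub (n : ℕ) : Filter.Tendsto
    (fun m => toNormed (preimage n (m + 1)) - toNormed (preimage n m)) Filter.atTop (nhds 0) := by
  have h := tendsto_sum_sub (E := NormedHeis) (C := 256 ^ n)
    (u := fun m i => toNormed (cScaled n m i • unitState (3 * 2 ^ m - 3 * i) (2 * i)))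
    (K := fun m => 2 ^ m + 2)
    (fun m i => (norm_smul_unitState_le _ _ _).trans (norm_cScaled_le n m i)) (fun i => ?_)
    (fun a b hab => Nat.add_le_add_right (Nat.pow_le_pow_right two_pos hab) 2) ?_
  · refine h.congr' ?_
    filter_upwards [tendsto_two_pow_atTop.eventually_gt_atTop n] with m hm
    rw [preimage_eq hm, preimage_eq (hm.trans (Nat.pow_lt_pow_succ one_lt_two)), map_sum, map_sum]
  · rw [tendsto_zero_iff_norm_tendsto_zero]
    have h1 : Filter.Tendsto (fun m : ℕ => max (256 ^ n * (1 / 2 : ℝ) ^ (m + 1))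
        ‖cScaled n (m + 1) i - cScaled n m i‖) Filter.atTop (nhds 0) := by
      have := (tendsto_half_pow.const_mul (256 ^ n : ℝ)).max (tendsto_cScaled_sub n i).norm
      simpa using this
    refine squeeze_zero' (Filter.Eventually.of_forall fun m => norm_nonneg _) ?_ h1
    filter_upwards [tendsto_two_pow_atTop.eventually_ge_atTop i] with m hm
    -- The bound i ≤ 2^m makes the natural subtraction exact, so that passing from m to m + 1 raises
    -- r by 3·2^m.
    rw [← map_sub, show 3 * 2 ^ (m + 1) - 3 * i = 3 * 2 ^ m - 3 * i + 3 * 2 ^ m by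
      rw [pow_succ]; omega]
    exact norm_smul_sub_smul_le n m i _ _
  · filter_upwards [tendsto_two_pow_atTop.eventually_gt_atTop n] with m hm i hi
    rw [cScaled_eq_zero hm.le (by omega), zero_smul, map_zero]

/-- In a nonarchimedean group it is enough that consecutive differences tend to zero. -/
theorem cauchySeq_preimage (n : ℕ) : CauchySeq fun m => toComplete (preimage n m) := by
  have : NonarchimedeanAddGroup NormedHeis := inferInstance
  exact (NonarchimedeanAddGroup.cauchySeq_of_tendsto_sub_nhds_zero
    (tendsto_preimage_sub n)).map (UniformSpace.Completion.uniformContinuous_coe NormedHeis)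

/-- Each q-coefficient is a continuous function on S₁, so its value at the limit state is the 2-adic
limit of the coefficients of the characters. -/
theorem characterHat_eq_of_tendsto {n : ℕ} {v : HeisComplete}
    (hv : Filter.Tendsto (fun m => toComplete (preimage n m)) Filter.atTop (nhds v)) (N : ℕ) :
    characterHat v N = PowerSeries.coeff N (hauptmodul ^ n) := by
  have h1 : Continuous fun v : HeisComplete => characterHat v N :=
    (continuous_eval_const N).comp characterHat.continuous
  refine tendsto_nhds_unique ((h1.tendsto v).comp hv)
    ((tendsto_coeff_character_preimage n N).congr fun m => ?_)
  rw [Function.comp_apply, characterHat_toComplete]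
  rfl

/-! ### The congruences between the coefficients -/

theorem le_stateVal {v : Heis} {k : ℤ} (h : (supNorm v : ℝ) ≤ 2 ^ (-k)) :
    (k : WithTop ℤ) ≤ stateVal v := by
  refine Finset.le_inf fun I hI => ?_
  have h0 := MvPolynomial.mem_support_iff.1 hI
  have h1 := (norm_coeff_le v I).trans h
  rw [Padic.norm_eq_zpow_neg_valuation h0] at h1
  rw [Padic.addValuation.apply h0, WithTop.coe_le_coe]
  have h2 := (zpow_le_zpow_iff_right₀ (by norm_num : (1 : ℝ) < (2 : ℕ))).1
    (by exact_mod_cast h1 : ((2 : ℕ) : ℝ) ^ (-(MvPolynomial.coeff I v).valuation) ≤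
      ((2 : ℕ) : ℝ) ^ (-k))
  omega

/-- α_{3·2^m} carries the factor 240^(-3·2^m), which compensates the change in the power of 240 from
m to m + 1. Both terms then share one scalar. -/
theorem cCoeff_smul_alpha_sub {n m : ℕ} (h : n < 2 ^ m) (i : ℕ) :
    cCoeff n (m + 1) i • alpha (3 * 2 ^ m) - cCoeff n m i • (1 : Heis) =
      ((240 : ℚ_[2]) ^ (3 * 2 ^ m - 3 * i : ℤ) * 504 ^ (2 * i)) •
        (cScaled n (m + 1) i • unitState (0 + 3 * 2 ^ m) 0 - cScaled n m i • unitState 0 0) := by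
  have h240 : (240 : ℚ_[2]) ≠ 0 := by norm_num
  have h1 : alpha (3 * 2 ^ m) = ((240 : ℚ_[2]) ^ (3 * 2 ^ m : ℤ))⁻¹ • unitState (0 + 3 * 2 ^ m) 0 := by
    have h2 := alphaBeta_eq_smul (3 * 2 ^ m) 0
    rw [alphaBeta_eq, pow_zero, evenPower_one, mul_one, ← alpha_eq, pow_zero, mul_one] at h2
    rw [h2, zero_add, ← zpow_natCast]
    push_cast
    rfl
  have h3 : unitState 0 0 = 1 := by simp [unitState, evenPower_one]
  have h4 : (240 : ℚ_[2]) ^ (3 * 2 ^ (m + 1) - 3 * i : ℤ) =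
      240 ^ (3 * 2 ^ m - 3 * i : ℤ) * 240 ^ (3 * 2 ^ m : ℤ) := by
    rw [← zpow_add₀ h240]
    congr 1
    ring
  rw [h1, h3, cCoeff_eq h, cCoeff_eq (h.trans (Nat.pow_lt_pow_succ one_lt_two)), smul_sub,
    smul_smul, smul_smul, smul_smul, h4]
  congr 2
  field_simp

/-- The common scalar has valuation 4(3·2^m - 3i) + 3·2i = 12·2^m - 6i, and the remaining difference
tends to 0 uniformly in i. -/
theorem eventually_le_stateVal (n : ℕ) (B : ℤ) : ∀ᶠ m : ℕ in Filter.atTop, ∀ i : ℕ,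
    ((B + 12 * 2 ^ m - 6 * (i : ℤ) : ℤ) : WithTop ℤ) ≤
      stateVal (cCoeff n (m + 1) i • alpha (3 * 2 ^ m) - cCoeff n m i • (1 : Heis)) := by
  have hB : (0 : ℝ) < 2 ^ (-B) := by positivity
  have h1 := eventually_forall_norm_le (E := ℚ_[2]) (C := 256 ^ n)
    (fun m i => (norm_sub_le_max _ _).trans
      (max_le (norm_cScaled_le n (m + 1) i) (norm_cScaled_le n m i)))
    (tendsto_cScaled_sub n) hB
  have h2 : Filter.Tendsto (fun m : ℕ => 256 ^ n * (1 / 2 : ℝ) ^ (m + 1)) Filter.atTop (nhds 0) := by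
    simpa using tendsto_half_pow.const_mul (256 ^ n : ℝ)
  filter_upwards [h1, h2.eventually (ge_mem_nhds hB),
    tendsto_two_pow_atTop.eventually_gt_atTop n] with m hm1 hm2 hm i
  rw [cCoeff_smul_alpha_sub hm]
  refine le_stateVal ?_
  have h3 := (norm_smul_sub_smul_le n m i 0 0).trans (max_le hm2 (hm1 i))
  have h4 : ‖(240 : ℚ_[2]) ^ (3 * 2 ^ m - 3 * i : ℤ) * 504 ^ (2 * i)‖ =
      (2 : ℝ) ^ (-(12 * 2 ^ m - 6 * i : ℤ)) := by
    rw [norm_mul, norm_zpow, norm_pow, norm_240, norm_504, one_div, inv_pow, inv_pow, inv_zpow,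
      inv_pow, ← zpow_natCast, ← zpow_natCast, ← zpow_natCast, ← zpow_mul, ← zpow_mul, ← mul_inv,
      ← zpow_add₀ two_ne_zero, ← zpow_neg]
    congr 1
    push_cast
    ring
  rw [← norm_toNormed, map_smul, norm_smul, h4,
    show -(B + 12 * 2 ^ m - 6 * (i : ℤ)) = -(12 * 2 ^ m - 6 * i : ℤ) + -B by ring,
    zpow_add₀ two_ne_zero]
  gcongr

end HeisenbergTwoAdic
end

/-! ### The main theorem. -/

theorem mainTheorem7 (n : ℕ) (hn : 1 ≤ n) :
    (∀ B : ℤ, ∃ m₀ : ℕ, ∀ m ≥ m₀, ∀ i : ℕ, i ≤ 2 ^ m + 1 →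
      ((B + 12 * 2 ^ m - 6 * (i : ℤ) : ℤ) : WithTop ℤ) ≤
        HeisenbergTwoAdic.stateVal
          (HeisenbergTwoAdic.cCoeff n (m + 1) i • HeisenbergTwoAdic.alpha (3 * 2 ^ m) -
            HeisenbergTwoAdic.cCoeff n m i • (1 : HeisenbergTwoAdic.Heis))) ∧
    CauchySeq (fun m : ℕ =>
      HeisenbergTwoAdic.toComplete (HeisenbergTwoAdic.preimage n m)) ∧
    ∃ v : HeisenbergTwoAdic.HeisComplete,
      Filter.Tendsto (fun m : ℕ =>
        HeisenbergTwoAdic.toComplete (HeisenbergTwoAdic.preimage n m))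
        Filter.atTop (nhds v) ∧
      ∀ N : ℕ, HeisenbergTwoAdic.characterHat v N =
        PowerSeries.coeff N (HeisenbergTwoAdic.hauptmodul ^ n) := by
  refine ⟨fun B => ?_, HeisenbergTwoAdic.cauchySeq_preimage n, ?_⟩
  · obtain ⟨m₀, h⟩ := Filter.eventually_atTop.1 (HeisenbergTwoAdic.eventually_le_stateVal n B)
    exact ⟨m₀, fun m hm i _ => h m hm i⟩
  · obtain ⟨v, hv⟩ := cauchySeq_tendsto_of_complete (HeisenbergTwoAdic.cauchySeq_preimage n)
    exact ⟨v, hv, HeisenbergTwoAdic.characterHat_eq_of_tendsto hv⟩
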